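/- Let $X$ be a separable real Banach space and $\mu$ a centered non-degenerate Gaussian measure on $X$ (every $L\in X^*\setminus\{0\}$ has mean $0$ and positive variance). Let $X^*_\mu$ be the closure of $X^*$ in $L^2(X,\mu)$ and let $H$ be the Cameron–Martin space, i.e. the vectors $h=R_\mu\hat h=\int_X \hat h(x)\,x\,d\mu(x)$ with $\hat h\in X^*_\mu$ and $|h|_H=\|\hat h\|_{L^2(X,\mu)}$; for $x^*\in X^*$ let $h_{x^*}\in H$ be the vector with $x^*(h)=\langle h_{x^*},h\rangle_H$ for all $h\in H$. Let $\nabla_H,\nabla_H^2$ be the first and second derivative along $H$, and $\mathcal H_2$ the space of Hilbert–Schmidt operators on $H$. For $\Omega\subseteq X$ let $W^{2,2}(\Omega,\mu)$ be the domain of the closure in $L^2(\Omega,\mu)$ of $(\nabla_H,\nabla_H^2)$, defined on the restrictions to $\Omega$ of the smooth cylindrical functions $\varphi(x_1^*,\dots,x_n^*)$ with $\varphi\in C_b^\infty(\mathbb R^n)$, with the norm $$\|u\|_{W^{2,2}(\Omega,\mu)}=\|u\|_{L^2(\Omega,\mu)}+\|\nabla_H u\|_{L^2(\Omega,\mu;H)}+\|\nabla_H^2u\|_{L^2(\Omega,\mu;\mathcal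 H_2)} ;$$ $W^{1,2}(\Omega,\mu)$ is defined in the same way with $\nabla_H$ only. Let $x^*\in X^*\setminus\{0\}$, $r\in\mathbb R$, $G(x)=x^*(x)-r$ and $\Omega=\{x\in X: x^*(x)\le r\}$. Let $\rho$ be the Hausdorff–Gauss surface measure of Feyel and de La Pradelle, and let $\operatorname{Tr}$ be the trace on $G^{-1}(0)$ of functions in $W^{1,2}(\Omega,\mu)$ (the limit in $L^1(G^{-1}(0),\rho)$ of the restrictions of bounded Lipschitz functions on $\Omega$ that converge in $W^{1,2}(\Omega,\mu)$), taken componentwise in an orthonormal basis of $H$ for $H$-valued functions. Put $$W^{2,2}_{0,N}(\Omega,\mu)=\{u\in W^{2,2}(\Omega,\mu): x^*(\operatorname{Tr}(\nabla_Hu)(x))=0 \text{ for } \rho\text{-a.e. } x\in G^{-1}(0)\}.$$ Then there exists a Neumann extension operator from $W^{2,2}_{0,N}(\Omega,\mu)$ to $W^{2,2}(X,\mu)$: a linear operator $E:W^{2,2}_{0,N}(\Omega,\mu)\to W^{2,2}(X,\mu)$ and a constant $K>0$ such that, for every $u\in W^{2,2}_{0,N}(\Omega,\mu)$, $$Eu(x)=u(x)\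 \text{ for } \mu\text{-a.e. } x\in\Omega,\qquad \|Eu\|_{W^{2,2}(X,\mu)}\le K\|u\|_{W^{2,2}(\Omega,\mu)}.$$ Moreover $E$ can be chosen so that, for some real numbers $a_j,b_j,c_j$ ($1\le j\le 7$) and every $u\in W^{2,2}_{0,N}(\Omega,\mu)$, $$Eu(x)=\sum_{j=1}^7 a_j\,u\Big(x-(j+1)G(x)\frac{h_{x^*}}{|h_{x^*}|_H^2}\Big)\exp\Big(-\frac{c_jG(x)+b_jG(x)^2}{2|h_{x^*}|_H}\Big)\quad\text{for } \mu\text{-a.e. } x \text{ with } G(x)>0 .$$ -/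

import Mathlib

open MeasureTheory ProbabilityTheory Filter Topology Set
open scoped ENNReal NNReal ContDiff InnerProductSpace

noncomputable section

namespace GaussSobolev

section CameronMartin

variable {X : Type*} [NormedAddCommGroup X] [NormedSpace ℝ X] [MeasurableSpace X] [BorelSpace X]

/-- The closure `X*_μ` of `X*` in `L²(X, μ)`. -/
def dualClosure (μ : Measure X) : Submodule ℝ (Lp ℝ 2 μ) :=
  (LinearMap.range (StrongDual.toLp (𝕜 := ℝ) μ 2).toLinearMap).topologicalClosure

/-- The Cameron–Martin space of `μ`. The vector `h` of `X` and its representative `ĥ` in `X*_μ`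
determine each other by `h = R_μ ĥ`, and `|h|_H` is the `L²`-norm of `ĥ`; an element of `CM μ` is
given by `ĥ`, and the vector `h` of `X` is `emb μ h` below. -/
def CM (μ : Measure X) : Type _ := dualClosure μ

instance (μ : Measure X) : NormedAddCommGroup (CM μ) :=
  inferInstanceAs (NormedAddCommGroup (dualClosure μ))

instance (μ : Measure X) : InnerProductSpace ℝ (CM μ) :=
  inferInstanceAs (InnerProductSpace ℝ (dualClosure μ))

instance (μ : Measure X) : CompleteSpace (CM μ) :=
  Submodule.topologicalClosure.completeSpace _

/-- The function `ĥ` on `X`, a version of an element of `L²(X, μ)`. -/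
def hat {μ : Measure X} (h : CM μ) : X → ℝ := (Subtype.val h : Lp ℝ 2 μ)

/-- The inclusion `R_μ` of the Cameron–Martin space into `X`, `h = ∫ ĥ(x) x μ(dx)`. -/
def emb (μ : Measure X) (h : CM μ) : X := ∫ x, hat h x • x ∂μ

/-- The vector of the Cameron–Martin space that represents `x*`, that is
`x*(h) = ⟨h_{x*}, h⟩` for every `h` of the Cameron–Martin space (see `dual_emb`). -/
def rep (μ : Measure X) (xs : StrongDual ℝ X) : CM μ :=
  (⟨StrongDual.toLp (𝕜 := ℝ) μ 2 xs,
    Submodule.le_topologicalClosure _ (LinearMap.mem_range_self _ xs)⟩ : dualClosure μ)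

theorem dual_emb [CompleteSpace X] [SecondCountableTopology X] (μ : Measure X) [IsGaussian μ]
    (xs : StrongDual ℝ X) (h : CM μ) : xs (emb μ h) = ⟪rep μ xs, h⟫_ℝ := by
  have h2 : MemLp (id : X → X) 2 μ := IsGaussian.memLp_two_id
  have hint : Integrable (fun x => hat h x • x) μ :=
    memLp_one_iff_integrable.1 (h2.smul (Lp.memLp (Subtype.val h : Lp ℝ 2 μ)))
  have hin : ⟪rep μ xs, h⟫_ℝ
      = ⟪StrongDual.toLp (𝕜 := ℝ) μ 2 xs, (Subtype.val h : Lp ℝ 2 μ)⟫_ℝ := rfl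
  rw [emb, ← ContinuousLinearMap.integral_comp_comm xs hint, hin, MeasureTheory.L2.inner_def]
  apply integral_congr_ae
  have e : (StrongDual.toLp (𝕜 := ℝ) μ 2 xs : X → ℝ) =ᵐ[μ] xs := by
    rw [StrongDual.toLp_apply h2]
    exact MemLp.coeFn_toLp _
  filter_upwards [e] with x hx
  simp [hat, hx]

/-- The gradient along `H`: the vector `v` with `f (x + h) = f x + ⟨v, h⟩ + o(|h|)`
for `h` in the Cameron–Martin space. -/
def gradH (μ : Measure X) (f : X → ℝ) (x : X) : CM μ :=
  gradient (fun h : CM μ => f (x + emb μ h)) 0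

/-- The second derivative along `H`: the derivative of `h ↦ gradH f (x + h)` at `0`. -/
def hessH (μ : Measure X) (f : X → ℝ) (x : X) : CM μ →L[ℝ] CM μ :=
  fderiv ℝ (fun h : CM μ => gradH μ f (x + emb μ h)) 0

end CameronMartin

/-- The smooth cylindrical functions `φ(x*_1, …, x*_n)`, where `φ` and all its derivatives
are bounded. -/
def IsFCbInf {X : Type*} [NormedAddCommGroup X] [NormedSpace ℝ X] (f : X → ℝ) : Prop :=
  ∃ (n : ℕ) (L : Fin n → StrongDual ℝ X) (φ : (Fin n → ℝ) → ℝ),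
    ContDiff ℝ ∞ φ ∧ (∀ k : ℕ, ∃ C : ℝ, ∀ y, ‖iteratedFDeriv ℝ k φ y‖ ≤ C) ∧
      f = fun x => φ (fun i => L i x)

section Sobolev

variable {X : Type*} [NormedAddCommGroup X] [NormedSpace ℝ X] [MeasurableSpace X] [BorelSpace X]
variable {ι : Type*}

/-- The Hilbert–Schmidt operators on `H`, described by an orthonormal basis `(b i)`: the
operator `A` is the square summable family `(A (b i))`, and its norm is
`(∑ i, ‖A (b i)‖²)^(1/2)`. -/
abbrev HS (μ : Measure X) (ι : Type*) : Type _ := lp (fun _ : ι => CM μ) 2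

/-- `W^{1,2}(ν)`, where `ν` is `μ` or the restriction of `μ` to a subset: the closure in
`L²(ν) × L²(ν; H)` of the pairs `(f, ∇_H f)` with `f` smooth cylindrical. The elements are the
pairs `(u, ∇_H u)`. -/
def W12 (μ ν : Measure X) : Submodule ℝ (Lp ℝ 2 ν × Lp (CM μ) 2 ν) :=
  (Submodule.span ℝ {p | ∃ f : X → ℝ, IsFCbInf f ∧ p.1 =ᵐ[ν] f ∧
    p.2 =ᵐ[ν] gradH μ f}).topologicalClosure

/-- `W^{2,2}(ν)`, where `ν` is `μ` or the restriction of `μ` to a subset: the closure in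
`L²(ν) × L²(ν; H) × L²(ν; 𝓗₂)` of the triples `(f, ∇_H f, ∇_H² f)` with `f` smooth cylindrical,
that is, the graph of the closure of `(∇_H, ∇_H²)`. The elements are the triples
`(u, ∇_H u, ∇_H² u)`. -/
def W22 (μ ν : Measure X) (b : HilbertBasis ι ℝ (CM μ)) :
    Submodule ℝ (Lp ℝ 2 ν × Lp (CM μ) 2 ν × Lp (HS μ ι) 2 ν) :=
  (Submodule.span ℝ {p | ∃ f : X → ℝ, IsFCbInf f ∧ p.1 =ᵐ[ν] f ∧ p.2.1 =ᵐ[ν] gradH μ f ∧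
    ∀ᵐ x ∂ν, ∀ i, p.2.2 x i = hessH μ f x (b i)}).topologicalClosure

variable {μ ν : Measure X} {b : HilbertBasis ι ℝ (CM μ)}

/-- The function underlying an element of `W^{2,2}(ν)`. -/
def W22.fn (u : W22 μ ν b) : X → ℝ := u.1.1

/-- The gradient along `H` of an element of `W^{2,2}(ν)`. -/
def W22.grad (u : W22 μ ν b) : X → CM μ := u.1.2.1

/-- The norm `‖u‖_{L²} + ‖∇_H u‖_{L²} + ‖∇_H² u‖_{L²}` of `W^{2,2}(ν)`. -/
def W22.sobNorm (u : W22 μ ν b) : ℝ := ‖u.1.1‖ + ‖u.1.2.1‖ + ‖u.1.2.2‖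

theorem W22.grad_add (u v : W22 μ ν b) :
    W22.grad (u + v) =ᵐ[ν] fun x => W22.grad u x + W22.grad v x :=
  Lp.coeFn_add u.1.2.1 v.1.2.1

theorem W22.grad_smul (c : ℝ) (u : W22 μ ν b) :
    W22.grad (c • u) =ᵐ[ν] fun x => c • W22.grad u x :=
  Lp.coeFn_smul c u.1.2.1

theorem W22.grad_zero : W22.grad (0 : W22 μ ν b) =ᵐ[ν] fun _ => 0 :=
  Lp.coeFn_zero _ _ _

end Sobolev

section Surface

/-- The spherical Hausdorff measure of dimension `d`: coverings by balls of radii `r_i`, weighted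
by `ω_d r_i^d`, where `ω_d` is the volume of the unit ball of `ℝ^d`. -/
def sphericalHausdorff (d : ℕ) (Y : Type*) [MetricSpace Y] [MeasurableSpace Y] [BorelSpace Y] :
    Measure Y :=
  Measure.mkMetric' fun S => ⨅ (c : Y) (r : ℝ≥0) (_ : S ⊆ Metric.closedBall c r),
    volume (Metric.ball (0 : EuclideanSpace ℝ (Fin d)) 1) * (r : ℝ≥0∞) ^ d

/-- The Gauss-weighted spherical measure `(2π)^{-(m+1)/2} exp(-|y|²/2) S^m(dy)` on `ℝ^{m+1}`. -/
def gaussSpherical (m : ℕ) : Measure (EuclideanSpace ℝ (Fin (m + 1))) :=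
  (sphericalHausdorff m (EuclideanSpace ℝ (Fin (m + 1)))).withDensity fun y =>
    ENNReal.ofReal ((2 * Real.pi) ^ (-((m : ℝ) + 1) / 2) * Real.exp (-‖y‖ ^ 2 / 2))

variable {X : Type*} [NormedAddCommGroup X] [NormedSpace ℝ X] [MeasurableSpace X] [BorelSpace X]

/-- `ρ^F(B)` for the subspace `F` of `H` with orthonormal basis `e`: with
`P_F x = ∑ i, ê_i(x) e_i`, the integral over `x` of the Gauss-weighted spherical measure of the
section `{y ∈ F | (x - P_F x) + y ∈ B}`. -/
def surfaceSection (μ : Measure X) {m : ℕ} (e : Fin (m + 1) → CM μ) (B : Set X) : ℝ≥0∞ :=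
  ∫⁻ x, gaussSpherical m {y | x - (∑ i, hat (e i) x • emb μ (e i))
    + ∑ i, y i • emb μ (e i) ∈ B} ∂μ

/-- The Hausdorff–Gauss surface measure of Feyel and de La Pradelle: the supremum of the measures
`ρ^F` over the finite-dimensional subspaces `F ≠ 0` of `H`, that is, the least Borel measure
that is at least `ρ^F` on Borel sets, for every `F`. -/
def surfaceMeasure (μ : Measure X) : Measure X :=
  sInf {σ : Measure X | ∀ (m : ℕ) (e : Fin (m + 1) → CM μ), Orthonormal ℝ e →
    ∀ B : Set X, MeasurableSet B → surfaceSection μ e B ≤ σ B}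

end Surface

section Neumann

variable {X : Type*} [NormedAddCommGroup X] [NormedSpace ℝ X] [MeasurableSpace X] [BorelSpace X]
variable {ι : Type*}

/-- The half-space `{x* ≤ r}`. -/
def halfSpace (xs : StrongDual ℝ X) (r : ℝ) : Set X := {x | xs x ≤ r}

/-- The surface measure on the boundary `{x* = r}` of the half-space. -/
def bdryMeasure (μ : Measure X) (xs : StrongDual ℝ X) (r : ℝ) : Measure X :=
  (surfaceMeasure μ).restrict {x | xs x = r}

/-- `T` is the trace on `{x* = r}` of the function `ψ` of `W^{1,2}(Ω, μ)`, `Ω = {x* ≤ r}`: the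
limit in `L¹` for the surface measure of the restrictions of bounded Lipschitz functions on `Ω`
that converge to `ψ` in `W^{1,2}(Ω, μ)`. -/
def IsTrace (μ : Measure X) (xs : StrongDual ℝ X) (r : ℝ) (ψ T : X → ℝ) : Prop :=
  MemLp T 1 (bdryMeasure μ xs r) ∧
  ∃ (Φ : W12 μ (μ.restrict (halfSpace xs r))) (Φs : ℕ → W12 μ (μ.restrict (halfSpace xs r)))
    (φ : ℕ → X → ℝ),
    Φ.1.1 =ᵐ[μ.restrict (halfSpace xs r)] ψ ∧
    (∀ n, (∃ K, LipschitzOnWith K (φ n) (halfSpace xs r)) ∧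
      (∃ C : ℝ, ∀ x ∈ halfSpace xs r, |φ n x| ≤ C) ∧
      (Φs n).1.1 =ᵐ[μ.restrict (halfSpace xs r)] φ n) ∧
    Tendsto Φs atTop (𝓝 Φ) ∧
    Tendsto (fun n => eLpNorm (φ n - T) 1 (bdryMeasure μ xs r)) atTop (𝓝 0)

/-- `T = ∑ i, Tr(⟨Ψ, b i⟩) b i` is the trace of the `H`-valued function `Ψ`. -/
def IsTraceH {μ : Measure X} (b : HilbertBasis ι ℝ (CM μ)) (xs : StrongDual ℝ X) (r : ℝ)
    (Ψ T : X → CM μ) : Prop :=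
  ∀ i, IsTrace μ xs r (fun x => ⟪Ψ x, b i⟫_ℝ) (fun x => ⟪T x, b i⟫_ℝ)

theorem IsTrace.congr {μ : Measure X} {xs : StrongDual ℝ X} {r : ℝ} {ψ ψ' T : X → ℝ}
    (h : IsTrace μ xs r ψ T) (e : ψ =ᵐ[μ.restrict (halfSpace xs r)] ψ') :
    IsTrace μ xs r ψ' T := by
  obtain ⟨hT, Φ, Φs, φ, h1, h2⟩ := h
  exact ⟨hT, Φ, Φs, φ, h1.trans e, h2⟩

theorem IsTrace.zero (μ : Measure X) (xs : StrongDual ℝ X) (r : ℝ) :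
    IsTrace μ xs r 0 0 := by
  refine ⟨MemLp.zero, 0, 0, 0, ?_, ?_, tendsto_const_nhds, ?_⟩
  · exact Lp.coeFn_zero _ _ _
  · exact fun n => ⟨⟨0, (LipschitzWith.const (0 : ℝ)).lipschitzOnWith⟩, ⟨0, by simp⟩,
      Lp.coeFn_zero _ _ _⟩
  · simp

theorem aesm_bdry (μ : Measure X) {xs : StrongDual ℝ X} {r : ℝ} {φ : X → ℝ} {K : ℝ≥0}
    (h : LipschitzOnWith K φ (halfSpace xs r)) :
    AEStronglyMeasurable φ (bdryMeasure μ xs r) := by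
  have hm : MeasurableSet {x | xs x = r} :=
    (isClosed_eq xs.continuous continuous_const).measurableSet
  exact (h.continuousOn.mono fun x (hx : xs x = r) => hx.le).aestronglyMeasurable hm

theorem IsTrace.add {μ : Measure X} {xs : StrongDual ℝ X} {r : ℝ} {ψ ψ' T T' : X → ℝ}
    (h : IsTrace μ xs r ψ T) (h' : IsTrace μ xs r ψ' T') :
    IsTrace μ xs r (ψ + ψ') (T + T') := by
  obtain ⟨hT, Φ, Φs, φ, h1, h2, h3, h4⟩ := h
  obtain ⟨hT', Φ', Φs', φ', h1', h2', h3', h4'⟩ := h'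
  refine ⟨hT.add hT', Φ + Φ', fun n => Φs n + Φs' n, fun n => φ n + φ' n, ?_, ?_,
    h3.add h3', ?_⟩
  · exact (Lp.coeFn_add _ _).trans (h1.add h1')
  · intro n
    obtain ⟨⟨K, hK⟩, ⟨C, hC⟩, he⟩ := h2 n
    obtain ⟨⟨K', hK'⟩, ⟨C', hC'⟩, he'⟩ := h2' n
    exact ⟨⟨K + K', hK.add hK'⟩,
      ⟨C + C', fun x hx => (abs_add_le _ _).trans (add_le_add (hC x hx) (hC' x hx))⟩,
      (Lp.coeFn_add _ _).trans (he.add he')⟩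
  · have h5 := h4.add h4'
    rw [add_zero] at h5
    refine tendsto_of_tendsto_of_tendsto_of_le_of_le tendsto_const_nhds h5
      (fun _ => bot_le) (fun n => ?_)
    obtain ⟨⟨K, hK⟩, -, -⟩ := h2 n
    obtain ⟨⟨K', hK'⟩, -, -⟩ := h2' n
    have e : φ n + φ' n - (T + T') = (φ n - T) + (φ' n - T') := by ring
    simp only [e]
    exact eLpNorm_add_le ((aesm_bdry μ hK).sub hT.1) ((aesm_bdry μ hK').sub hT'.1) le_rfl

theorem IsTrace.smul {μ : Measure X} {xs : StrongDual ℝ X} {r : ℝ} {ψ T : X → ℝ} (c : ℝ)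
    (h : IsTrace μ xs r ψ T) : IsTrace μ xs r (c • ψ) (c • T) := by
  obtain ⟨hT, Φ, Φs, φ, h1, h2, h3, h4⟩ := h
  refine ⟨hT.const_smul c, c • Φ, fun n => c • Φs n, fun n => c • φ n, ?_, ?_,
    h3.const_smul c, ?_⟩
  · exact (Lp.coeFn_smul _ _).trans (h1.const_smul c)
  · intro n
    obtain ⟨⟨K, hK⟩, ⟨C, hC⟩, he⟩ := h2 n
    refine ⟨⟨_, (lipschitzWith_smul c).comp_lipschitzOnWith hK⟩, ⟨|c| * C, fun x hx => ?_⟩,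
      (Lp.coeFn_smul _ _).trans (he.const_smul c)⟩
    simpa [abs_mul] using mul_le_mul_of_nonneg_left (hC x hx) (abs_nonneg c)
  · have h5 := ENNReal.Tendsto.const_mul (a := ‖c‖ₑ) h4 (Or.inr (by simp))
    rw [mul_zero] at h5
    refine h5.congr fun n => ?_
    rw [← smul_sub, eLpNorm_const_smul]

/-- `W^{2,2}_{0,N}(Ω, μ)` for `Ω = {x* ≤ r}`: the elements `u` of `W^{2,2}(Ω, μ)` such that
`x*(Tr(∇_H u)(x)) = ⟨Tr(∇_H u)(x), h_{x*}⟩ = 0` for almost every `x` of `{x* = r}` with respect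
to the surface measure. -/
def W22N (μ : Measure X) (b : HilbertBasis ι ℝ (CM μ)) (xs : StrongDual ℝ X) (r : ℝ) :
    Submodule ℝ (W22 μ (μ.restrict (halfSpace xs r)) b) where
  carrier := {u | ∃ T : X → CM μ, IsTraceH b xs r (W22.grad u) T ∧
    ∀ᵐ x ∂(bdryMeasure μ xs r), ⟪T x, rep μ xs⟫_ℝ = 0}
  zero_mem' := by
    refine ⟨fun _ => 0, fun i => ?_, by simp⟩
    simp only [inner_zero_left]
    refine (IsTrace.zero μ xs r).congr ?_
    filter_upwards [W22.grad_zero (μ := μ) (b := b)] with x hx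
    rw [hx, inner_zero_left, Pi.zero_apply]
  add_mem' := by
    rintro u v ⟨T, hT, hT0⟩ ⟨S, hS, hS0⟩
    refine ⟨fun x => T x + S x, fun i => ?_, ?_⟩
    · simp only [inner_add_left]
      refine ((hT i).add (hS i)).congr ?_
      filter_upwards [W22.grad_add u v] with x hx
      rw [hx, inner_add_left, Pi.add_apply]
    · filter_upwards [hT0, hS0] with x h1 h2
      rw [inner_add_left, h1, h2, add_zero]
  smul_mem' := by
    rintro c u ⟨T, hT, hT0⟩
    refine ⟨fun x => c • T x, fun i => ?_, ?_⟩
    · simp only [real_inner_smul_left]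
      refine ((hT i).smul c).congr ?_
      filter_upwards [W22.grad_smul c u] with x hx
      rw [hx, real_inner_smul_left, Pi.smul_apply, smul_eq_mul]
    · filter_upwards [hT0] with x h1
      rw [real_inner_smul_left, h1, mul_zero]

/-- A Neumann extension operator: a linear operator from `W^{2,2}_{0,N}(Ω, μ)` to
`W^{2,2}(X, μ)` with `E u = u` almost everywhere on `Ω` and
`‖E u‖_{W^{2,2}(X, μ)} ≤ K ‖u‖_{W^{2,2}(Ω, μ)}`. -/
structure IsNeumannExtension {μ : Measure X} {b : HilbertBasis ι ℝ (CM μ)}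
    {xs : StrongDual ℝ X} {r : ℝ} (E : W22N μ b xs r →ₗ[ℝ] W22 μ μ b) : Prop where
  extends_ae : ∀ u, W22.fn (E u) =ᵐ[μ.restrict (halfSpace xs r)] W22.fn u.1
  bounded : ∃ K : ℝ, 0 < K ∧ ∀ u, W22.sobNorm (E u) ≤ K * W22.sobNorm u.1

/-- The seven-term reflection of `f` across `{x* = r}`, with `G = x* - r`:
`∑_{j=1}^7 a_j f(x - (j+1) G(x) h_{x*} / |h_{x*}|²) exp(-(c_j G(x) + d_j G(x)²) / (2 |h_{x*}|))`.
The coefficients `a_j, d_j, c_j` stand at the index `j - 1`. -/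
def reflection (μ : Measure X) (xs : StrongDual ℝ X) (r : ℝ) (a d c : Fin 7 → ℝ)
    (f : X → ℝ) (x : X) : ℝ :=
  ∑ j : Fin 7, a j *
    f (x - ((((j : ℕ) : ℝ) + 2) * (xs x - r) / ‖rep μ xs‖ ^ 2) • emb μ (rep μ xs)) *
    Real.exp (-(c j * (xs x - r) + d j * (xs x - r) ^ 2) / (2 * ‖rep μ xs‖))

end Neumann

end GaussSobolev

end

/-! Write `G = x* - r`, `h = h_{x*}`, `v = h / |h|²` (so that `x*(v) = 1`), `R_k x = x - k G(x) v`
for `k > 1`, and `π_t` for the projection onto `{x* = t}` along `v`. The map `R_k` fixes the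
hyperplane `{G = 0}` and sends `{G > 0}` to `{G < 0}`. Let `g` be smooth with `∂_v g = 0` on the
hyperplane. The function equal to `g` where `G ≤ 0` and to `exp(-a G²/2) g ∘ R_k` where `G > 0` is
then of class `C¹` across the hyperplane: the weight has value 1 and derivative 0 there, and `R_k`
alters only the normal derivative, which vanishes (`fderiv_reflUp_of_eq`). One reflection thus
already extends `g`. The seven reflections are averaged with equal weights only to produce an
operator of the required form, with all `c_j = 0`.

Boundedness from `L²(Ω)` to `L²(X)` is a one-dimensional matter. By `map_fib`, `μ` is invariant when
the coordinate `x*` is resampled from its Gaussian law, which gives Fubini along the lines parallel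
to `v`. On each line the density of `x*`, times the squared weight of rate `k(k-1)/|h|²`, is at most
a constant times the density at the reflected point (`normalDens_refl_le`). Raising the rate by 2
absorbs the polynomial factors that arise from differentiating the weight. The product and chain
rules become bounded operators on triples (function, gradient, second derivative), collected in
`reflOp`. For `g` as above the reflected triple lies in `W^{2,2}(X, μ)` (`reflOp_jet_mem`): it is a
bounded, almost everywhere stationary limit of triples of smooth cylindrical functions.

It remains to show that such `g` are dense in `W^{2,2}_{0,N}` (`mem_closure_neumann`). Let
cylindrical `f_n` tend to `u` in `W^{2,2}(Ω, μ)`. First, `∂_v f_n ∘ π_r` tends to 0 in `L²(μ)`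
(`tendsto_normal_trace`). This follows from a trace inequality on thin strips, together with the
fact that the Feyel–de La Pradelle measure on the hyperplane dominates a positive multiple of the
law of `π_r` (`exists_smul_map_le_bdryMeasure`), so that the trace of the statement can be read off
under `μ`. Second, `f` is replaced by `f - χ(G/ε)(f - f ∘ π_t)`, where `χ` is a cutoff equal to 1
near 0 (`exists_correction`). Near the hyperplane this is `f ∘ π_t`, whose normal derivative is 0.
For a well chosen slice `t` in `[r - ε, r]`, Poincaré inequalities bound the correction by the
second derivative of `f` on the strip `{r - ε ≤ x* ≤ r}` plus `ε^{-1/2}` times the normal derivative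
on the hyperplane. Choosing first `ε` small and then `n` large makes both terms small. Continuity of
`reflOp` and closedness of `W^{2,2}(X, μ)` finish the proof. -/

set_option autoImplicit false
set_option maxSynthPendingDepth 3
set_option linter.unusedSectionVars false

noncomputable section

namespace GaussSobolev

/-! ### Derivatives along the Cameron–Martin space in terms of Fréchet derivatives -/

section Calculus

variable {X : Type*} [NormedAddCommGroup X] [NormedSpace ℝ X] [MeasurableSpace X] [BorelSpace X]

/-- `rep` as a continuous linear map. -/
def repL (μ : Measure X) : StrongDual ℝ X →L[ℝ] CM μ :=
  (StrongDual.toLp (𝕜 := ℝ) μ 2).codRestrict (dualClosure μ) fun xs =>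
    Submodule.le_topologicalClosure _ (LinearMap.mem_range_self _ xs)

theorem repL_apply (μ : Measure X) (xs : StrongDual ℝ X) : repL μ xs = rep μ xs := rfl

variable [CompleteSpace X] [SecondCountableTopology X] (μ : Measure X) [IsGaussian μ]

theorem dual_emb_repL (xs : StrongDual ℝ X) (h : CM μ) : xs (emb μ h) = ⟪repL μ xs, h⟫_ℝ :=
  dual_emb μ xs h

/-- `emb` as a continuous linear map. -/
def embL : CM μ →L[ℝ] X :=
  LinearMap.mkContinuous
    { toFun := emb μ
      -- Linearity and the norm bound are both tested against functionals, where `dual_emb` turns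
      -- `emb` into an inner product with `repL μ xs`.
      map_add' := fun h k => by
        refine (SeparatingDual.eq_iff_forall_dual_eq (R := ℝ)).2 fun xs => ?_
        simp only [map_add, dual_emb_repL, inner_add_right]
      map_smul' := fun c h => by
        refine (SeparatingDual.eq_iff_forall_dual_eq (R := ℝ)).2 fun xs => ?_
        simp only [map_smul, dual_emb_repL, inner_smul_right, RingHom.id_apply, smul_eq_mul] }
    ‖repL μ‖ fun h => by
      refine NormedSpace.norm_le_dual_bound ℝ _ (by positivity) fun xs => ?_
      change ‖xs (emb μ h)‖ ≤ _
      rw [dual_emb_repL]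
      calc ‖⟪repL μ xs, h⟫_ℝ‖ ≤ ‖repL μ xs‖ * ‖h‖ := norm_inner_le_norm _ _
        _ ≤ ‖repL μ‖ * ‖xs‖ * ‖h‖ := by gcongr; exact (repL μ).le_opNorm xs
        _ = ‖repL μ‖ * ‖h‖ * ‖xs‖ := by ring

theorem embL_apply (h : CM μ) : embL μ h = emb μ h := rfl

theorem dual_embL (xs : StrongDual ℝ X) (h : CM μ) : xs (embL μ h) = ⟪repL μ xs, h⟫_ℝ :=
  dual_emb μ xs h

theorem norm_repL_sq (L : StrongDual ℝ X) : ‖repL μ L‖ ^ 2 = ∫ x, L x ^ 2 ∂μ := by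
  have h2 : MemLp (id : X → X) 2 μ := IsGaussian.memLp_two_id
  have e : (StrongDual.toLp (𝕜 := ℝ) μ 2 L : X → ℝ) =ᵐ[μ] L := by
    rw [StrongDual.toLp_apply h2]
    exact MemLp.coeFn_toLp _
  have hin : ⟪repL μ L, repL μ L⟫_ℝ
      = ⟪StrongDual.toLp (𝕜 := ℝ) μ 2 L, StrongDual.toLp (𝕜 := ℝ) μ 2 L⟫_ℝ := rfl
  rw [← real_inner_self_eq_norm_sq, hin, MeasureTheory.L2.inner_def]
  apply integral_congr_ae
  filter_upwards [e] with x hx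
  simp [hx, sq]

theorem hat_rep (L : StrongDual ℝ X) : hat (rep μ L) =ᵐ[μ] L := by
  have h2 : MemLp (id : X → X) 2 μ := IsGaussian.memLp_two_id
  change (StrongDual.toLp (𝕜 := ℝ) μ 2 L : X → ℝ) =ᵐ[μ] L
  rw [StrongDual.toLp_apply h2]
  exact MemLp.coeFn_toLp _

/-- The chain rule along `embL` and the identity `x*(h) = ⟨repL x*, h⟩`. All differentiation can
then be carried out in the dual of `X`. -/
theorem gradH_eq {f : X → ℝ} {x : X} (hf : DifferentiableAt ℝ f x) :
    gradH μ f x = repL μ (fderiv ℝ f x) := by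
  have h0 : x + embL μ 0 = x := by simp
  have h1 : HasFDerivAt (fun h : CM μ => f (x + embL μ h)) ((fderiv ℝ f x).comp (embL μ)) 0 := by
    have hd : HasFDerivAt f (fderiv ℝ f x) (x + embL μ 0) := by
      rw [h0]; exact hf.hasFDerivAt
    exact hd.comp (0 : CM μ) ((embL μ).hasFDerivAt.const_add x)
  have h2 : gradH μ f x
      = (InnerProductSpace.toDual ℝ (CM μ)).symm (fderiv ℝ (fun h => f (x + embL μ h)) 0) := rfl
  rw [h2, h1.fderiv, LinearIsometryEquiv.symm_apply_eq]
  ext h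
  simp [dual_embL]

theorem hessH_eq {f : X → ℝ} (hf : ContDiff ℝ 2 f) (x : X) (h : CM μ) :
    hessH μ f x h = repL μ (fderiv ℝ (fderiv ℝ f) x (embL μ h)) := by
  have h0 : x + embL μ 0 = x := by simp
  have hd : Differentiable ℝ f := hf.differentiable (by norm_num)
  have hd2 : Differentiable ℝ (fderiv ℝ f) :=
    (hf.fderiv_right (m := 1) (by norm_num)).differentiable (by norm_num)
  have e : (fun h : CM μ => gradH μ f (x + emb μ h))
      = fun h : CM μ => repL μ (fderiv ℝ f (x + embL μ h)) := by
    funext h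
    exact gradH_eq μ (hd _)
  have h1 : HasFDerivAt (fun h : CM μ => repL μ (fderiv ℝ f (x + embL μ h)))
      ((repL μ).comp ((fderiv ℝ (fderiv ℝ f) x).comp (embL μ))) 0 := by
    have hd' : HasFDerivAt (fderiv ℝ f) (fderiv ℝ (fderiv ℝ f) x) (x + embL μ 0) := by
      rw [h0]; exact (hd2 x).hasFDerivAt
    exact (repL μ).hasFDerivAt.comp (0 : CM μ)
      (hd'.comp (0 : CM μ) ((embL μ).hasFDerivAt.const_add x))
  rw [hessH, e, h1.fderiv]
  rfl

end Calculus

/-! ### Hilbert–Schmidt operators on the Cameron–Martin space -/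

section HilbertSchmidt

variable {X : Type*} [NormedAddCommGroup X] [NormedSpace ℝ X] [MeasurableSpace X] [BorelSpace X]
variable {μ : Measure X} {ι : Type*}

/-- A square summable family of linear maps into `H` as a continuous linear map into `HS`. -/
def hsMk {V : Type*} [SeminormedAddCommGroup V] [NormedSpace ℝ V] (A : V →ₗ[ℝ] (ι → CM μ)) (C : ℝ)
    (hC0 : 0 ≤ C) (hC : ∀ x (s : Finset ι), ∑ i ∈ s, ‖A x i‖ ^ 2 ≤ (C * ‖x‖) ^ 2) :
    V →L[ℝ] HS μ ι :=
  LinearMap.mkContinuous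
    { toFun := fun x => (⟨A x, memℓp_gen' (C := (C * ‖x‖) ^ 2) fun s => by
        simpa using hC x s⟩ : lp (fun _ : ι => CM μ) 2)
      map_add' := fun x y => by ext i : 2; simp; rfl
      map_smul' := fun c x => by ext i : 2; simp }
    C fun x => lp.norm_le_of_forall_sum_le (by norm_num) (by positivity) fun s => by
      simpa using hC x s

theorem sum_inner_sq_le (b : HilbertBasis ι ℝ (CM μ)) (v : CM μ) (s : Finset ι) :
    ∑ i ∈ s, ⟪v, b i⟫_ℝ ^ 2 ≤ ‖v‖ ^ 2 := by
  have := b.orthonormal.sum_inner_products_le v (s := s)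
  refine le_trans (le_of_eq (Finset.sum_congr rfl fun i _ => ?_)) this
  rw [real_inner_comm, Real.norm_eq_abs, sq_abs]

/-- The operators `v ⊗ e : h ↦ ⟪e, h⟫ v`, linear in `v`. -/
def tenR (b : HilbertBasis ι ℝ (CM μ)) (e : CM μ) : CM μ →L[ℝ] HS μ ι :=
  hsMk (LinearMap.pi fun i => ⟪e, b i⟫_ℝ • LinearMap.id) ‖e‖ (norm_nonneg _) fun v s => by
    simp only [LinearMap.pi_apply, LinearMap.smul_apply, LinearMap.id_apply, norm_smul, mul_pow,
      Real.norm_eq_abs, sq_abs, ← Finset.sum_mul]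
    gcongr
    exact sum_inner_sq_le b e s

theorem tenR_apply (b : HilbertBasis ι ℝ (CM μ)) (e v : CM μ) (i : ι) :
    tenR b e v i = ⟪e, b i⟫_ℝ • v := rfl

/-- The operators `e ⊗ v : h ↦ ⟪v, h⟫ e`, linear in `v`. -/
def tenL (b : HilbertBasis ι ℝ (CM μ)) (e : CM μ) : CM μ →L[ℝ] HS μ ι :=
  hsMk (LinearMap.pi fun i => (innerₗ (CM μ) (b i)).smulRight e) ‖e‖ (norm_nonneg _) fun v s => by
    simp only [LinearMap.pi_apply, LinearMap.smulRight_apply, norm_smul, mul_pow,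
      Real.norm_eq_abs, sq_abs, ← Finset.sum_mul, innerₗ_apply_apply]
    rw [mul_comm]
    gcongr
    simpa only [real_inner_comm] using sum_inner_sq_le b v s

theorem tenL_apply (b : HilbertBasis ι ℝ (CM μ)) (e v : CM μ) (i : ι) :
    tenL b e v i = ⟪b i, v⟫_ℝ • e := rfl

/-- The composition `Q ↦ (e ⊗ e) Q`. -/
def projHS (ι : Type*) (e : CM μ) : HS μ ι →L[ℝ] HS μ ι :=
  hsMk (LinearMap.pi fun i => ((innerₗ (CM μ) e).smulRight e).comp
      ((LinearMap.proj i).comp (lpSubmodule ℝ (fun _ : ι => CM μ) 2).subtype))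
    (‖e‖ ^ 2) (by positivity) fun Q s => by
    have h1 : ∑ i ∈ s, ‖Q i‖ ^ 2 ≤ ‖Q‖ ^ 2 := by
      simpa using lp.sum_rpow_le_norm_rpow (p := 2) (by norm_num) Q s
    calc ∑ i ∈ s, ‖⟪e, Q i⟫_ℝ • e‖ ^ 2 ≤ ∑ i ∈ s, (‖e‖ ^ 2) ^ 2 * ‖Q i‖ ^ 2 := by
          refine Finset.sum_le_sum fun i _ => ?_
          rw [norm_smul, ← mul_pow]
          refine pow_le_pow_left₀ (by positivity) ?_ 2
          calc ‖⟪e, Q i⟫_ℝ‖ * ‖e‖ ≤ ‖e‖ * ‖Q i‖ * ‖e‖ := by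
                gcongr; exact norm_inner_le_norm _ _
            _ = ‖e‖ ^ 2 * ‖Q i‖ := by ring
      _ ≤ (‖e‖ ^ 2 * ‖Q‖) ^ 2 := by
          rw [← Finset.mul_sum, mul_pow]
          gcongr

/-- The evaluation `Q ↦ Q e` of Hilbert–Schmidt operators. -/
def evHS (b : HilbertBasis ι ℝ (CM μ)) (e : CM μ) : HS μ ι →L[ℝ] CM μ :=
  -- The Hilbert–Schmidt product of `v ⊗ e` with `Q` is `⟨v, Q e⟩`, so evaluation at `e` is the
  -- adjoint of `v ↦ v ⊗ e`, and continuity comes for free.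
  ContinuousLinearMap.adjoint (tenR b e)

/-- A continuous bilinear form on `X` as a Hilbert–Schmidt operator on `H`. -/
def hsL [CompleteSpace X] [SecondCountableTopology X] [IsGaussian μ]
    (b : HilbertBasis ι ℝ (CM μ)) : (X →L[ℝ] StrongDual ℝ X) →L[ℝ] HS μ ι :=
  hsMk (LinearMap.pi fun i =>
      (repL μ).toLinearMap.comp (ContinuousLinearMap.apply ℝ _ (embL μ (b i))).toLinearMap)
    (‖repL μ‖ * √(∫ x, ‖x‖ ^ 2 ∂μ)) (by positivity) fun B s => by
    change ∑ i ∈ s, ‖repL μ (B (embL μ (b i)))‖ ^ 2 ≤ _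
    have h2 : MemLp (id : X → X) 2 μ := IsGaussian.memLp_two_id
    have hi : ∀ L : StrongDual ℝ X, Integrable (fun x => L x ^ 2) μ := fun L =>
      (IsGaussian.memLp_dual μ L 2 (by simp)).integrable_sq
    have hn : Integrable (fun x : X => ‖x‖ ^ 2) μ := h2.norm.integrable_sq
    -- Each `‖repL L‖²` is the second moment of `L`. Under the integral sign, swapping the two
    -- arguments of `B` exposes the coordinates of the single vector `repL (B(·, x))`, to which
    -- Bessel's inequality applies. The remaining integral of `‖x‖²` is finite because `μ` is
    -- Gaussian.
    calc ∑ i ∈ s, ‖repL μ (B (embL μ (b i)))‖ ^ 2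
        = ∑ i ∈ s, ∫ x, (B (embL μ (b i)) x) ^ 2 ∂μ := by simp_rw [norm_repL_sq]
      _ = ∫ x, ∑ i ∈ s, (B (embL μ (b i)) x) ^ 2 ∂μ :=
          (integral_finsetSum _ fun i _ => hi _).symm
      _ ≤ ∫ x, (‖repL μ‖ * ‖B‖) ^ 2 * ‖x‖ ^ 2 ∂μ := by
          refine integral_mono (integrable_finsetSum _ fun i _ => hi _) (hn.const_mul _) fun x => ?_
          have e : ∀ i, B (embL μ (b i)) x = ⟪repL μ (B.flip x), b i⟫_ℝ := fun i => by
            rw [← dual_embL, ContinuousLinearMap.flip_apply]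
          simp only [e]
          refine (sum_inner_sq_le b _ s).trans ?_
          rw [← mul_pow]
          gcongr
          calc ‖repL μ (B.flip x)‖ ≤ ‖repL μ‖ * ‖B.flip x‖ := (repL μ).le_opNorm _
            _ ≤ ‖repL μ‖ * (‖B.flip‖ * ‖x‖) := by gcongr; exact B.flip.le_opNorm x
            _ = ‖repL μ‖ * ‖B‖ * ‖x‖ := by rw [ContinuousLinearMap.opNorm_flip]; ring
      _ = (‖repL μ‖ * √(∫ x, ‖x‖ ^ 2 ∂μ) * ‖B‖) ^ 2 := by
          rw [integral_const_mul, mul_pow, mul_pow, mul_pow, Real.sq_sqrt (by positivity)]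
          ring

section

variable [CompleteSpace X] [SecondCountableTopology X] [IsGaussian μ]
  (b : HilbertBasis ι ℝ (CM μ))

theorem hsL_apply (B : X →L[ℝ] StrongDual ℝ X) (i : ι) :
    hsL b B i = repL μ (B (embL μ (b i))) := rfl

theorem evHS_hsL (e : CM μ) (B : X →L[ℝ] StrongDual ℝ X) :
    evHS b e (hsL b B) = repL μ (B (embL μ e)) := by
  refine ext_inner_left ℝ fun v => ?_
  rw [evHS, ContinuousLinearMap.adjoint_inner_right, lp.inner_eq_tsum]
  have h : HasSum (fun i => ⟪b i, e⟫_ℝ • b i) e := by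
    simpa [HilbertBasis.repr_apply_apply] using b.hasSum_repr e
  have h' := h.mapL ((innerSL ℝ v).comp ((repL μ).comp (B.comp (embL μ))))
  have h2 : ⟪v, repL μ (B (embL μ e))⟫_ℝ
    = (innerSL ℝ v).comp ((repL μ).comp (B.comp (embL μ))) e := by simp
  rw [h2, ← h'.tsum_eq]
  refine tsum_congr fun i => ?_
  simp [tenR_apply, hsL_apply, real_inner_comm, inner_smul_left]

theorem hsL_smulRight (L K : StrongDual ℝ X) :
    hsL b (L.smulRight K) = tenR b (repL μ L) (repL μ K) := by
  ext i : 2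
  rw [hsL_apply, tenR_apply, ContinuousLinearMap.smulRight_apply, map_smul, dual_embL]

theorem tenL_eq_hsL (L K : StrongDual ℝ X) :
    tenL b (repL μ K) (repL μ L) = hsL b (L.smulRight K) := by
  ext i : 2
  rw [hsL_apply, tenL_apply, ContinuousLinearMap.smulRight_apply, map_smul, dual_embL,
    real_inner_comm]

end

end HilbertSchmidt

/-! ### Smooth functions with bounded derivatives -/

section BddSmooth

/-- Smooth functions that are bounded together with all their derivatives. -/
def BddSmooth {V : Type*} [NormedAddCommGroup V] [NormedSpace ℝ V] (φ : V → ℝ) : Prop :=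
  ContDiff ℝ ∞ φ ∧ ∀ k : ℕ, ∃ C : ℝ, ∀ y, ‖iteratedFDeriv ℝ k φ y‖ ≤ C

variable {V W : Type*} [NormedAddCommGroup V] [NormedSpace ℝ V] [NormedAddCommGroup W]
  [NormedSpace ℝ W] {φ ψ : V → ℝ}

theorem BddSmooth.add (hφ : BddSmooth φ) (hψ : BddSmooth ψ) :
    BddSmooth (fun x => φ x + ψ x) := by
  refine ⟨hφ.1.add hψ.1, fun k => ?_⟩
  obtain ⟨C, hC⟩ := hφ.2 k
  obtain ⟨D, hD⟩ := hψ.2 k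
  refine ⟨C + D, fun y => ?_⟩
  rw [show (fun x => φ x + ψ x) = φ + ψ from rfl, iteratedFDeriv_add_apply (hφ.1.of_le (by exact_mod_cast le_top)).contDiffAt
    (hψ.1.of_le (by exact_mod_cast le_top)).contDiffAt]
  exact (norm_add_le _ _).trans (add_le_add (hC y) (hD y))

theorem BddSmooth.mul (hφ : BddSmooth φ) (hψ : BddSmooth ψ) :
    BddSmooth (fun x => φ x * ψ x) := by
  refine ⟨hφ.1.mul hψ.1, fun k => ?_⟩
  choose C hC using hφ.2
  choose D hD using hψ.2
  refine ⟨∑ i ∈ Finset.range (k + 1), (k.choose i : ℝ) * C i * D (k - i), fun y => ?_⟩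
  refine (norm_iteratedFDeriv_mul_le (N := ∞) hφ.1 hψ.1 y
    (by exact_mod_cast le_top)).trans ?_
  refine Finset.sum_le_sum fun i _ => ?_
  have := (norm_nonneg _).trans (hC i y)
  gcongr
  · exact hC i y
  · exact hD _ y

theorem BddSmooth.comp_affine (hφ : BddSmooth φ) (A : W →L[ℝ] V) (c : V) :
    BddSmooth (fun x => φ (A x + c)) := by
  have h1 : ContDiff ℝ ∞ (fun y => φ (y + c)) := hφ.1.comp (contDiff_id.add contDiff_const)
  refine ⟨h1.comp A.contDiff, fun k => ?_⟩
  obtain ⟨C, hC⟩ := hφ.2 k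
  refine ⟨C * ‖A‖ ^ k, fun y => ?_⟩
  have e : (fun x => φ (A x + c)) = (fun y => φ (y + c)) ∘ A := rfl
  rw [e, A.iteratedFDeriv_comp_right h1 y (by exact_mod_cast le_top),
    iteratedFDeriv_comp_add_right]
  refine (ContinuousMultilinearMap.norm_compContinuousLinearMap_le _ _).trans ?_
  rw [Finset.prod_const, Finset.card_univ, Fintype.card_fin]
  gcongr
  exact hC _

theorem BddSmooth.comp_clm (hφ : BddSmooth φ) (A : W →L[ℝ] V) :
    BddSmooth (fun x => φ (A x)) := by
  simpa using hφ.comp_affine A 0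

theorem BddSmooth.const (c : ℝ) : BddSmooth (fun _ : V => c) := by
  refine ⟨contDiff_const, fun k => ?_⟩
  rcases k.eq_zero_or_pos with rfl | hk
  · exact ⟨‖c‖, fun y => by simp⟩
  · exact ⟨0, fun y => by simp [iteratedFDeriv_const_of_ne hk.ne']⟩

theorem BddSmooth.of_hasCompactSupport (hφ : ContDiff ℝ ∞ φ) (hc : HasCompactSupport φ) :
    BddSmooth φ :=
  ⟨hφ, fun k => by
    obtain ⟨C, hC⟩ := (hc.iteratedFDeriv (𝕜 := ℝ) k).exists_bound_of_continuous
      (hφ.continuous_iteratedFDeriv (m := k) (by exact_mod_cast le_top))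
    exact ⟨C, hC⟩⟩

end BddSmooth

/-! ### Stability of the smooth cylindrical functions -/

section Cylinder

variable {X : Type*} [NormedAddCommGroup X] [NormedSpace ℝ X] {f g : X → ℝ}

/-- Coordinates are chosen only here. Any finite-dimensional target is then allowed, so two
cylindrical functions can be combined on the product of their targets. -/
theorem IsFCbInf.of_comp {V : Type*} [NormedAddCommGroup V] [NormedSpace ℝ V]
    [FiniteDimensional ℝ V] (L : X →L[ℝ] V) {φ : V → ℝ} (hφ : BddSmooth φ) :
    IsFCbInf (fun x => φ (L x)) := by
  let e := (Module.finBasis ℝ V).equivFunL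
  have h := hφ.comp_clm (e.symm : (Fin (Module.finrank ℝ V) → ℝ) →L[ℝ] V)
  refine ⟨Module.finrank ℝ V, fun i => (ContinuousLinearMap.proj (R := ℝ) (φ := fun _ => ℝ) i).comp
    ((e : V →L[ℝ] _).comp L), fun y => φ (e.symm y), h.1, h.2, ?_⟩
  funext x
  have : (fun i => ((ContinuousLinearMap.proj (R := ℝ) (φ := fun _ => ℝ) i).comp
    ((e : V →L[ℝ] (Fin (Module.finrank ℝ V) → ℝ)).comp L)) x) = e (L x) := rfl
  rw [this]
  simp only [ContinuousLinearEquiv.symm_apply_apply]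

theorem IsFCbInf.exists_comp (hf : IsFCbInf f) :
    ∃ (n : ℕ) (L : X →L[ℝ] (Fin n → ℝ)) (φ : (Fin n → ℝ) → ℝ), BddSmooth φ ∧
      f = fun x => φ (L x) := by
  obtain ⟨n, L, φ, h1, h2, h3⟩ := hf
  exact ⟨n, ContinuousLinearMap.pi L, φ, ⟨h1, h2⟩, h3⟩

theorem IsFCbInf.add (hf : IsFCbInf f) (hg : IsFCbInf g) : IsFCbInf (fun x => f x + g x) := by
  obtain ⟨n, L, φ, hφ, rfl⟩ := hf.exists_comp
  obtain ⟨m, K, ψ, hψ, rfl⟩ := hg.exists_comp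
  exact IsFCbInf.of_comp (L.prod K) ((hφ.comp_clm (ContinuousLinearMap.fst ℝ _ _)).add
    (hψ.comp_clm (ContinuousLinearMap.snd ℝ _ _)))

theorem IsFCbInf.mul (hf : IsFCbInf f) (hg : IsFCbInf g) : IsFCbInf (fun x => f x * g x) := by
  obtain ⟨n, L, φ, hφ, rfl⟩ := hf.exists_comp
  obtain ⟨m, K, ψ, hψ, rfl⟩ := hg.exists_comp
  exact IsFCbInf.of_comp (L.prod K) ((hφ.comp_clm (ContinuousLinearMap.fst ℝ _ _)).mul
    (hψ.comp_clm (ContinuousLinearMap.snd ℝ _ _)))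

theorem IsFCbInf.const (c : ℝ) : IsFCbInf (fun _ : X => c) :=
  IsFCbInf.of_comp (0 : X →L[ℝ] ℝ) (BddSmooth.const c)

theorem IsFCbInf.const_mul (c : ℝ) (hf : IsFCbInf f) : IsFCbInf (fun x => c * f x) :=
  (IsFCbInf.const c).mul hf

theorem IsFCbInf.sub (hf : IsFCbInf f) (hg : IsFCbInf g) : IsFCbInf (fun x => f x - g x) := by
  simpa [sub_eq_add_neg] using hf.add (hg.const_mul (-1))

/-- The affine map `x ↦ x - k (x* x - c) v`. -/
def aff (xs : StrongDual ℝ X) (v : X) (k c : ℝ) (x : X) : X := x - (k * (xs x - c)) • v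

/-- The coordinates `L (aff x)` depend affinely on the pair `(L x, x* x)`, so it suffices to adjoin
`x*` to the functionals. -/
theorem IsFCbInf.comp_aff (hf : IsFCbInf f) (xs : StrongDual ℝ X) (v : X) (k c : ℝ) :
    IsFCbInf (fun x => f (aff xs v k c x)) := by
  obtain ⟨n, L, φ, hφ, rfl⟩ := hf.exists_comp
  have h := IsFCbInf.of_comp (L.prod xs) (hφ.comp_affine
    (ContinuousLinearMap.fst ℝ (Fin n → ℝ) ℝ -
      k • (ContinuousLinearMap.snd ℝ (Fin n → ℝ) ℝ).smulRight (L v)) ((k * c) • L v))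
  convert h using 2 with x
  simp only [aff, map_sub, map_smul, ContinuousLinearMap.prod_apply,
    sub_apply, smul_apply,
    ContinuousLinearMap.smulRight_apply, ContinuousLinearMap.coe_fst',
    ContinuousLinearMap.coe_snd']
  congr 1
  module

theorem IsFCbInf.mul_comp (hf : IsFCbInf f) (xs : StrongDual ℝ X) {m : ℝ → ℝ}
    (hm : ContDiff ℝ ∞ m) (hc : HasCompactSupport m) : IsFCbInf (fun x => m (xs x) * f x) :=
  (IsFCbInf.of_comp xs (BddSmooth.of_hasCompactSupport hm hc)).mul hf

/-- `C²` functions that are bounded together with their first two derivatives. -/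
def C2b (f : X → ℝ) : Prop :=
  ContDiff ℝ 2 f ∧ ∃ C : ℝ, ∀ x, ‖f x‖ ≤ C ∧ ‖fderiv ℝ f x‖ ≤ C ∧ ‖fderiv ℝ (fderiv ℝ f) x‖ ≤ C

theorem IsFCbInf.c2b (hf : IsFCbInf f) : C2b f := by
  obtain ⟨n, L, φ, hφ, rfl⟩ := hf.exists_comp
  have h := hφ.comp_clm L
  refine ⟨h.1.of_le (WithTop.coe_le_coe.2 le_top), ?_⟩
  obtain ⟨C0, h0⟩ := h.2 0
  obtain ⟨C1, h1⟩ := h.2 1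
  obtain ⟨C2, h2⟩ := h.2 2
  refine ⟨max C0 (max C1 C2), fun x => ⟨?_, ?_, ?_⟩⟩
  · have := h0 x
    rw [norm_iteratedFDeriv_zero] at this
    exact this.trans (le_max_left _ _)
  · have := h1 x
    rw [norm_iteratedFDeriv_one] at this
    exact this.trans ((le_max_left _ _).trans (le_max_right _ _))
  · have := h2 x
    rw [← norm_iteratedFDeriv_fderiv, norm_iteratedFDeriv_one] at this
    exact this.trans ((le_max_right _ _).trans (le_max_right _ _))

theorem C2b.differentiable (hf : C2b f) : Differentiable ℝ f :=
  hf.1.differentiable (by norm_num)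

theorem C2b.contDiff_fderiv (hf : C2b f) : ContDiff ℝ 1 (fderiv ℝ f) :=
  hf.1.fderiv_right (m := 1) (by norm_num)

theorem C2b.differentiable_fderiv (hf : C2b f) : Differentiable ℝ (fderiv ℝ f) :=
  hf.contDiff_fderiv.differentiable (by norm_num)

theorem C2b.continuous_fderiv (hf : C2b f) : Continuous (fderiv ℝ f) :=
  hf.contDiff_fderiv.continuous

theorem C2b.continuous_hess (hf : C2b f) : Continuous (fderiv ℝ (fderiv ℝ f)) :=
  hf.contDiff_fderiv.continuous_fderiv (by norm_num)

end Cylinder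

/-! ### Triples of a function and its first two derivatives -/

section Jet

variable {X : Type*} [NormedAddCommGroup X] [NormedSpace ℝ X] [MeasurableSpace X] [BorelSpace X]
  [CompleteSpace X] [SecondCountableTopology X] {μ : Measure X} [IsGaussian μ] {ι : Type*}
  (b : HilbertBasis ι ℝ (CM μ)) {ν : Measure X} [IsFiniteMeasure ν] {f g : X → ℝ}

theorem memLp_of_continuous_bound {V : Type*} [NormedAddCommGroup V] {F : X → V}
    (hF : Continuous F) {C : ℝ} (hC : ∀ x, ‖F x‖ ≤ C) (p : ℝ≥0∞) : MemLp F p ν :=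
  MemLp.of_bound hF.aestronglyMeasurable C (ae_of_all _ hC)

theorem C2b.memLp (hf : C2b f) (p : ℝ≥0∞) : MemLp f p ν := by
  obtain ⟨C, hC⟩ := hf.2
  exact memLp_of_continuous_bound hf.1.continuous (fun x => (hC x).1) p

theorem C2b.memLp_grad (hf : C2b f) (p : ℝ≥0∞) :
    MemLp (fun x => repL μ (fderiv ℝ f x)) p ν := by
  obtain ⟨C, hC⟩ := hf.2
  refine memLp_of_continuous_bound ((repL μ).continuous.comp hf.continuous_fderiv)
    (C := ‖repL μ‖ * C) (fun x => ?_) p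
  exact (repL μ).le_opNorm_of_le (hC x).2.1

theorem C2b.memLp_hess (hf : C2b f) (p : ℝ≥0∞) :
    MemLp (fun x => hsL b (fderiv ℝ (fderiv ℝ f) x)) p ν := by
  obtain ⟨C, hC⟩ := hf.2
  refine memLp_of_continuous_bound ((hsL b).continuous.comp hf.continuous_hess)
    (C := ‖hsL b‖ * C) (fun x => ?_) p
  exact (hsL b).le_opNorm_of_le (hC x).2.2

/-- The triple `(f, ∇_H f, ∇_H² f)` of a function of class `C²` with bounded derivatives. -/
def jet (ν : Measure X) [IsFiniteMeasure ν] (hf : C2b f) :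
    Lp ℝ 2 ν × Lp (CM μ) 2 ν × Lp (HS μ ι) 2 ν :=
  ((hf.memLp 2).toLp f, (hf.memLp_grad 2).toLp _, (hf.memLp_hess b 2).toLp _)

theorem jet_fst (hf : C2b f) : (jet b ν hf).1 =ᵐ[ν] f := MemLp.coeFn_toLp (hf.memLp 2)

theorem jet_grad (hf : C2b f) :
    (jet b ν hf).2.1 =ᵐ[ν] fun x => repL μ (fderiv ℝ f x) :=
  MemLp.coeFn_toLp (hf.memLp_grad 2)

theorem jet_hess (hf : C2b f) :
    (jet b ν hf).2.2 =ᵐ[ν] fun x => hsL b (fderiv ℝ (fderiv ℝ f) x) :=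
  MemLp.coeFn_toLp (hf.memLp_hess b 2)

/-- The link with the definition of `W22`: the generators there are exactly the jets of cylindrical
functions, computed with Fréchet derivatives. -/
theorem jet_eq_iff (hf : C2b f) (p : Lp ℝ 2 ν × Lp (CM μ) 2 ν × Lp (HS μ ι) 2 ν) :
    (p.1 =ᵐ[ν] f ∧ p.2.1 =ᵐ[ν] gradH μ f ∧ ∀ᵐ x ∂ν, ∀ i, p.2.2 x i = hessH μ f x (b i)) ↔
      p = jet b ν hf := by
  have hg : gradH μ f = fun x => repL μ (fderiv ℝ f x) :=
    funext fun x => gradH_eq μ (hf.differentiable x)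
  have hh : ∀ x i, hessH μ f x (b i) = hsL b (fderiv ℝ (fderiv ℝ f) x) i := fun x i =>
    hessH_eq μ hf.1 x (b i)
  constructor
  · rintro ⟨h1, h2, h3⟩
    refine Prod.ext (Lp.ext (h1.trans (jet_fst b hf).symm)) (Prod.ext (Lp.ext ?_) (Lp.ext ?_))
    · rw [hg] at h2
      exact h2.trans (jet_grad b hf).symm
    · refine EventuallyEq.trans ?_ (jet_hess b hf).symm
      filter_upwards [h3] with x hx
      ext i : 2
      rw [hx i, hh]
  · rintro rfl
    refine ⟨jet_fst b hf, ?_, ?_⟩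
    · rw [hg]
      exact jet_grad b hf
    · filter_upwards [jet_hess b hf (ν := ν)] with x hx i
      rw [hx, hh]

theorem jet_mem (hf : IsFCbInf f) : jet b ν hf.c2b ∈ W22 μ ν b :=
  Submodule.le_topologicalClosure _ (Submodule.subset_span
    ⟨f, hf, (jet_eq_iff b hf.c2b _).2 rfl⟩)

theorem fderiv_add_fun (hf : C2b f) (hg : C2b g) :
    fderiv ℝ (fun x => f x + g x) = fun x => fderiv ℝ f x + fderiv ℝ g x :=
  funext fun x => fderiv_fun_add (hf.differentiable x) (hg.differentiable x)

theorem jet_add (hf : C2b f) (hg : C2b g) (hfg : C2b (fun x => f x + g x)) :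
    jet b ν hfg = jet b ν hf + jet b ν hg := by
  refine Prod.ext rfl (Prod.ext ?_ ?_)
  · refine Lp.ext ((jet_grad b hfg).trans ?_)
    filter_upwards [jet_grad b hf (ν := ν), jet_grad b hg (ν := ν),
      Lp.coeFn_add (jet b ν hf).2.1 (jet b ν hg).2.1] with x h1 h2 h3
    change _ = ((jet b ν hf).2.1 + (jet b ν hg).2.1 : Lp (CM μ) 2 ν) x
    rw [h3, Pi.add_apply, h1, h2, fderiv_add_fun hf hg, map_add]
  · refine Lp.ext ((jet_hess b hfg).trans ?_)
    filter_upwards [jet_hess b hf (ν := ν), jet_hess b hg (ν := ν),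
      Lp.coeFn_add (jet b ν hf).2.2 (jet b ν hg).2.2] with x h1 h2 h3
    change _ = ((jet b ν hf).2.2 + (jet b ν hg).2.2 : Lp (HS μ ι) 2 ν) x
    rw [h3, Pi.add_apply, h1, h2, fderiv_add_fun hf hg,
      fderiv_fun_add (hf.differentiable_fderiv x) (hg.differentiable_fderiv x), map_add]

theorem fderiv_const_mul_fun (c : ℝ) (hf : C2b f) :
    fderiv ℝ (fun x => c * f x) = fun x => c • fderiv ℝ f x :=
  funext fun x => fderiv_const_mul (hf.differentiable x) c

theorem jet_const_mul (c : ℝ) (hf : C2b f) (hcf : C2b (fun x => c * f x)) :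
    jet b ν hcf = c • jet b ν hf := by
  refine Prod.ext rfl (Prod.ext ?_ ?_)
  · refine Lp.ext ((jet_grad b hcf).trans ?_)
    filter_upwards [jet_grad b hf (ν := ν), Lp.coeFn_smul c (jet b ν hf).2.1] with x h1 h3
    change _ = (c • (jet b ν hf).2.1 : Lp (CM μ) 2 ν) x
    rw [h3, Pi.smul_apply, h1, fderiv_const_mul_fun c hf, map_smul]
  · refine Lp.ext ((jet_hess b hcf).trans ?_)
    filter_upwards [jet_hess b hf (ν := ν), Lp.coeFn_smul c (jet b ν hf).2.2] with x h1 h3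
    change _ = (c • (jet b ν hf).2.2 : Lp (HS μ ι) 2 ν) x
    rw [h3, Pi.smul_apply, h1, fderiv_const_mul_fun c hf,
      fderiv_fun_const_smul (hf.differentiable_fderiv x), map_smul]

/-- Every element of `W^{2,2}` is a limit of the triples of smooth cylindrical functions. -/
theorem exists_jet_tendsto {u : Lp ℝ 2 ν × Lp (CM μ) 2 ν × Lp (HS μ ι) 2 ν}
    (hu : u ∈ W22 μ ν b) : ∃ (f : ℕ → X → ℝ) (hf : ∀ n, IsFCbInf (f n)),
      Tendsto (fun n => jet b ν (hf n).c2b) atTop (𝓝 u) := by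
  -- The jets of cylindrical functions already form a subspace, so the linear span adds nothing.
  have key : ∀ p ∈ Submodule.span ℝ {p : Lp ℝ 2 ν × Lp (CM μ) 2 ν × Lp (HS μ ι) 2 ν |
      ∃ f : X → ℝ, IsFCbInf f ∧ p.1 =ᵐ[ν] f ∧ p.2.1 =ᵐ[ν] gradH μ f ∧
        ∀ᵐ x ∂ν, ∀ i, p.2.2 x i = hessH μ f x (b i)},
      ∃ (f : X → ℝ) (hf : IsFCbInf f), p = jet b ν hf.c2b := by
    intro p hp
    induction hp using Submodule.span_induction with
    | mem p hp =>
      obtain ⟨f, hf, h⟩ := hp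
      exact ⟨f, hf, (jet_eq_iff b hf.c2b p).1 h⟩
    | zero =>
      refine ⟨_, (IsFCbInf.const (0 : ℝ)).const_mul 0, ?_⟩
      rw [jet_const_mul b 0 (IsFCbInf.const (0 : ℝ)).c2b, zero_smul]
    | add p q _ _ hp hq =>
      obtain ⟨f, hf, rfl⟩ := hp
      obtain ⟨g, hg, rfl⟩ := hq
      exact ⟨_, hf.add hg, (jet_add b hf.c2b hg.c2b _).symm⟩
    | smul c p _ hp =>
      obtain ⟨f, hf, rfl⟩ := hp
      exact ⟨_, hf.const_mul c, (jet_const_mul b c hf.c2b _).symm⟩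
  obtain ⟨x, hx, hlim⟩ := mem_closure_iff_seq_limit.1 hu
  choose f hf h using fun n => key (x n) (hx n)
  exact ⟨f, hf, by simpa only [← h] using hlim⟩

/-- The pair `(f, ∇_H f)` of a function of class `C²` with bounded derivatives. -/
def jetOne (μ : Measure X) [IsGaussian μ] (ν : Measure X) [IsFiniteMeasure ν] (hf : C2b f) :
    Lp ℝ 2 ν × Lp (CM μ) 2 ν :=
  ((hf.memLp 2).toLp f, (hf.memLp_grad 2).toLp _)

theorem exists_jetOne_tendsto {u : Lp ℝ 2 ν × Lp (CM μ) 2 ν} (hu : u ∈ W12 μ ν) :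
    ∃ (f : ℕ → X → ℝ) (hf : ∀ n, IsFCbInf (f n)),
      Tendsto (fun n => jetOne μ ν (hf n).c2b) atTop (𝓝 u) := by
  have ext_grad : ∀ {f : X → ℝ} (hf : C2b f) (p : Lp (CM μ) 2 ν),
      p =ᵐ[ν] (fun x => repL μ (fderiv ℝ f x)) → p = (jetOne μ ν hf).2 := fun hf p h =>
    Lp.ext (h.trans (MemLp.coeFn_toLp (hf.memLp_grad 2)).symm)
  have key : ∀ p ∈ Submodule.span ℝ {p : Lp ℝ 2 ν × Lp (CM μ) 2 ν |
      ∃ f : X → ℝ, IsFCbInf f ∧ p.1 =ᵐ[ν] f ∧ p.2 =ᵐ[ν] gradH μ f},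
      ∃ (f : X → ℝ) (hf : IsFCbInf f), p = jetOne μ ν hf.c2b := by
    intro p hp
    induction hp using Submodule.span_induction with
    | mem p hp =>
      obtain ⟨f, hf, h1, h2⟩ := hp
      have hg : gradH μ f = fun x => repL μ (fderiv ℝ f x) :=
        funext fun x => gradH_eq μ (hf.c2b.differentiable x)
      rw [hg] at h2
      exact ⟨f, hf, Prod.ext (Lp.ext (h1.trans (MemLp.coeFn_toLp (hf.c2b.memLp 2)).symm))
        (ext_grad hf.c2b _ h2)⟩
    | zero =>
      refine ⟨_, IsFCbInf.const (0 : ℝ), Prod.ext ?_ (ext_grad _ _ ?_)⟩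
      · exact Lp.ext ((Lp.coeFn_zero _ _ _).trans
          (MemLp.coeFn_toLp ((IsFCbInf.const (0 : ℝ)).c2b.memLp 2)).symm)
      · filter_upwards [Lp.coeFn_zero (CM μ) 2 ν] with x hx
        rw [Prod.snd_zero, hx]
        simp
    | add p q _ _ hp hq =>
      obtain ⟨f, hf, rfl⟩ := hp
      obtain ⟨g, hg, rfl⟩ := hq
      refine ⟨_, hf.add hg, Prod.ext rfl (ext_grad _ _ ?_)⟩
      refine (Lp.coeFn_add _ _).trans ?_
      filter_upwards [MemLp.coeFn_toLp (hf.c2b.memLp_grad (μ := μ) (ν := ν) 2),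
        MemLp.coeFn_toLp (hg.c2b.memLp_grad (μ := μ) (ν := ν) 2)] with x h1 h2
      rw [fderiv_add_fun hf.c2b hg.c2b, map_add, ← h1, ← h2]
      rfl
    | smul c p _ hp =>
      obtain ⟨f, hf, rfl⟩ := hp
      refine ⟨_, hf.const_mul c, Prod.ext rfl (ext_grad _ _ ?_)⟩
      refine (Lp.coeFn_smul _ _).trans ?_
      filter_upwards [MemLp.coeFn_toLp (hf.c2b.memLp_grad (μ := μ) (ν := ν) 2)] with x h1
      rw [fderiv_const_mul_fun c hf.c2b, map_smul, ← h1]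
      rfl
  obtain ⟨x, hx, hlim⟩ := mem_closure_iff_seq_limit.1 hu
  choose f hf h using fun n => key (x n) (hx n)
  exact ⟨f, hf, by simpa only [← h] using hlim⟩

end Jet

/-! ### Disintegration of the measure along the normal lines -/

section Fibers

variable {X : Type*} [NormedAddCommGroup X] [NormedSpace ℝ X] [MeasurableSpace X] [BorelSpace X]
  [CompleteSpace X] [SecondCountableTopology X] (μ : Measure X) [IsGaussian μ]
  (xs : StrongDual ℝ X)

/-- The direction `h_{x*} / |h_{x*}|²` of `X`, normalized by `x* v = 1`. -/
def normalDir : X := (‖repL μ xs‖ ^ 2)⁻¹ • embL μ (repL μ xs)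

/-- The law of `x*` under `μ`. -/
def normalLaw : Measure ℝ := gaussianReal 0 (‖repL μ xs‖₊ ^ 2)

instance : IsProbabilityMeasure (normalLaw μ xs) := by unfold normalLaw; infer_instance

theorem dual_normalDir (L : StrongDual ℝ X) :
    L (normalDir μ xs) = (‖repL μ xs‖ ^ 2)⁻¹ * ⟪repL μ L, repL μ xs⟫_ℝ := by
  rw [normalDir, map_smul, dual_embL, smul_eq_mul]

variable {μ xs}

theorem repL_ne_zero (hnd : 0 < Var[xs; μ]) (hcent : μ[xs] = 0) : repL μ xs ≠ 0 := by
  intro h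
  have h1 := norm_repL_sq μ xs
  rw [h, ← variance_of_integral_eq_zero (by fun_prop) hcent] at h1
  simp at h1
  exact hnd.ne h1

theorem xs_normalDir (h0 : repL μ xs ≠ 0) : xs (normalDir μ xs) = 1 := by
  rw [dual_normalDir, real_inner_self_eq_norm_sq]
  exact inv_mul_cancel₀ (by positivity)

theorem charFunDual_centered (hcent : ∀ L : StrongDual ℝ X, μ[L] = 0) (L : StrongDual ℝ X) :
    charFunDual μ L = Complex.exp (-(‖repL μ L‖ ^ 2 : ℝ) / 2) := by
  rw [IsGaussian.charFunDual_eq, integral_complex_ofReal, hcent L, norm_repL_sq,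
    ← variance_of_integral_eq_zero (by fun_prop) (hcent L)]
  congr 1
  push_cast
  ring

/-- The point of the fiber through `x` at height `t`. -/
def fib (μ : Measure X) [IsGaussian μ] (xs : StrongDual ℝ X) (x : X) (t : ℝ) : X :=
  aff xs (normalDir μ xs) 1 t x

theorem fib_eq (x : X) (t : ℝ) : fib μ xs x t = x - (xs x - t) • normalDir μ xs := by
  rw [fib, aff, one_mul]

theorem continuous_fib : Continuous (fun p : X × ℝ => fib μ xs p.1 p.2) := by
  simp only [fib_eq]
  fun_prop

theorem xs_fib (h0 : repL μ xs ≠ 0) (x : X) (t : ℝ) : xs (fib μ xs x t) = t := by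
  rw [fib_eq, map_sub, map_smul, xs_normalDir h0]
  simp

theorem fib_fib (h0 : repL μ xs ≠ 0) (x : X) (s t : ℝ) :
    fib μ xs (fib μ xs x s) t = fib μ xs x t := by
  rw [fib_eq (fib μ xs x s), xs_fib h0, fib_eq, fib_eq]
  module

theorem fib_self (x : X) : fib μ xs x (xs x) = x := by
  rw [fib_eq]
  simp

theorem fib_add (x : X) (s t : ℝ) :
    fib μ xs x t = fib μ xs x s + (t - s) • normalDir μ xs := by
  rw [fib_eq, fib_eq]
  module

/-- Under `μ` the variable `x*` is independent of `x - x*(x) v`, since the two are jointly Gaussian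
and uncorrelated; resampling `x*` therefore leaves `μ` unchanged. The proof compares characteristic
functionals. Every Fubini argument along the fibers rests on this. -/
theorem map_fib (hcent : ∀ L : StrongDual ℝ X, μ[L] = 0) (h0 : repL μ xs ≠ 0) :
    (μ.prod (normalLaw μ xs)).map (fun p => fib μ xs p.1 p.2) = μ := by
  let A : X × ℝ →L[ℝ] X := ContinuousLinearMap.fst ℝ X ℝ -
    ((xs.comp (ContinuousLinearMap.fst ℝ X ℝ)) - ContinuousLinearMap.snd ℝ X ℝ).smulRight
      (normalDir μ xs)
  have hA : (fun p : X × ℝ => fib μ xs p.1 p.2) = A := by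
    funext p
    simp [A, fib_eq]
  rw [hA]
  have : IsFiniteMeasure ((μ.prod (normalLaw μ xs)).map A) := inferInstance
  refine Measure.ext_of_charFunDual ?_
  funext L
  rw [charFunDual_map, charFunDual_prod, charFunDual_centered hcent, charFunDual_centered hcent]
  have e1 : (L.comp A).comp (ContinuousLinearMap.inl ℝ X ℝ) = L - L (normalDir μ xs) • xs := by
    ext x
    simp [A]
    ring
  have e2 : charFunDual (normalLaw μ xs) ((L.comp A).comp (ContinuousLinearMap.inr ℝ X ℝ))
      = Complex.exp (-((L (normalDir μ xs)) ^ 2 * ‖repL μ xs‖ ^ 2 : ℝ) / 2) := by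
    rw [normalLaw, IsGaussian.charFunDual_eq, integral_complex_ofReal,
      integral_continuousLinearMap_gaussianReal,
      variance_continuousLinearMap_gaussianReal]
    have : ((L.comp A).comp (ContinuousLinearMap.inr ℝ X ℝ)) 1 = L (normalDir μ xs) := by
      simp [A]
    rw [this, map_zero, Real.coe_toNNReal _ (sq_nonneg _)]
    congr 1
    push_cast
    ring
  rw [e1, e2, ← Complex.exp_add, map_sub, map_smul]
  congr 1
  have h2 : ‖repL μ xs‖ ^ 2 ≠ 0 := by positivity
  -- Pythagoras: `L (normalDir μ xs) • repL μ xs` is the orthogonal projection of `repL μ L` onto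
  -- the line of `repL μ xs`.
  have e3 : ‖repL μ L - L (normalDir μ xs) • repL μ xs‖ ^ 2
      + L (normalDir μ xs) ^ 2 * ‖repL μ xs‖ ^ 2 = ‖repL μ L‖ ^ 2 := by
    rw [norm_sub_sq_real, inner_smul_right, norm_smul, mul_pow, Real.norm_eq_abs, sq_abs,
      dual_normalDir]
    field_simp
    ring
  rw [← e3]
  push_cast
  ring

/-- Fubini along the fibers. -/
theorem lintegral_fib (hcent : ∀ L : StrongDual ℝ X, μ[L] = 0) (h0 : repL μ xs ≠ 0)
    {g : X → ℝ≥0∞} (hg : Measurable g) :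
    ∫⁻ x, g x ∂μ = ∫⁻ x, ∫⁻ t, g (fib μ xs x t) ∂(normalLaw μ xs) ∂μ := by
  conv_lhs => rw [← map_fib hcent h0]
  rw [lintegral_map hg continuous_fib.measurable, lintegral_prod]
  exact (hg.comp continuous_fib.measurable).aemeasurable

theorem lintegral_fib_swap (hcent : ∀ L : StrongDual ℝ X, μ[L] = 0) (h0 : repL μ xs ≠ 0)
    {g : X → ℝ≥0∞} (hg : Measurable g) :
    ∫⁻ x, g x ∂μ = ∫⁻ t, ∫⁻ x, g (fib μ xs x t) ∂μ ∂(normalLaw μ xs) := by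
  conv_lhs => rw [← map_fib hcent h0]
  rw [lintegral_map hg continuous_fib.measurable, lintegral_prod_symm]
  exact (hg.comp continuous_fib.measurable).aemeasurable

/-- The density of the law of `x*`. -/
def normalDens (μ : Measure X) [IsGaussian μ] (xs : StrongDual ℝ X) (t : ℝ) : ℝ :=
  (√(2 * Real.pi * ‖repL μ xs‖ ^ 2))⁻¹ * Real.exp (-t ^ 2 / (2 * ‖repL μ xs‖ ^ 2))

theorem normalDens_pos (h0 : repL μ xs ≠ 0) (t : ℝ) : 0 < normalDens μ xs t := by
  have : 0 < ‖repL μ xs‖ := norm_pos_iff.2 h0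
  have := Real.pi_pos
  unfold normalDens
  positivity

theorem continuous_normalDens : Continuous (normalDens μ xs) := by
  unfold normalDens
  fun_prop

theorem normalLaw_eq (h0 : repL μ xs ≠ 0) :
    normalLaw μ xs = volume.withDensity fun t => ENNReal.ofReal (normalDens μ xs t) := by
  have : ‖repL μ xs‖₊ ^ 2 ≠ 0 := by
    simpa using h0
  rw [normalLaw, gaussianReal_of_var_ne_zero _ this]
  congr 1
  funext t
  simp [gaussianPDF, gaussianPDFReal, normalDens]

theorem lintegral_normalLaw (h0 : repL μ xs ≠ 0) {g : ℝ → ℝ≥0∞} (hg : Measurable g) :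
    ∫⁻ t, g t ∂(normalLaw μ xs) = ∫⁻ t, ENNReal.ofReal (normalDens μ xs t) * g t := by
  rw [normalLaw_eq h0, lintegral_withDensity_eq_lintegral_mul _
    (continuous_normalDens.measurable.ennreal_ofReal) hg]
  rfl

/-- Each fiber meets the hyperplane in one point and the law of `x*` has no atoms. Pointwise
statements about glued functions may thus ignore the hyperplane. -/
theorem measure_level (hcent : ∀ L : StrongDual ℝ X, μ[L] = 0) (h0 : repL μ xs ≠ 0) (r : ℝ) :
    μ {x | xs x = r} = 0 := by
  have hm : MeasurableSet {x | xs x = r} := (isClosed_eq xs.continuous continuous_const).measurableSet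
  rw [← lintegral_indicator_one hm, lintegral_fib hcent h0 (measurable_one.indicator hm)]
  have : ∀ x, (∫⁻ t, ({x | xs x = r}.indicator 1 (fib μ xs x t) : ℝ≥0∞) ∂(normalLaw μ xs)) = 0 := by
    intro x
    have e : (fun t => ({x | xs x = r}.indicator 1 (fib μ xs x t) : ℝ≥0∞))
        = ({r} : Set ℝ).indicator 1 := by
      funext t
      simp [indicator, xs_fib h0]
    have h2 : ‖repL μ xs‖₊ ^ 2 ≠ 0 := by simpa using h0
    have := nullSingletonClass_gaussianReal (μ := 0) h2
    rw [e, lintegral_indicator_one (measurableSet_singleton r), normalLaw]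
    simp
  simp [this]

end Fibers

/-! ### One-dimensional estimates -/

section Generic

theorem eLpNorm_two_sq {α V : Type*} [MeasurableSpace α] [NormedAddCommGroup V] (f : α → V)
    (ν : Measure α) : eLpNorm f 2 ν ^ 2 = ∫⁻ x, ‖f x‖ₑ ^ 2 ∂ν := by
  have h := eLpNorm_nnreal_pow_eq_lintegral (f := f) (μ := ν) (p := 2) (by norm_num)
  have e : ((2 : ℝ≥0) : ℝ) = ((2 : ℕ) : ℝ) := by norm_num
  simp only [e, ENNReal.rpow_natCast] at h
  exact_mod_cast h

theorem sq_setLIntegral_le {h : ℝ → ℝ≥0∞} (hh : Measurable h) (a c : ℝ) :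
    (∫⁻ t in Icc a c, h t) ^ 2 ≤ ENNReal.ofReal (c - a) * ∫⁻ t in Icc a c, h t ^ 2 := by
  have h1 := ENNReal.lintegral_mul_le_Lp_mul_Lq (volume.restrict (Icc a c))
    Real.HolderConjugate.two_two (f := fun _ => 1) (g := h) aemeasurable_const hh.aemeasurable
  have h2 := ENNReal.pow_le_pow_left (n := 2) h1
  rw [mul_pow, ← ENNReal.rpow_natCast, ← ENNReal.rpow_natCast (_ ^ _), ← ENNReal.rpow_natCast (_ ^ _),
    ← ENNReal.rpow_mul, ← ENNReal.rpow_mul] at h2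
  norm_num at h2
  simpa using h2

/-- The fundamental theorem of calculus with the Cauchy–Schwarz inequality. -/
theorem enorm_sub_sq_le_lintegral {V : Type*} [NormedAddCommGroup V] [NormedSpace ℝ V]
    [CompleteSpace V] {φ φ' : ℝ → V} (hd : ∀ t, HasDerivAt φ (φ' t) t) (hc : Continuous φ')
    {a c s t : ℝ} (hs : s ∈ Icc a c) (ht : t ∈ Icc a c) :
    ‖φ t - φ s‖ₑ ^ 2 ≤ ENNReal.ofReal (c - a) * ∫⁻ w in Icc a c, ‖φ' w‖ₑ ^ 2 := by
  refine le_trans (pow_le_pow_left' ?_ 2) (sq_setLIntegral_le hc.enorm.measurable a c)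
  have e := intervalIntegral.integral_eq_sub_of_hasDerivAt (a := s) (b := t)
    (fun x _ => hd x) (hc.intervalIntegrable s t)
  have hsub : uIoc s t ⊆ Icc a c := fun w hw => by
    have := uIoc_subset_uIcc hw
    exact (uIcc_subset_Icc hs ht) this
  calc ‖φ t - φ s‖ₑ = ‖∫ w in uIoc s t, φ' w‖ₑ := by
        rw [← e, ← ofReal_norm, intervalIntegral.norm_intervalIntegral_eq, ofReal_norm]
    _ ≤ ∫⁻ w in uIoc s t, ‖φ' w‖ₑ := enorm_integral_le_lintegral_enorm _
    _ ≤ ∫⁻ w in Icc a c, ‖φ' w‖ₑ := lintegral_mono_set hsub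

end Generic

/-! ### Thin strips and their Poincaré inequality -/

section Strip

variable {X : Type*} [NormedAddCommGroup X] [NormedSpace ℝ X] [MeasurableSpace X] [BorelSpace X]
  [CompleteSpace X] [SecondCountableTopology X] {μ : Measure X} [IsGaussian μ]
  {xs : StrongDual ℝ X} {r ε : ℝ}
  {V : Type*} [NormedAddCommGroup V] [NormedSpace ℝ V] [CompleteSpace V]

/-- The strip `{r - ε ≤ x* ≤ r}`. -/
def strip (xs : StrongDual ℝ X) (r ε : ℝ) : Set X := {x | xs x ∈ Icc (r - ε) r}

theorem measurableSet_strip : MeasurableSet (strip xs r ε) :=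
  xs.continuous.measurable measurableSet_Icc

theorem measurableSet_halfSpace : MeasurableSet (halfSpace xs r) :=
  (isClosed_le xs.continuous continuous_const).measurableSet

theorem strip_subset_halfSpace : strip xs r ε ⊆ halfSpace xs r := fun _ hx => hx.2

theorem indicator_strip_fib (h0 : repL μ xs ≠ 0) (g : X → ℝ≥0∞) (x : X) (t : ℝ) :
    (strip xs r ε).indicator g (fib μ xs x t)
      = (Icc (r - ε) r).indicator (fun t => g (fib μ xs x t)) t := by
  simp only [indicator, strip, mem_ofPred_eq, xs_fib h0]

theorem setLIntegral_strip (hcent : ∀ L : StrongDual ℝ X, μ[L] = 0) (h0 : repL μ xs ≠ 0)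
    {g : X → ℝ≥0∞} (hg : Measurable g) :
    ∫⁻ x in strip xs r ε, g x ∂μ
      = ∫⁻ x, ∫⁻ t in Icc (r - ε) r, g (fib μ xs x t) ∂(normalLaw μ xs) ∂μ := by
  rw [← lintegral_indicator measurableSet_strip,
    lintegral_fib hcent h0 (hg.indicator measurableSet_strip)]
  refine lintegral_congr fun x => ?_
  rw [← lintegral_indicator measurableSet_Icc]
  exact lintegral_congr fun t => indicator_strip_fib h0 g x t

theorem setLIntegral_strip_swap (hcent : ∀ L : StrongDual ℝ X, μ[L] = 0) (h0 : repL μ xs ≠ 0)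
    {g : X → ℝ≥0∞} (hg : Measurable g) :
    ∫⁻ x in strip xs r ε, g x ∂μ
      = ∫⁻ t in Icc (r - ε) r, ∫⁻ x, g (fib μ xs x t) ∂μ ∂(normalLaw μ xs) := by
  rw [← lintegral_indicator measurableSet_strip,
    lintegral_fib_swap hcent h0 (hg.indicator measurableSet_strip),
    ← lintegral_indicator measurableSet_Icc]
  refine lintegral_congr fun t => ?_
  simp only [indicator_strip_fib h0]
  by_cases ht : t ∈ Icc (r - ε) r <;> simp [ht]

/-- Fubini separates the interval from the fibers. Functions of the form `F ∘ π_t` thereby have the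
same norm on the strip and on `X`, up to the mass of the interval, which is of order `ε`. -/
theorem setLIntegral_strip_of_const (hcent : ∀ L : StrongDual ℝ X, μ[L] = 0)
    (h0 : repL μ xs ≠ 0) {g : X → ℝ≥0∞} (hg : Measurable g)
    (hc : ∀ x t, g (fib μ xs x t) = g x) :
    ∫⁻ x in strip xs r ε, g x ∂μ = normalLaw μ xs (Icc (r - ε) r) * ∫⁻ x, g x ∂μ := by
  rw [setLIntegral_strip hcent h0 hg]
  simp only [hc, lintegral_const, Measure.restrict_apply, MeasurableSet.univ, univ_inter]
  rw [lintegral_mul_const' _ _ (measure_ne_top _ _), mul_comm]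

/-- The `L²` norm over the strip of a function that is constant along the fibers. -/
theorem eLpNorm_strip_comp_fib_sq (hcent : ∀ L : StrongDual ℝ X, μ[L] = 0)
    (h0 : repL μ xs ≠ 0) {F : X → V} {t : ℝ} (hF : Continuous fun x => F (fib μ xs x t)) :
    eLpNorm (fun x => F (fib μ xs x t)) 2 (μ.restrict (strip xs r ε)) ^ 2
      = normalLaw μ xs (Icc (r - ε) r) * eLpNorm (fun x => F (fib μ xs x t)) 2 μ ^ 2 := by
  rw [eLpNorm_two_sq, eLpNorm_two_sq]
  refine setLIntegral_strip_of_const hcent h0 (hF.enorm.measurable.pow_const 2) fun x s => ?_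
  rw [fib_fib h0]

/-- Bounds of the density of `x*` near `r`. -/
theorem exists_dens_bounds (μ : Measure X) [IsGaussian μ] (xs : StrongDual ℝ X)
    (h0 : repL μ xs ≠ 0) (r : ℝ) : ∃ c C : ℝ, 0 < c ∧ 0 < C ∧
      ∀ t ∈ Icc (r - 1) r, c ≤ normalDens μ xs t ∧ normalDens μ xs t ≤ C := by
  have hne : (Icc (r - 1) r).Nonempty := nonempty_Icc.2 (by linarith)
  obtain ⟨s, hs, hmin⟩ := isCompact_Icc.exists_isMinOn hne
    (continuous_normalDens (μ := μ) (xs := xs)).continuousOn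
  obtain ⟨w, hw, hmax⟩ := isCompact_Icc.exists_isMaxOn hne
    (continuous_normalDens (μ := μ) (xs := xs)).continuousOn
  exact ⟨_, _, normalDens_pos h0 s, normalDens_pos h0 w, fun t ht => ⟨hmin ht, hmax ht⟩⟩

theorem setLIntegral_normalLaw (h0 : repL μ xs ≠ 0) {g : ℝ → ℝ≥0∞} (hg : Measurable g)
    {s : Set ℝ} (hs : MeasurableSet s) :
    ∫⁻ t in s, g t ∂(normalLaw μ xs) = ∫⁻ t in s, ENNReal.ofReal (normalDens μ xs t) * g t := by
  rw [← lintegral_indicator hs, lintegral_normalLaw h0 (hg.indicator hs), ← lintegral_indicator hs]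
  refine lintegral_congr fun t => ?_
  by_cases ht : t ∈ s <;> simp [ht]

theorem normalLaw_Icc_bounds (h0 : repL μ xs ≠ 0) {c C : ℝ}
    (hcC : ∀ t ∈ Icc (r - 1) r, c ≤ normalDens μ xs t ∧ normalDens μ xs t ≤ C)
    (hε : ε ∈ Ioc (0 : ℝ) 1) {g : ℝ → ℝ≥0∞} (hg : Measurable g) :
    ENNReal.ofReal c * (∫⁻ t in Icc (r - ε) r, g t)
        ≤ ∫⁻ t in Icc (r - ε) r, g t ∂(normalLaw μ xs) ∧
      ∫⁻ t in Icc (r - ε) r, g t ∂(normalLaw μ xs)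
        ≤ ENNReal.ofReal C * ∫⁻ t in Icc (r - ε) r, g t := by
  have hsub : Icc (r - ε) r ⊆ Icc (r - 1) r := Icc_subset_Icc_left (by linarith [hε.2])
  rw [setLIntegral_normalLaw h0 hg measurableSet_Icc]
  constructor
  · rw [← lintegral_const_mul _ hg]
    exact setLIntegral_mono' measurableSet_Icc fun t ht => by
      gcongr
      exact (hcC t (hsub ht)).1
  · rw [← lintegral_const_mul _ hg]
    exact setLIntegral_mono' measurableSet_Icc fun t ht => by
      gcongr
      exact (hcC t (hsub ht)).2

theorem normalLaw_Icc_le (h0 : repL μ xs ≠ 0) {c C : ℝ}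
    (hcC : ∀ t ∈ Icc (r - 1) r, c ≤ normalDens μ xs t ∧ normalDens μ xs t ≤ C)
    (hε : ε ∈ Ioc (0 : ℝ) 1) :
    ENNReal.ofReal c * ENNReal.ofReal ε ≤ normalLaw μ xs (Icc (r - ε) r) ∧
      normalLaw μ xs (Icc (r - ε) r) ≤ ENNReal.ofReal C * ENNReal.ofReal ε := by
  simpa using normalLaw_Icc_bounds h0 hcC hε (g := fun _ => 1) measurable_const

/-- `F'` is the derivative of `F` along the fibers. -/
structure HasNormalDeriv (μ : Measure X) [IsGaussian μ] (xs : StrongDual ℝ X) (F F' : X → V) :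
    Prop where
  cont : Continuous F
  cont' : Continuous F'
  deriv : ∀ x t, HasDerivAt (fun t => F (fib μ xs x t)) (F' (fib μ xs x t)) t

theorem HasNormalDeriv.sub {F F' G G' : X → V} (hF : HasNormalDeriv μ xs F F')
    (hG : HasNormalDeriv μ xs G G') :
    HasNormalDeriv μ xs (fun x => F x - G x) (fun x => F' x - G' x) :=
  ⟨hF.cont.sub hG.cont, hF.cont'.sub hG.cont', fun x t => (hF.deriv x t).sub (hG.deriv x t)⟩

theorem HasNormalDeriv.clm {W : Type*} [NormedAddCommGroup W] [NormedSpace ℝ W] {F F' : X → V}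
    (hF : HasNormalDeriv μ xs F F') (A : V →L[ℝ] W) :
    HasNormalDeriv μ xs (fun x => A (F x)) (fun x => A (F' x)) :=
  ⟨A.continuous.comp hF.cont, A.continuous.comp hF.cont', fun x t =>
    A.hasFDerivAt.comp_hasDerivAt t (hF.deriv x t)⟩

theorem HasNormalDeriv.of_fderiv {F : X → V} (hF : ContDiff ℝ 1 F) :
    HasNormalDeriv μ xs F (fun x => fderiv ℝ F x (normalDir μ xs)) := by
  refine ⟨hF.continuous, (hF.continuous_fderiv (by norm_num)).clm_apply continuous_const,
    fun x t => ?_⟩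
  have h1 : HasDerivAt (fun t => fib μ xs x t) (normalDir μ xs) t := by
    have : (fun t => fib μ xs x t) = fun t => fib μ xs x 0 + t • normalDir μ xs := by
      funext t
      rw [fib_add x 0 t, sub_zero]
    rw [this]
    simpa using ((hasDerivAt_id t).smul_const (normalDir μ xs)).const_add (fib μ xs x 0)
  exact ((hF.differentiable (by norm_num) _).hasFDerivAt).comp_hasDerivAt t h1

theorem continuous_fib_const (t : ℝ) : Continuous fun x => fib μ xs x t :=
  continuous_fib.comp (continuous_id.prodMk continuous_const)

theorem continuous_fib_right (x : X) : Continuous fun t => fib μ xs x t :=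
  continuous_fib.comp (continuous_const.prodMk continuous_id)

/-- Poincaré inequality on thin strips. -/
theorem poincare_strip (hcent : ∀ L : StrongDual ℝ X, μ[L] = 0) (h0 : repL μ xs ≠ 0)
    {c C : ℝ} (hc : 0 < c) (hC : 0 < C)
    (hcC : ∀ t ∈ Icc (r - 1) r, c ≤ normalDens μ xs t ∧ normalDens μ xs t ≤ C)
    {F F' : X → V} (hF : HasNormalDeriv μ xs F F') (hε : ε ∈ Ioc (0 : ℝ) 1) {s : ℝ}
    (hs : s ∈ Icc (r - ε) r) :
    eLpNorm (fun x => F x - F (fib μ xs x s)) 2 (μ.restrict (strip xs r ε))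
      ≤ ENNReal.ofReal (√(C / c) * ε) * eLpNorm F' 2 (μ.restrict (strip xs r ε)) := by
  have hε0 : 0 ≤ ε := hε.1.le
  rw [← ENNReal.pow_le_pow_left_iff two_ne_zero, mul_pow, eLpNorm_two_sq, eLpNorm_two_sq]
  have hc0 : ENNReal.ofReal c ≠ 0 := by simpa using hc
  set g : X → ℝ≥0∞ := fun x => ‖F' x‖ₑ ^ 2 with hg
  have hgm : Measurable g := hF.cont'.enorm.measurable.pow_const 2
  set k : X → ℝ≥0∞ := fun x => ∫⁻ t in Icc (r - ε) r, g (fib μ xs x t) ∂(normalLaw μ xs) with hk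
  have hkm : Measurable k := by
    refine Measurable.lintegral_prod_right' (f := fun p : X × ℝ => g (fib μ xs p.1 p.2)) ?_
    exact hgm.comp continuous_fib.measurable
  -- Fundamental theorem of calculus on the fiber of `x` between the heights `s` and `x* x`. The
  -- lower bound `c` of the density replaces Lebesgue measure by the law of `x*`.
  have hpt : ∀ x ∈ strip xs r ε, ‖F x - F (fib μ xs x s)‖ₑ ^ 2
      ≤ ENNReal.ofReal ε * (ENNReal.ofReal c)⁻¹ * k x := by
    intro x hx
    have h1 := enorm_sub_sq_le_lintegral (hF.deriv x)
      (hF.cont'.comp (continuous_fib_right x)) hs hx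
    rw [fib_self, sub_sub_cancel] at h1
    refine h1.trans ?_
    rw [mul_assoc]
    gcongr
    rw [← ENNReal.div_eq_inv_mul, ENNReal.le_div_iff_mul_le (Or.inl hc0)
      (Or.inl ENNReal.ofReal_ne_top), mul_comm]
    exact (normalLaw_Icc_bounds h0 hcC hε
      (hgm.comp (continuous_fib_right x).measurable)).1
  calc ∫⁻ x in strip xs r ε, ‖F x - F (fib μ xs x s)‖ₑ ^ 2 ∂μ
      ≤ ∫⁻ x in strip xs r ε, ENNReal.ofReal ε * (ENNReal.ofReal c)⁻¹ * k x ∂μ :=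
        setLIntegral_mono' measurableSet_strip hpt
    -- The function `k` is constant along the fibers, so integrating it over the strip yields the
    -- mass of the interval, at most `C ε`. This second factor `ε` gives the constant `(C / c) ε²`
    -- for the squared norms.
    _ = ENNReal.ofReal ε * (ENNReal.ofReal c)⁻¹ *
          (normalLaw μ xs (Icc (r - ε) r) * ∫⁻ x in strip xs r ε, g x ∂μ) := by
        rw [lintegral_const_mul _ hkm, setLIntegral_strip_of_const hcent h0 hkm,
          setLIntegral_strip hcent h0 hgm]
        intro x t
        simp only [hk, fib_fib h0]
    _ ≤ ENNReal.ofReal ε * (ENNReal.ofReal c)⁻¹ *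
          (ENNReal.ofReal C * ENNReal.ofReal ε * ∫⁻ x in strip xs r ε, g x ∂μ) := by
        gcongr
        exact (normalLaw_Icc_le h0 hcC hε).2
    _ = ENNReal.ofReal (√(C / c) * ε) ^ 2 * ∫⁻ x in strip xs r ε, g x ∂μ := by
        rw [← ENNReal.ofReal_pow (by positivity), mul_pow, Real.sq_sqrt (by positivity),
          ← ENNReal.ofReal_inv_of_pos hc, ← mul_assoc, ← mul_assoc,
          ← ENNReal.ofReal_mul hε0, ← ENNReal.ofReal_mul (by positivity),
          ← ENNReal.ofReal_mul (by positivity)]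
        congr 2
        field_simp

/-- Some slice carries no more than the average over the strip. -/
theorem exists_slice (hcent : ∀ L : StrongDual ℝ X, μ[L] = 0) (h0 : repL μ xs ≠ 0)
    (hε : ε ∈ Ioc (0 : ℝ) 1) {F : X → V} (hF : Continuous F) :
    ∃ s ∈ Icc (r - ε) r, eLpNorm (fun x => F (fib μ xs x s)) 2 (μ.restrict (strip xs r ε))
      ≤ eLpNorm F 2 (μ.restrict (strip xs r ε)) := by
  obtain ⟨c, C, hc, hC, hcC⟩ := exists_dens_bounds μ xs h0 r
  have hpos : normalLaw μ xs (Icc (r - ε) r) ≠ 0 := by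
    have h1 := (normalLaw_Icc_le h0 hcC hε).1
    intro h
    rw [h] at h1
    have : 0 < ENNReal.ofReal c * ENNReal.ofReal ε :=
      ENNReal.mul_pos (by simpa using hc) (by simpa using hε.1)
    exact absurd h1 (not_le.2 this)
  have hgm : Measurable fun x => ‖F x‖ₑ ^ 2 := hF.enorm.measurable.pow_const 2
  obtain ⟨s, hs, hle⟩ := exists_le_setLAverage (μ := normalLaw μ xs) (s := Icc (r - ε) r)
    (f := fun t => ∫⁻ x, ‖F (fib μ xs x t)‖ₑ ^ 2 ∂μ) hpos (measure_ne_top _ _)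
    (Measurable.lintegral_prod_right' (f := fun p : ℝ × X => ‖F (fib μ xs p.2 p.1)‖ₑ ^ 2)
      (hgm.comp (continuous_fib.comp continuous_swap).measurable)).aemeasurable
  refine ⟨s, hs, ?_⟩
  rw [← ENNReal.pow_le_pow_left_iff two_ne_zero,
    eLpNorm_strip_comp_fib_sq hcent h0 (hF.comp (continuous_fib_const s)), eLpNorm_two_sq,
    eLpNorm_two_sq, setLIntegral_strip_swap hcent h0 hgm]
  rw [setLAverage_eq] at hle
  calc normalLaw μ xs (Icc (r - ε) r) * ∫⁻ x, ‖F (fib μ xs x s)‖ₑ ^ 2 ∂μ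
      ≤ normalLaw μ xs (Icc (r - ε) r) * _ := by gcongr
    _ = _ := ENNReal.mul_div_cancel hpos (measure_ne_top _ _)

end Strip

/-! ### The trace inequality -/

section Trace

variable {X : Type*} [NormedAddCommGroup X] [NormedSpace ℝ X] [MeasurableSpace X] [BorelSpace X]
  [CompleteSpace X] [SecondCountableTopology X] {μ : Measure X} [IsGaussian μ]
  {xs : StrongDual ℝ X} {r ε : ℝ}
  {V : Type*} [NormedAddCommGroup V] [NormedSpace ℝ V] [CompleteSpace V]

theorem fib_mem_halfSpace (h0 : repL μ xs ≠ 0) (x : X) : fib μ xs x r ∈ halfSpace xs r :=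
  (xs_fib h0 x r).le

theorem continuous_comp_fib_of_lipschitzOn (h0 : repL μ xs ≠ 0) {φ : X → V} {K : ℝ≥0}
    (hφ : LipschitzOnWith K φ (halfSpace xs r)) : Continuous fun x => φ (fib μ xs x r) :=
  hφ.continuousOn.comp_continuous (continuous_fib_const r) (fib_mem_halfSpace h0)

theorem aestronglyMeasurable_of_lipschitzOn {φ : X → V} {K : ℝ≥0}
    (hφ : LipschitzOnWith K φ (halfSpace xs r)) :
    AEStronglyMeasurable φ (μ.restrict (halfSpace xs r)) :=
  hφ.continuousOn.aestronglyMeasurable measurableSet_halfSpace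

/-- The trace inequality. -/
theorem trace_ineq (hcent : ∀ L : StrongDual ℝ X, μ[L] = 0) (h0 : repL μ xs ≠ 0)
    {c C : ℝ} (hc : 0 < c) (hC : 0 < C)
    (hcC : ∀ t ∈ Icc (r - 1) r, c ≤ normalDens μ xs t ∧ normalDens μ xs t ≤ C)
    {F F' : X → V} (hF : HasNormalDeriv μ xs F F') {φ : X → V} {K : ℝ≥0}
    (hφ : LipschitzOnWith K φ (halfSpace xs r)) (hε : ε ∈ Ioc (0 : ℝ) 1) :
    eLpNorm (fun x => F (fib μ xs x r) - φ (fib μ xs x r)) 2 μ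
      ≤ ENNReal.ofReal (√(c * ε))⁻¹ *
          (ENNReal.ofReal (√(C / c) * ε) * eLpNorm F' 2 (μ.restrict (halfSpace xs r))
            + eLpNorm (fun x => F x - φ x) 2 (μ.restrict (halfSpace xs r)))
        + ENNReal.ofReal (K * ‖normalDir μ xs‖ * ε) := by
  have hε0 := hε.1
  set S := strip xs r ε
  set D := normalLaw μ xs (Icc (r - ε) r)
  set N := eLpNorm (fun x => F (fib μ xs x r) - φ (fib μ xs x r)) 2 μ
  have hcont : Continuous fun x => F (fib μ xs x r) - φ (fib μ xs x r) :=
    (hF.cont.comp (continuous_fib_const r)).sub (continuous_comp_fib_of_lipschitzOn h0 hφ)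
  have hD := normalLaw_Icc_le h0 hcC hε
  have hDpos : ENNReal.ofReal (√(c * ε)) ^ 2 ≤ D := by
    rw [← ENNReal.ofReal_pow (by positivity), Real.sq_sqrt (by positivity),
      ENNReal.ofReal_mul hc.le]
    exact hD.1
  have hD0 : D ≠ 0 := by
    refine ne_of_gt (lt_of_lt_of_le ?_ hDpos)
    have : 0 < √(c * ε) := Real.sqrt_pos.2 (by positivity)
    exact pos_of_ne_zero (pow_ne_zero 2 (ENNReal.ofReal_pos.2 this).ne')
  have hDt : D ≠ ⊤ := measure_ne_top _ _
  -- For functions constant along the fibers, `q` is the ratio of the `L²` norm on the strip to that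
  -- on `X`; it is at least `√(c ε)`.
  set q : ℝ≥0∞ := D ^ (1 / 2 : ℝ)
  have hq2 : q ^ 2 = D := by
    rw [← ENNReal.rpow_natCast, ← ENNReal.rpow_mul]
    norm_num
  have hq0 : q ≠ 0 := fun h => hD0 (by rw [← hq2, h]; simp)
  have hqt : q ≠ ⊤ := fun h => hDt (by rw [← hq2, h]; simp)
  have hqc : q⁻¹ ≤ ENNReal.ofReal (√(c * ε))⁻¹ := by
    rw [ENNReal.ofReal_inv_of_pos (Real.sqrt_pos.2 (by positivity)), ENNReal.inv_le_inv,
      ← ENNReal.pow_le_pow_left_iff two_ne_zero, hq2]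
    exact hDpos
  have hS : eLpNorm (fun x => F (fib μ xs x r) - φ (fib μ xs x r)) 2 (μ.restrict S) = q * N := by
    have h1 := eLpNorm_strip_comp_fib_sq (r := r) (ε := ε) hcent h0
      (F := fun x => F x - φ x) (t := r) hcont
    refine (ENNReal.pow_right_strictMono two_ne_zero).injective ?_
    simp only [mul_pow, hq2]
    exact h1
  have hle : μ.restrict S ≤ μ.restrict (halfSpace xs r) :=
    Measure.restrict_mono strip_subset_halfSpace le_rfl
  have hFm : AEStronglyMeasurable F (μ.restrict S) := hF.cont.aestronglyMeasurable
  have hFm' : AEStronglyMeasurable (fun x => F (fib μ xs x r)) (μ.restrict S) :=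
    (hF.cont.comp (continuous_fib_const r)).aestronglyMeasurable
  have hφm : AEStronglyMeasurable φ (μ.restrict S) :=
    (aestronglyMeasurable_of_lipschitzOn hφ).mono_measure hle
  have hφm' : AEStronglyMeasurable (fun x => φ (fib μ xs x r)) (μ.restrict S) :=
    (continuous_comp_fib_of_lipschitzOn h0 hφ).aestronglyMeasurable
  -- No derivative of `φ` is available, so its oscillation on a fiber is controlled by the Lipschitz
  -- constant instead of the Poincaré inequality.
  have hlip : eLpNorm (fun x => φ x - φ (fib μ xs x r)) 2 (μ.restrict S)
      ≤ ENNReal.ofReal (K * ‖normalDir μ xs‖ * ε) * q := by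
    have hb : ∀ᵐ x ∂(μ.restrict S), ‖φ x - φ (fib μ xs x r)‖ ≤ K * ‖normalDir μ xs‖ * ε := by
      refine (ae_restrict_iff' measurableSet_strip).2 (ae_of_all _ fun x hx => ?_)
      have h1 := hφ.dist_le_mul x (strip_subset_halfSpace hx) _ (fib_mem_halfSpace h0 x)
      rw [dist_eq_norm, dist_eq_norm] at h1
      refine h1.trans ?_
      rw [fib_eq, sub_sub_cancel, norm_smul, mul_assoc]
      have h2 : ‖xs x - r‖ ≤ ε := by
        rw [Real.norm_eq_abs, abs_le]
        constructor <;> linarith [hx.1, hx.2]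
      calc (K : ℝ) * (‖xs x - r‖ * ‖normalDir μ xs‖) ≤ K * (ε * ‖normalDir μ xs‖) := by gcongr
        _ = K * (‖normalDir μ xs‖ * ε) := by ring
    have h1 := eLpNorm_le_of_ae_bound (p := 2) hb
    have h2 : μ.restrict S univ = D := by
      rw [← lintegral_one, setLIntegral_strip_of_const hcent h0 measurable_const (by simp)]
      simp [D]
    rw [h2, mul_comm] at h1
    convert h1 using 3
    norm_num
  have htri : q * N ≤ ENNReal.ofReal (√(C / c) * ε) * eLpNorm F' 2 (μ.restrict (halfSpace xs r))
        + eLpNorm (fun x => F x - φ x) 2 (μ.restrict (halfSpace xs r))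
        + ENNReal.ofReal (K * ‖normalDir μ xs‖ * ε) * q := by
    rw [← hS]
    -- The difference of the traces is moved into the strip: an oscillation of `F`, the difference
    -- `F - φ`, and an oscillation of `φ`.
    have e : (fun x => F (fib μ xs x r) - φ (fib μ xs x r)) =
        ((fun x => F (fib μ xs x r) - F x) + (fun x => F x - φ x))
          + fun x => φ x - φ (fib μ xs x r) := by
      funext x
      simp
    rw [e]
    refine (eLpNorm_add_le ((hFm'.sub hFm).add (hFm.sub hφm)) (hφm.sub hφm') (by norm_num)).trans ?_
    refine add_le_add ((eLpNorm_add_le (hFm'.sub hFm) (hFm.sub hφm) (by norm_num)).trans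
      (add_le_add ?_ ?_)) hlip
    · have h1 := poincare_strip hcent h0 hc hC hcC hF hε (s := r) ⟨by linarith, le_rfl⟩
      have h2 : eLpNorm (fun x => F (fib μ xs x r) - F x) 2 (μ.restrict S)
          = eLpNorm (fun x => F x - F (fib μ xs x r)) 2 (μ.restrict S) := by
        rw [← eLpNorm_neg]
        congr 1
        funext x
        simp
      refine (h2.le.trans h1).trans ?_
      gcongr
    · exact eLpNorm_mono_measure _ hle
  calc N = q⁻¹ * (q * N) := by rw [← mul_assoc, ENNReal.inv_mul_cancel hq0 hqt, one_mul]
    _ ≤ q⁻¹ * (ENNReal.ofReal (√(C / c) * ε) * eLpNorm F' 2 (μ.restrict (halfSpace xs r))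
        + eLpNorm (fun x => F x - φ x) 2 (μ.restrict (halfSpace xs r))
        + ENNReal.ofReal (K * ‖normalDir μ xs‖ * ε) * q) := by gcongr
    _ = q⁻¹ * (ENNReal.ofReal (√(C / c) * ε) * eLpNorm F' 2 (μ.restrict (halfSpace xs r))
        + eLpNorm (fun x => F x - φ x) 2 (μ.restrict (halfSpace xs r)))
        + ENNReal.ofReal (K * ‖normalDir μ xs‖ * ε) := by
        rw [mul_add, mul_comm _ q, ← mul_assoc, ENNReal.inv_mul_cancel hq0 hqt, one_mul]
    _ ≤ _ := by gcongr

/-- Convergence in `L²(Ω)` with bounded normal derivatives implies convergence of the traces. -/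
theorem tendsto_trace (hcent : ∀ L : StrongDual ℝ X, μ[L] = 0) (h0 : repL μ xs ≠ 0)
    {F F' : ℕ → X → V} (hF : ∀ n, HasNormalDeriv μ xs (F n) (F' n)) {φ : X → V} {K : ℝ≥0}
    (hφ : LipschitzOnWith K φ (halfSpace xs r)) {B : ℝ≥0∞} (hB : B ≠ ⊤)
    (hF' : ∀ n, eLpNorm (F' n) 2 (μ.restrict (halfSpace xs r)) ≤ B)
    (hlim : Tendsto (fun n => eLpNorm (fun x => F n x - φ x) 2 (μ.restrict (halfSpace xs r)))
      atTop (𝓝 0)) :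
    Tendsto (fun n => eLpNorm (fun x => F n (fib μ xs x r) - φ (fib μ xs x r)) 2 μ)
      atTop (𝓝 0) := by
  obtain ⟨c, C, hc, hC, hcC⟩ := exists_dens_bounds μ xs h0 r
  rw [ENNReal.tendsto_nhds_zero]
  intro δ hδ
  -- These are the terms of the trace inequality that do not see `F n - φ`. They are of order `√ε`
  -- and `ε` uniformly in `n`, so `ε` is fixed first; the factor `(c ε)^{-1/2}` of the remaining
  -- term is then harmless as `n` grows.
  have hlimε : Tendsto (fun ε : ℝ => ENNReal.ofReal (√(C / c) / √c * √ε) * B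
      + ENNReal.ofReal (K * ‖normalDir μ xs‖ * ε)) (𝓝[>] 0) (𝓝 0) := by
    have h1 : Tendsto (fun ε : ℝ => ENNReal.ofReal (√(C / c) / √c * √ε) * B
      + ENNReal.ofReal (K * ‖normalDir μ xs‖ * ε)) (𝓝 0)
        (𝓝 (ENNReal.ofReal (√(C / c) / √c * √0) * B
          + ENNReal.ofReal (K * ‖normalDir μ xs‖ * 0))) := by
      refine Tendsto.add (ENNReal.Tendsto.mul_const ?_ (Or.inr hB)) ?_
      · exact (ENNReal.continuous_ofReal.comp
          (continuous_const.mul Real.continuous_sqrt)).tendsto 0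
      · exact (ENNReal.continuous_ofReal.comp (continuous_const.mul continuous_id)).tendsto 0
    simp only [Real.sqrt_zero, mul_zero, ENNReal.ofReal_zero, zero_mul, add_zero] at h1
    exact h1.mono_left nhdsWithin_le_nhds
  have hδ2 : 0 < δ / 2 := ENNReal.half_pos hδ.ne'
  obtain ⟨ε, hε1, hε2⟩ := ((ENNReal.tendsto_nhds_zero.1 hlimε _ hδ2).and
    (Ioc_mem_nhdsGT (zero_lt_one' ℝ))).exists
  have hεpos : 0 < ε := hε2.1
  have h3 : Tendsto (fun n => ENNReal.ofReal (√(c * ε))⁻¹ *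
      eLpNorm (fun x => F n x - φ x) 2 (μ.restrict (halfSpace xs r))) atTop (𝓝 0) := by
    have := ENNReal.Tendsto.const_mul (a := ENNReal.ofReal (√(c * ε))⁻¹) hlim
      (Or.inr ENNReal.ofReal_ne_top)
    rwa [mul_zero] at this
  filter_upwards [ENNReal.tendsto_nhds_zero.1 h3 _ hδ2] with n hn
  refine (trace_ineq hcent h0 hc hC hcC (hF n) hφ hε2).trans ?_
  have e : ENNReal.ofReal (√(c * ε))⁻¹ * ENNReal.ofReal (√(C / c) * ε)
      = ENNReal.ofReal (√(C / c) / √c * √ε) := by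
    rw [← ENNReal.ofReal_mul (by positivity)]
    congr 1
    rw [Real.sqrt_mul hc.le]
    have : √ε ≠ 0 := (Real.sqrt_pos.2 hεpos).ne'
    have : √c ≠ 0 := (Real.sqrt_pos.2 hc).ne'
    field_simp
    rw [Real.sq_sqrt hεpos.le]
  rw [mul_add, ← mul_assoc, e]
  calc _ ≤ ENNReal.ofReal (√(C / c) / √c * √ε) * B + δ / 2
        + ENNReal.ofReal (K * ‖normalDir μ xs‖ * ε) := by gcongr; exact hF' n
    _ = (ENNReal.ofReal (√(C / c) / √c * √ε) * B + ENNReal.ofReal (K * ‖normalDir μ xs‖ * ε))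
        + δ / 2 := by ring
    _ ≤ δ / 2 + δ / 2 := by gcongr
    _ = δ := ENNReal.add_halves δ

end Trace

/-! ### The surface measure dominates a multiple of the projected Gaussian measure -/

section SurfaceBound

/-- In dimension zero every covering ball costs `w`, the volume of the unit ball of `ℝ⁰`, whatever
its radius. Hence a multiple of the Dirac mass lies below the outer measure already at scale 1. Only
this lower bound is needed. -/
theorem one_le_sphericalHausdorff_zero {Y : Type*} [MetricSpace Y] [MeasurableSpace Y]
    [BorelSpace Y] (y : Y) :
    volume (Metric.ball (0 : EuclideanSpace ℝ (Fin 0)) 1) ≤ sphericalHausdorff 0 Y {y} := by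
  set w := volume (Metric.ball (0 : EuclideanSpace ℝ (Fin 0)) 1)
  refine le_trans ?_ (le_toMeasure_apply _
    (OuterMeasure.mkMetric'_isMetric _).le_caratheodory _)
  have h : w • OuterMeasure.dirac y ≤ OuterMeasure.mkMetric' fun S : Set Y =>
      ⨅ (c : Y) (r : ℝ≥0) (_ : S ⊆ Metric.closedBall c r), w * (r : ℝ≥0∞) ^ 0 := by
    refine le_iSup₂_of_le 1 one_pos (OuterMeasure.mkMetric'.le_pre.2 fun S _ => ?_)
    simp only [pow_zero, mul_one, le_iInf_iff]
    intro _ _ _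
    rw [smul_apply, OuterMeasure.dirac_apply]
    by_cases hy : y ∈ S <;> simp [hy]
  have := h {y}
  simpa [smul_apply] using this

variable {X : Type*} [NormedAddCommGroup X] [NormedSpace ℝ X] [MeasurableSpace X] [BorelSpace X]
  [CompleteSpace X] [SecondCountableTopology X] {μ : Measure X} [IsGaussian μ]
  {xs : StrongDual ℝ X}

/-- The surface measure is tested on the line spanned by `h_{x*}`, where `m = 0` and the spherical
measure charges points. The section of the hyperplane by the fiber of `x` is the single point `π_r
x`, whose coordinate and weight do not depend on `x`. As a consequence, `L¹` convergence and almost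
everywhere statements on the hyperplane pass to `μ` after composition with `π_r`. -/
theorem exists_smul_map_le_bdryMeasure (h0 : repL μ xs ≠ 0) (r : ℝ) :
    ∃ κ : ℝ≥0∞, κ ≠ 0 ∧ κ ≠ ⊤ ∧
      κ • μ.map (fun x => fib μ xs x r) ≤ bdryMeasure μ xs r := by
  set σ := ‖repL μ xs‖ with hσdef
  have hσ : 0 < σ := norm_pos_iff.2 h0
  set w := volume (Metric.ball (0 : EuclideanSpace ℝ (Fin 0)) 1)
  have hw0 : w ≠ 0 := (Metric.measure_ball_pos _ _ one_pos).ne'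
  have hwt : w ≠ ⊤ := measure_ball_lt_top.ne
  -- The coordinate of the hyperplane on the fiber, measured along the unit vector `h_{x*} / σ`.
  set y : EuclideanSpace ℝ (Fin 1) := WithLp.toLp 2 fun _ => r / σ
  set dens : EuclideanSpace ℝ (Fin 1) → ℝ≥0∞ := fun y =>
    ENNReal.ofReal ((2 * Real.pi) ^ (-(((0 : ℕ) : ℝ) + 1) / 2) * Real.exp (-‖y‖ ^ 2 / 2))
  have hdens0 : dens y ≠ 0 := by
    have : 0 < (2 * Real.pi) ^ (-(((0 : ℕ) : ℝ) + 1) / 2) * Real.exp (-‖y‖ ^ 2 / 2) := by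
      have := Real.pi_pos
      positivity
    simpa only [dens, ne_eq, ENNReal.ofReal_eq_zero, not_le] using this
  have hsing : dens y * w ≤ gaussSpherical 0 {y} := by
    rw [gaussSpherical, withDensity_apply _ (measurableSet_singleton y), lintegral_singleton]
    gcongr
    exact one_le_sphericalHausdorff_zero y
  refine ⟨dens y * w, mul_ne_zero hdens0 hw0, ENNReal.mul_ne_top ENNReal.ofReal_ne_top hwt, ?_⟩
  have hmeas : Measurable fun x => fib μ xs x r := (continuous_fib_const r).measurable
  have hlevel : MeasurableSet {x | xs x = r} :=
    (isClosed_eq xs.continuous continuous_const).measurableSet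
  have key : (dens y * w) • μ.map (fun x => fib μ xs x r) ≤ surfaceMeasure μ := by
    refine le_sInf fun s hs => Measure.le_iff.2 fun B hB => ?_
    set e : Fin (0 + 1) → CM μ := fun _ => rep μ (σ⁻¹ • xs)
    have he : ∀ i, e i = σ⁻¹ • repL μ xs := fun i => by
      change repL μ (σ⁻¹ • xs) = _
      rw [map_smul]
    have hon : Orthonormal ℝ e := by
      refine ⟨fun i => ?_, fun i j hij => absurd (Subsingleton.elim (α := Fin 1) i j) hij⟩
      rw [he i, norm_smul, norm_inv, Real.norm_of_nonneg hσ.le]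
      exact inv_mul_cancel₀ hσ.ne'
    refine le_trans ?_ (hs 0 e hon B hB)
    rw [Measure.smul_apply, Measure.map_apply hmeas hB, smul_eq_mul, surfaceSection,
      ← lintegral_indicator_one (hmeas hB), ← lintegral_const_mul _
      (measurable_one.indicator (hmeas hB))]
    refine lintegral_mono_ae ?_
    filter_upwards [hat_rep μ (σ⁻¹ • xs)] with x hx
    by_cases hxB : fib μ xs x r ∈ B
    · rw [indicator_of_mem (show x ∈ (fun x => fib μ xs x r) ⁻¹' B from hxB), Pi.one_apply, mul_one]
      refine hsing.trans (measure_mono (singleton_subset_iff.2 ?_))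
      have hemb : emb μ (rep μ (σ⁻¹ • xs)) = σ⁻¹ • embL μ (repL μ xs) := by
        change embL μ (repL μ (σ⁻¹ • xs)) = _
        rw [map_smul, map_smul]
      have e1 : x - ∑ i, hat (e i) x • emb μ (e i) + ∑ i, y i • emb μ (e i) = fib μ xs x r := by
        simp only [Nat.reduceAdd, Finset.univ_unique, Finset.sum_singleton, e, hx, hemb, y]
        rw [fib_eq, normalDir, ← hσdef]
        simp only [smul_apply, smul_eq_mul, smul_smul]
        have e2 : σ⁻¹ * xs x * σ⁻¹ = xs x * (σ ^ 2)⁻¹ := by field_simp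
        have e3 : r / σ * σ⁻¹ = r * (σ ^ 2)⁻¹ := by field_simp
        rw [e2, e3]
        module
      change x - ∑ i, hat (e i) x • emb μ (e i) + ∑ i, y i • emb μ (e i) ∈ B
      rw [e1]
      exact hxB
    · rw [indicator_of_notMem (show x ∉ (fun x => fib μ xs x r) ⁻¹' B from hxB), mul_zero]
      exact zero_le
  rw [bdryMeasure]
  refine Measure.le_iff.2 fun B hB => ?_
  rw [Measure.restrict_apply hB]
  have e : (μ.map fun x => fib μ xs x r) B = (μ.map fun x => fib μ xs x r) (B ∩ {x | xs x = r}) := by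
    rw [Measure.map_apply hmeas hB, Measure.map_apply hmeas (hB.inter hlevel)]
    congr 1
    ext x
    simp [xs_fib h0]
  rw [Measure.smul_apply, e, ← Measure.smul_apply]
  exact key _

end SurfaceBound

/-! ### Convergence in `L^p` of explicit functions -/

section LpHelpers

variable {α V W : Type*} [MeasurableSpace α] {ν : Measure α} [NormedAddCommGroup V]
  [NormedSpace ℝ V] [NormedAddCommGroup W] [NormedSpace ℝ W]

theorem tendsto_eLpNorm_sub_of_toLp {p : ℝ≥0∞} [Fact (1 ≤ p)] {F : ℕ → α → V}
    (hF : ∀ n, MemLp (F n) p ν) {u : Lp V p ν}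
    (h : Tendsto (fun n => (hF n).toLp (F n)) atTop (𝓝 u)) :
    Tendsto (fun n => eLpNorm (fun x => F n x - u x) p ν) atTop (𝓝 0) := by
  refine ((Lp.tendsto_Lp_iff_tendsto_eLpNorm' _ _).1 h).congr fun n => eLpNorm_congr_ae ?_
  filter_upwards [(hF n).coeFn_toLp] with x hx
  rw [Pi.sub_apply, hx]

theorem exists_eLpNorm_bound_of_tendsto {p : ℝ≥0∞} [Fact (1 ≤ p)] {F : ℕ → α → V}
    (hF : ∀ n, MemLp (F n) p ν) {u : Lp V p ν}
    (h : Tendsto (fun n => (hF n).toLp (F n)) atTop (𝓝 u)) :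
    ∃ B : ℝ≥0∞, B ≠ ⊤ ∧ ∀ n, eLpNorm (F n) p ν ≤ B := by
  obtain ⟨M, hM⟩ := h.norm.bddAbove_range
  refine ⟨ENNReal.ofReal M, ENNReal.ofReal_ne_top, fun n => ?_⟩
  have h1 : ‖(hF n).toLp (F n)‖ ≤ M := hM (mem_range_self n)
  rw [Lp.norm_toLp] at h1
  rw [← ENNReal.ofReal_toReal (hF n).2.ne]
  exact ENNReal.ofReal_le_ofReal h1

theorem eLpNorm_clm_le (A : V →L[ℝ] W) (F : α → V) (p : ℝ≥0∞) :
    eLpNorm (fun x => A (F x)) p ν ≤ ENNReal.ofReal ‖A‖ * eLpNorm F p ν :=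
  eLpNorm_le_mul_eLpNorm_of_ae_le_mul (ae_of_all _ fun x => A.le_opNorm (F x)) p

theorem tendsto_zero_of_le {f g : ℕ → ℝ≥0∞} (hg : Tendsto g atTop (𝓝 0)) (h : ∀ n, f n ≤ g n) :
    Tendsto f atTop (𝓝 0) :=
  tendsto_of_tendsto_of_tendsto_of_le_of_le tendsto_const_nhds hg (fun _ => zero_le) h

end LpHelpers

/-! ### The normal derivative on the hyperplane -/

section NormalTrace

variable {X : Type*} [NormedAddCommGroup X] [NormedSpace ℝ X] [MeasurableSpace X] [BorelSpace X]
  [CompleteSpace X] [SecondCountableTopology X] {μ : Measure X} [IsGaussian μ]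
  {xs : StrongDual ℝ X} {r : ℝ} {ι : Type*} (b : HilbertBasis ι ℝ (CM μ))

/-- The derivative along the fibers of a function is a component of its gradient. -/
theorem fderiv_normalDir (f : X → ℝ) (x : X) : fderiv ℝ f x (normalDir μ xs)
    = ((‖repL μ xs‖ ^ 2)⁻¹ • innerSL ℝ (repL μ xs)) (repL μ (fderiv ℝ f x)) := by
  rw [dual_normalDir, smul_apply, innerSL_apply_apply, real_inner_comm]
  rfl

theorem C2b.hasNormalDeriv {f : X → ℝ} (hf : C2b f) :
    HasNormalDeriv μ xs f (fun x => fderiv ℝ f x (normalDir μ xs)) :=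
  HasNormalDeriv.of_fderiv (hf.1.of_le (by norm_num))

theorem repL_hess_normalDir (f : X → ℝ) (x : X) :
    repL μ (fderiv ℝ (fderiv ℝ f) x (normalDir μ xs))
      = ((‖repL μ xs‖ ^ 2)⁻¹ • evHS b (repL μ xs)) (hsL b (fderiv ℝ (fderiv ℝ f) x)) := by
  rw [normalDir, map_smul, map_smul, smul_apply, evHS_hsL]

theorem C2b.hasNormalDeriv_grad {f : X → ℝ} (hf : C2b f) :
    HasNormalDeriv μ xs (fun x => repL μ (fderiv ℝ f x))
      (fun x => ((‖repL μ xs‖ ^ 2)⁻¹ • evHS b (repL μ xs))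
        (hsL b (fderiv ℝ (fderiv ℝ f) x))) := by
  have h := (HasNormalDeriv.of_fderiv (μ := μ) (xs := xs) hf.contDiff_fderiv).clm (repL μ)
  simpa only [repL_hess_normalDir b] using h

theorem aestronglyMeasurable_comp_fib_of_bdry (h0 : repL μ xs ≠ 0) {T : X → ℝ}
    (hT : AEStronglyMeasurable T (bdryMeasure μ xs r)) :
    AEStronglyMeasurable T (μ.map fun x => fib μ xs x r) := by
  obtain ⟨κ, hκ0, hκt, hκ⟩ := exists_smul_map_le_bdryMeasure h0 r
  exact (hT.mono_measure hκ).mono_ac (Measure.AbsolutelyContinuous.smul_right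
    Measure.AbsolutelyContinuous.rfl hκ0)

theorem tendsto_eLpNorm_comp_fib_of_bdry (h0 : repL μ xs ≠ 0) {φ : ℕ → X → ℝ}
    (hφ : ∀ n, AEStronglyMeasurable (φ n) (bdryMeasure μ xs r))
    (hlim : Tendsto (fun n => eLpNorm (φ n) 1 (bdryMeasure μ xs r)) atTop (𝓝 0)) :
    Tendsto (fun n => eLpNorm (fun x => φ n (fib μ xs x r)) 1 μ) atTop (𝓝 0) := by
  obtain ⟨κ, hκ0, hκt, hκ⟩ := exists_smul_map_le_bdryMeasure h0 r
  have h1 := ENNReal.Tendsto.const_mul (a := κ⁻¹) hlim (Or.inr (ENNReal.inv_ne_top.2 hκ0))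
  rw [mul_zero] at h1
  refine tendsto_zero_of_le h1 fun n => ?_
  have h2 := eLpNorm_mono_measure (p := 1) (φ n) hκ
  rw [eLpNorm_one_smul_measure, eLpNorm_map_measure (aestronglyMeasurable_comp_fib_of_bdry h0 (hφ n))
    (continuous_fib_const r).aemeasurable] at h2
  rw [← ENNReal.div_eq_inv_mul, ENNReal.le_div_iff_mul_le (Or.inl hκ0) (Or.inl hκt), mul_comm]
  exact h2

/-- The trace of the statement is the limit of the traces of every sequence of regular functions
that converges in `L²(Ω)` with bounded normal derivatives. -/
theorem IsTrace.tendsto_trace (hcent : ∀ L : StrongDual ℝ X, μ[L] = 0) (h0 : repL μ xs ≠ 0)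
    {ψ T : X → ℝ} (hT : IsTrace μ xs r ψ T) {F F' : ℕ → X → ℝ}
    (hF : ∀ n, HasNormalDeriv μ xs (F n) (F' n)) {B : ℝ≥0∞} (hB : B ≠ ⊤)
    (hF' : ∀ n, eLpNorm (F' n) 2 (μ.restrict (halfSpace xs r)) ≤ B)
    (hlim : Tendsto (fun n => eLpNorm (fun x => F n x - ψ x) 2 (μ.restrict (halfSpace xs r)))
      atTop (𝓝 0)) :
    Tendsto (fun n => eLpNorm (fun x => F n (fib μ xs x r) - T (fib μ xs x r)) 1 μ)
      atTop (𝓝 0) := by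
  obtain ⟨hTm, Φ, Φs, φ, hΦψ, hφ, hΦs, hφT⟩ := hT
  set A : CM μ →L[ℝ] ℝ := (‖repL μ xs‖ ^ 2)⁻¹ • innerSL ℝ (repL μ xs) with hA
  set δ : ℕ → ℝ≥0∞ := fun m => ((m + 1 : ℕ) : ℝ≥0∞)⁻¹ with hδ
  have hδpos : ∀ m, 0 < δ m := fun m => ENNReal.inv_pos.2 (ENNReal.natCast_ne_top _)
  have hδlim : Tendsto δ atTop (𝓝 0) :=
    ENNReal.tendsto_inv_nat_nhds_zero.comp (tendsto_add_atTop_nat 1)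
  have hδle : ∀ m, δ m ≤ 1 := fun m => by
    rw [hδ, ENNReal.inv_le_one]
    exact_mod_cast Nat.succ_pos m
  -- The Lipschitz constants of the `φ m` may be unbounded, so the trace inequality cannot be
  -- applied to them uniformly. For each fixed `m`, `φ m` is replaced by a smooth `G` that is close
  -- to it in `L²(Ω)`, in the gradient, and on the hyperplane.
  have happ : ∀ m, ∃ G : X → ℝ, C2b G ∧
      eLpNorm (fun x => G x - (Φs m).1.1 x) 2 (μ.restrict (halfSpace xs r)) ≤ δ m ∧
      eLpNorm (fun x => repL μ (fderiv ℝ G x) - (Φs m).1.2 x) 2 (μ.restrict (halfSpace xs r)) ≤ δ m ∧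
      eLpNorm (fun x => G (fib μ xs x r) - φ m (fib μ xs x r)) 2 μ ≤ δ m := by
    intro m
    obtain ⟨g, hg, hglim⟩ := exists_jetOne_tendsto (Φs m).2
    obtain ⟨⟨K, hK⟩, -, hφe⟩ := hφ m
    have l1 := tendsto_eLpNorm_sub_of_toLp (fun n => (hg n).c2b.memLp (ν := μ.restrict (halfSpace xs r)) 2)
      ((continuous_fst.tendsto _).comp hglim)
    have hg2 : Tendsto (fun n => ((hg n).c2b.memLp_grad (μ := μ) (ν := μ.restrict (halfSpace xs r)) 2).toLp _) atTop
      (𝓝 (Φs m).1.2) := (continuous_snd.tendsto _).comp hglim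
    have l2 := tendsto_eLpNorm_sub_of_toLp (fun n => (hg n).c2b.memLp_grad (μ := μ) (ν := μ.restrict (halfSpace xs r)) 2) hg2
    obtain ⟨B', hB't, hB'⟩ := exists_eLpNorm_bound_of_tendsto
      (fun n => (hg n).c2b.memLp_grad (μ := μ) (ν := μ.restrict (halfSpace xs r)) 2) hg2
    have l3 := GaussSobolev.tendsto_trace (r := r) hcent h0
      (fun n => (hg n).c2b.hasNormalDeriv (μ := μ) (xs := xs)) hK
      (B := ENNReal.ofReal ‖A‖ * B') (ENNReal.mul_ne_top ENNReal.ofReal_ne_top hB't)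
      (fun n => by
        simp only [fderiv_normalDir]
        exact (eLpNorm_clm_le A _ 2).trans (by gcongr; exact hB' n))
      (l1.congr fun n => eLpNorm_congr_ae (by
        filter_upwards [hφe] with x hx
        rw [hx]))
    obtain ⟨n, h1, h2, h3⟩ := ((ENNReal.tendsto_nhds_zero.1 l1 _ (hδpos m)).and
      ((ENNReal.tendsto_nhds_zero.1 l2 _ (hδpos m)).and
        (ENNReal.tendsto_nhds_zero.1 l3 _ (hδpos m)))).exists
    exact ⟨g n, (hg n).c2b, h1, h2, h3⟩
  choose G hG hG1 hG2 hG3 using happ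
  have hΦ1 : Tendsto (fun n => eLpNorm (fun x => (Φs n).1.1 x - Φ.1.1 x) 2 (μ.restrict (halfSpace xs r))) atTop (𝓝 0) :=
    (Lp.tendsto_Lp_iff_tendsto_eLpNorm' _ _).1 ((continuous_fst.tendsto _).comp
      ((continuous_subtype_val.tendsto _).comp hΦs))
  have hΦ2 : Tendsto (fun n => (Φs n).1.2) atTop (𝓝 Φ.1.2) :=
    (continuous_snd.tendsto _).comp ((continuous_subtype_val.tendsto _).comp hΦs)
  obtain ⟨M, hM⟩ : ∃ M : ℝ≥0∞, M ≠ ⊤ ∧ ∀ n, eLpNorm (Φs n).1.2 2 (μ.restrict (halfSpace xs r)) ≤ M := by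
    obtain ⟨M, hM⟩ := hΦ2.norm.bddAbove_range
    refine ⟨ENNReal.ofReal M, ENNReal.ofReal_ne_top, fun n => ?_⟩
    have h1 : ‖(Φs n).1.2‖ ≤ M := hM (mem_range_self n)
    rw [Lp.norm_def] at h1
    rw [← ENNReal.ofReal_toReal (Lp.eLpNorm_ne_top (Φs n).1.2)]
    exact ENNReal.ofReal_le_ofReal h1
  have hFm : ∀ n, AEStronglyMeasurable (F n) (μ.restrict (halfSpace xs r)) := fun n => (hF n).cont.aestronglyMeasurable
  have hGm : ∀ n, AEStronglyMeasurable (G n) (μ.restrict (halfSpace xs r)) := fun n => (hG n).1.continuous.aestronglyMeasurable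
  have hψm : AEStronglyMeasurable ψ (μ.restrict (halfSpace xs r)) := (Lp.aestronglyMeasurable Φ.1.1).congr hΦψ
  have hFG : Tendsto (fun n => eLpNorm (fun x => (F n x - G n x) - (0 : X → ℝ) x) 2 (μ.restrict (halfSpace xs r)))
      atTop (𝓝 0) := by
    have hsum := (hlim.add hδlim).add hΦ1
    simp only [add_zero] at hsum
    refine tendsto_zero_of_le hsum fun n => ?_
    have e : (fun x => (F n x - G n x) - (0 : X → ℝ) x) =ᵐ[(μ.restrict (halfSpace xs r))]
        ((fun x => F n x - ψ x) + fun x => (Φs n).1.1 x - G n x) +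
          fun x => Φ.1.1 x - (Φs n).1.1 x := by
      filter_upwards [hΦψ] with x hx
      simp only [Pi.add_apply, Pi.zero_apply, hx]
      ring
    rw [eLpNorm_congr_ae e]
    have m1 : AEStronglyMeasurable (fun x => (Φs n).1.1 x - G n x) (μ.restrict (halfSpace xs r)) :=
      (Lp.aestronglyMeasurable _).sub (hGm n)
    refine (eLpNorm_add_le (((hFm n).sub hψm).add m1)
      ((Lp.aestronglyMeasurable _).sub (Lp.aestronglyMeasurable _)) (by norm_num)).trans ?_
    refine add_le_add ((eLpNorm_add_le ((hFm n).sub hψm) m1 (by norm_num)).trans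
      (add_le_add le_rfl ?_)) ?_
    · exact (eLpNorm_sub_comm (Φs n).1.1 (G n) 2 (μ.restrict (halfSpace xs r))).le.trans (hG1 n)
    · exact (eLpNorm_sub_comm _ _ 2 (μ.restrict (halfSpace xs r))).le
  have hbound : ∀ n, eLpNorm (fun x => F' n x - fderiv ℝ (G n) x (normalDir μ xs)) 2 (μ.restrict (halfSpace xs r))
      ≤ B + ENNReal.ofReal ‖A‖ * (1 + M) := by
    intro n
    refine (eLpNorm_sub_le (hF n).cont'.aestronglyMeasurable
      ((hG n).hasNormalDeriv (μ := μ) (xs := xs)).cont'.aestronglyMeasurable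
      (by norm_num)).trans (add_le_add (hF' n) ?_)
    simp only [fderiv_normalDir]
    refine (eLpNorm_clm_le A _ 2).trans ?_
    gcongr
    have e : (fun x => repL μ (fderiv ℝ (G n) x))
        = (fun x => repL μ (fderiv ℝ (G n) x) - (Φs n).1.2 x) + (Φs n).1.2 := by
      funext x
      simp
    rw [e]
    refine (eLpNorm_add_le ((((hG n).memLp_grad 2).1).sub (Lp.aestronglyMeasurable _))
      (Lp.aestronglyMeasurable _) (by norm_num)).trans
      (add_le_add ((hG2 n).trans (hδle n)) (hM.2 n))
  -- The differences `F n - G n` are compared with the zero function, whose Lipschitz constant 0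
  -- serves for all `n`.
  have hFGtr := GaussSobolev.tendsto_trace (r := r) (φ := (0 : X → ℝ)) (K := 0) hcent h0
    (fun n => (hF n).sub ((hG n).hasNormalDeriv (μ := μ) (xs := xs)))
    ((LipschitzWith.const (0 : ℝ)).lipschitzOnWith)
    (ENNReal.add_ne_top.2 ⟨hB, ENNReal.mul_ne_top ENNReal.ofReal_ne_top
      (ENNReal.add_ne_top.2 ⟨ENNReal.one_ne_top, hM.1⟩)⟩) hbound hFG
  have hφm : ∀ n, AEStronglyMeasurable (φ n - T) (bdryMeasure μ xs r) := fun n => by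
    obtain ⟨⟨K, hK⟩, -, -⟩ := hφ n
    exact (aesm_bdry μ hK).sub hTm.1
  have hφtr := tendsto_eLpNorm_comp_fib_of_bdry h0 hφm hφT
  have hsum := (hFGtr.add hδlim).add hφtr
  simp only [add_zero] at hsum
  refine tendsto_zero_of_le hsum fun n => ?_
  obtain ⟨⟨K, hK⟩, -, -⟩ := hφ n
  have hc1 : Continuous fun x => F n (fib μ xs x r) - G n (fib μ xs x r) - (0 : X → ℝ) (fib μ xs x r) :=
    (((hF n).cont.comp (continuous_fib_const r)).sub
      ((hG n).1.continuous.comp (continuous_fib_const r))).sub continuous_const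
  have hc2 : Continuous fun x => G n (fib μ xs x r) - φ n (fib μ xs x r) :=
    ((hG n).1.continuous.comp (continuous_fib_const r)).sub
      (continuous_comp_fib_of_lipschitzOn h0 hK)
  have hm3 : AEStronglyMeasurable (fun x => (φ n - T) (fib μ xs x r)) μ :=
    (aestronglyMeasurable_comp_fib_of_bdry h0 (hφm n)).comp_measurable
      (continuous_fib_const r).measurable
  have e : (fun x => F n (fib μ xs x r) - T (fib μ xs x r)) =
      ((fun x => F n (fib μ xs x r) - G n (fib μ xs x r) - (0 : X → ℝ) (fib μ xs x r)) +
        fun x => G n (fib μ xs x r) - φ n (fib μ xs x r)) + fun x => (φ n - T) (fib μ xs x r) := by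
    funext x
    simp
  rw [e]
  refine (eLpNorm_add_le (hc1.aestronglyMeasurable.add hc2.aestronglyMeasurable) hm3
    le_rfl).trans (add_le_add ((eLpNorm_add_le hc1.aestronglyMeasurable
      hc2.aestronglyMeasurable le_rfl).trans (add_le_add ?_ ?_)) le_rfl)
  · exact eLpNorm_le_eLpNorm_of_exponent_le (by norm_num) hc1.aestronglyMeasurable
  · exact (eLpNorm_le_eLpNorm_of_exponent_le (by norm_num) hc2.aestronglyMeasurable).trans (hG3 n)

/-- The normal derivatives on the boundary tend to zero along every sequence of smooth cylindrical
functions that converges to an element of `W^{2,2}_{0,N}`. -/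
theorem tendsto_normal_trace (hcent : ∀ L : StrongDual ℝ X, μ[L] = 0) (h0 : repL μ xs ≠ 0)
    {u : W22 μ (μ.restrict (halfSpace xs r)) b} (hu : u ∈ W22N μ b xs r) {f : ℕ → X → ℝ}
    (hf : ∀ n, C2b (f n))
    (hlim : Tendsto (fun n => jet b (μ.restrict (halfSpace xs r)) (hf n)) atTop (𝓝 u.1)) :
    Tendsto (fun n => eLpNorm
      (fun x => fderiv ℝ (f n) (fib μ xs x r) (normalDir μ xs)) 2 μ) atTop (𝓝 0) := by
  obtain ⟨T, hT, hT0⟩ := hu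
  set A : HS μ ι →L[ℝ] CM μ := (‖repL μ xs‖ ^ 2)⁻¹ • evHS b (repL μ xs) with hA
  have hg2 : Tendsto (fun n => ((hf n).memLp_grad (μ := μ) (ν := μ.restrict (halfSpace xs r)) 2).toLp _) atTop
    (𝓝 u.1.2.1) := (continuous_fst.tendsto _).comp ((continuous_snd.tendsto _).comp hlim)
  have hg3 : Tendsto (fun n => ((hf n).memLp_hess b (ν := μ.restrict (halfSpace xs r)) 2).toLp _) atTop
    (𝓝 u.1.2.2) := (continuous_snd.tendsto _).comp ((continuous_snd.tendsto _).comp hlim)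
  have l2 := tendsto_eLpNorm_sub_of_toLp _ hg2
  obtain ⟨B, hBt, hB⟩ := exists_eLpNorm_bound_of_tendsto _ hg3
  have hB' : ∀ n, eLpNorm (fun x => A (hsL b (fderiv ℝ (fderiv ℝ (f n)) x))) 2 (μ.restrict (halfSpace xs r))
      ≤ ENNReal.ofReal ‖A‖ * B := fun n => (eLpNorm_clm_le A _ 2).trans (by gcongr; exact hB n)
  have hnd := fun n => (hf n).hasNormalDeriv_grad (xs := xs) b
  have hcomp : ∀ n, MemLp (fun x => repL μ (fderiv ℝ (f n) (fib μ xs x r))) 2 μ := fun n => by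
    obtain ⟨C, hC⟩ := (hf n).2
    exact memLp_of_continuous_bound ((repL μ).continuous.comp ((hf n).continuous_fderiv.comp
      (continuous_fib_const r))) (C := ‖repL μ‖ * C)
      (fun x => (repL μ).le_opNorm_of_le (hC _).2.1) 2
  -- The trace inequality with `ε = 1` and `φ = 0`, applied to differences of gradients, bounds the
  -- boundary gradients by the `W^{2,2}(Ω)` distance of the functions.
  have hcauchy : CauchySeq fun n => (hcomp n).toLp _ := by
    obtain ⟨c, C, hc, hC, hcC⟩ := exists_dens_bounds μ xs h0 r
    rw [Lp.cauchySeq_Lp_iff_cauchySeq_eLpNorm]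
    have k2 := (Lp.cauchySeq_Lp_iff_cauchySeq_eLpNorm _).1 hg2.cauchySeq
    have k3 := (Lp.cauchySeq_Lp_iff_cauchySeq_eLpNorm _).1 hg3.cauchySeq
    have k4 := ENNReal.Tendsto.const_mul (a := ENNReal.ofReal (√(C / c) * 1) *
      ENNReal.ofReal ‖A‖) k3 (Or.inr (ENNReal.mul_ne_top ENNReal.ofReal_ne_top
        ENNReal.ofReal_ne_top))
    rw [mul_zero] at k4
    have k5 := ENNReal.Tendsto.const_mul (a := ENNReal.ofReal (√(c * 1))⁻¹) (k4.add k2)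
      (Or.inr ENNReal.ofReal_ne_top)
    rw [add_zero, mul_zero] at k5
    refine tendsto_of_tendsto_of_tendsto_of_le_of_le tendsto_const_nhds k5
      (fun _ => zero_le) fun p => ?_
    have h1 := trace_ineq (r := r) (ε := 1) hcent h0 hc hC hcC ((hnd p.1).sub (hnd p.2))
      (φ := fun _ => 0) (K := 0) ((LipschitzWith.const (0 : CM μ)).lipschitzOnWith)
      ⟨one_pos, le_rfl⟩
    simp only [NNReal.coe_zero, zero_mul, ENNReal.ofReal_zero, add_zero, sub_zero] at h1
    have e1 : eLpNorm (⇑((hcomp p.1).toLp _) - ⇑((hcomp p.2).toLp _)) 2 μ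
        = eLpNorm (fun x => repL μ (fderiv ℝ (f p.1) (fib μ xs x r))
          - repL μ (fderiv ℝ (f p.2) (fib μ xs x r))) 2 μ :=
      eLpNorm_congr_ae ((hcomp p.1).coeFn_toLp.sub (hcomp p.2).coeFn_toLp)
    have e2 : eLpNorm (⇑(((hf p.1).memLp_grad (μ := μ) (ν := μ.restrict (halfSpace xs r)) 2).toLp _)
          - ⇑(((hf p.2).memLp_grad (μ := μ) (ν := μ.restrict (halfSpace xs r)) 2).toLp _)) 2 (μ.restrict (halfSpace xs r))
        = eLpNorm (fun x => repL μ (fderiv ℝ (f p.1) x) - repL μ (fderiv ℝ (f p.2) x)) 2 (μ.restrict (halfSpace xs r)) :=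
      eLpNorm_congr_ae (((hf p.1).memLp_grad 2).coeFn_toLp.sub ((hf p.2).memLp_grad 2).coeFn_toLp)
    have e3 : eLpNorm (⇑(((hf p.1).memLp_hess b (ν := μ.restrict (halfSpace xs r)) 2).toLp _)
          - ⇑(((hf p.2).memLp_hess b (ν := μ.restrict (halfSpace xs r)) 2).toLp _)) 2 (μ.restrict (halfSpace xs r))
        = eLpNorm (fun x => hsL b (fderiv ℝ (fderiv ℝ (f p.1)) x)
          - hsL b (fderiv ℝ (fderiv ℝ (f p.2)) x)) 2 (μ.restrict (halfSpace xs r)) :=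
      eLpNorm_congr_ae (((hf p.1).memLp_hess b 2).coeFn_toLp.sub
        ((hf p.2).memLp_hess b 2).coeFn_toLp)
    simp only [e1, e2, e3]
    refine h1.trans ?_
    rw [mul_assoc (ENNReal.ofReal (√(C / c) * 1))]
    gcongr
    refine le_trans (le_of_eq ?_) (eLpNorm_clm_le A _ 2)
    congr 1
    funext x
    exact (map_sub A _ _).symm
  obtain ⟨τ, hτ⟩ := cauchySeq_tendsto_of_complete hcauchy
  have lτ := tendsto_eLpNorm_sub_of_toLp hcomp hτ
  -- Both `τ` and the trace `T ∘ π_r` are limits of the boundary gradients, componentwise in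
  -- `L¹(μ)`, hence they have the same components.
  have hcoef : ∀ i, ∀ᵐ x ∂μ, ⟪τ x, b i⟫_ℝ = ⟪T (fib μ xs x r), b i⟫_ℝ := by
    intro i
    have hnd' : ∀ n, HasNormalDeriv μ xs (fun x => ⟪repL μ (fderiv ℝ (f n) x), b i⟫_ℝ)
        (fun x => innerSL ℝ (b i) (A (hsL b (fderiv ℝ (fderiv ℝ (f n)) x)))) := fun n => by
      have := (hnd n).clm (innerSL ℝ (b i))
      simpa only [innerSL_apply_apply, real_inner_comm] using this
    have t1 := IsTrace.tendsto_trace (r := r) hcent h0 (hT i) hnd'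
      (B := ENNReal.ofReal ‖innerSL ℝ (b i)‖ * (ENNReal.ofReal ‖A‖ * B))
      (ENNReal.mul_ne_top ENNReal.ofReal_ne_top (ENNReal.mul_ne_top ENNReal.ofReal_ne_top hBt))
      (fun n => (eLpNorm_clm_le (innerSL ℝ (b i)) _ 2).trans (by gcongr; exact hB' n))
      (by
        have k := ENNReal.Tendsto.const_mul (a := ENNReal.ofReal ‖innerSL ℝ (b i)‖) l2
          (Or.inr ENNReal.ofReal_ne_top)
        rw [mul_zero] at k
        refine tendsto_zero_of_le k fun n => ?_
        refine le_trans (le_of_eq ?_) (eLpNorm_clm_le (innerSL ℝ (b i)) _ 2)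
        congr 1
        funext x
        rw [innerSL_apply_apply, inner_sub_right, real_inner_comm, real_inner_comm (b i)]
        rfl)
    have t2 : Tendsto (fun n => eLpNorm (fun x => ⟪repL μ (fderiv ℝ (f n) (fib μ xs x r)), b i⟫_ℝ
        - ⟪τ x, b i⟫_ℝ) 1 μ) atTop (𝓝 0) := by
      have k := ENNReal.Tendsto.const_mul (a := ENNReal.ofReal ‖innerSL ℝ (b i)‖) lτ
          (Or.inr ENNReal.ofReal_ne_top)
      rw [mul_zero] at k
      refine tendsto_zero_of_le k fun n => ?_
      have hm : AEStronglyMeasurable (fun x => repL μ (fderiv ℝ (f n) (fib μ xs x r)) - τ x) μ :=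
        (hcomp n).1.sub (Lp.aestronglyMeasurable τ)
      refine le_trans (le_of_eq ?_) ((eLpNorm_clm_le (innerSL ℝ (b i)) _ 1).trans
        (mul_le_mul_right (eLpNorm_le_eLpNorm_of_exponent_le (by norm_num) hm) _))
      congr 1
      funext x
      rw [innerSL_apply_apply, inner_sub_right, real_inner_comm, real_inner_comm (b i)]
    have hm1 : ∀ n, AEStronglyMeasurable
        (fun x => ⟪repL μ (fderiv ℝ (f n) (fib μ xs x r)), b i⟫_ℝ) μ := fun n =>
      (hcomp n).1.inner_const (c := b i)
    have hm2 : AEStronglyMeasurable (fun x => ⟪τ x, b i⟫_ℝ) μ :=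
      (Lp.aestronglyMeasurable τ).inner_const
    have hm3 : AEStronglyMeasurable (fun x => ⟪T (fib μ xs x r), b i⟫_ℝ) μ :=
      (aestronglyMeasurable_comp_fib_of_bdry h0 (hT i).1.1).comp_measurable
        (continuous_fib_const r).measurable
    have hzero : eLpNorm (fun x => ⟪τ x, b i⟫_ℝ - ⟪T (fib μ xs x r), b i⟫_ℝ) 1 μ = 0 := by
      have ksum := t2.add t1
      rw [add_zero] at ksum
      refine le_antisymm (ge_of_tendsto' ksum fun n => ?_) zero_le
      have e : (fun x => ⟪τ x, b i⟫_ℝ - ⟪T (fib μ xs x r), b i⟫_ℝ)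
          = (fun x => ⟪τ x, b i⟫_ℝ - ⟪repL μ (fderiv ℝ (f n) (fib μ xs x r)), b i⟫_ℝ)
            + fun x => ⟪repL μ (fderiv ℝ (f n) (fib μ xs x r)), b i⟫_ℝ
              - ⟪T (fib μ xs x r), b i⟫_ℝ := by
        funext x
        simp
      rw [e]
      refine (eLpNorm_add_le (hm2.sub (hm1 n)) ((hm1 n).sub hm3) le_rfl).trans
        (add_le_add (le_of_eq ?_) le_rfl)
      exact eLpNorm_sub_comm _ _ 1 μ
    filter_upwards [(eLpNorm_eq_zero_iff (hm2.sub hm3) one_ne_zero).1 hzero] with x hx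
    exact sub_eq_zero.1 hx
  have hTfib : ∀ᵐ x ∂μ, ⟪T (fib μ xs x r), repL μ xs⟫_ℝ = 0 := by
    obtain ⟨κ, hκ0, hκt, hκ⟩ := exists_smul_map_le_bdryMeasure h0 r
    have h1 : ∀ᵐ x ∂(μ.map fun x => fib μ xs x r), ⟪T x, rep μ xs⟫_ℝ = 0 := by
      exact (Measure.AbsolutelyContinuous.smul_right Measure.AbsolutelyContinuous.rfl hκ0).ae_le
        (ae_mono hκ hT0)
    exact ae_of_ae_map (continuous_fib_const r).aemeasurable h1
  -- The index set may be uncountable, whereas null sets may be united only countably often. The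
  -- vector `repL μ xs` has only countably many nonzero coordinates, and no others enter the inner
  -- product with it.
  have hsupp : (Function.support fun i => ⟪b i, repL μ xs⟫_ℝ).Countable := by
    have hs := b.summable_inner_mul_inner (repL μ xs) (repL μ xs)
    have hs' := hs.countable_support
    refine hs'.mono fun i hi => ?_
    rw [Function.mem_support] at hi ⊢
    rw [real_inner_comm]
    exact mul_ne_zero hi hi
  have hall : ∀ᵐ x ∂μ, ∀ i ∈ Function.support fun i => ⟪b i, repL μ xs⟫_ℝ,
      ⟪τ x, b i⟫_ℝ = ⟪T (fib μ xs x r), b i⟫_ℝ :=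
    (ae_ball_iff hsupp).2 fun i _ => hcoef i
  have hτ0 : ∀ᵐ x ∂μ, ⟪τ x, repL μ xs⟫_ℝ = 0 := by
    filter_upwards [hall, hTfib] with x hx hx0
    rw [← hx0, ← b.tsum_inner_mul_inner, ← b.tsum_inner_mul_inner]
    refine tsum_congr fun i => ?_
    by_cases hi : ⟪b i, repL μ xs⟫_ℝ = 0
    · rw [hi, mul_zero, mul_zero]
    · rw [hx i hi]
  set A' : CM μ →L[ℝ] ℝ := (‖repL μ xs‖ ^ 2)⁻¹ • innerSL ℝ (repL μ xs)
  have k := ENNReal.Tendsto.const_mul (a := ENNReal.ofReal ‖A'‖) lτ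
    (Or.inr ENNReal.ofReal_ne_top)
  rw [mul_zero] at k
  refine tendsto_zero_of_le k fun n => ?_
  refine le_trans (le_of_eq (eLpNorm_congr_ae ?_)) (eLpNorm_clm_le A' _ 2)
  filter_upwards [hτ0] with x hx
  have hA'0 : A' (τ x) = 0 := by
    change (‖repL μ xs‖ ^ 2)⁻¹ • ⟪repL μ xs, τ x⟫_ℝ = 0
    rw [real_inner_comm, hx, smul_zero]
  rw [map_sub, hA'0, sub_zero, fderiv_normalDir]

end NormalTrace

/-! ### Weighted composition operators between `L²` spaces -/

section WeightedComposition

variable {α β V : Type*} [MeasurableSpace α] [MeasurableSpace β] [NormedAddCommGroup V]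
  [NormedSpace ℝ V] {μ : Measure α} {ν : Measure β} {w : α → ℝ} {R : α → β} {c : ℝ≥0}

/-- The weighted composition operator `f ↦ w • f ∘ R` is bounded from `L²(ν)` to `L²(μ)`. -/
structure IsWeightedComp (μ : Measure α) (ν : Measure β) (w : α → ℝ) (R : α → β) (c : ℝ≥0) :
    Prop where
  meas_weight : Measurable w
  meas_map : Measurable R
  bound : ∀ g : β → ℝ≥0∞, Measurable g →
    ∫⁻ x, ‖w x‖ₑ ^ 2 * g (R x) ∂μ ≤ c * ∫⁻ y, g y ∂ν

/-- The bound applied to the indicator of a null set shows that the weight vanishes almost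
everywhere on the preimage of that set. The operator is thus well defined on classes, although `R`
alone may pull null sets back to sets of positive measure. -/
theorem IsWeightedComp.congr_ae (h : IsWeightedComp μ ν w R c) {f g : β → V} (hfg : f =ᵐ[ν] g) :
    (fun x => w x • f (R x)) =ᵐ[μ] fun x => w x • g (R x) := by
  set N := toMeasurable ν {y | f y ≠ g y}
  have hN : ν N = 0 := by
    rw [measure_toMeasurable]
    exact hfg
  have hm : Measurable (N.indicator (1 : β → ℝ≥0∞)) :=
    measurable_one.indicator (measurableSet_toMeasurable _ _)
  have h1 := h.bound _ hm
  rw [lintegral_indicator_one (measurableSet_toMeasurable _ _), hN, mul_zero,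
    nonpos_iff_eq_zero] at h1
  have h2 := (lintegral_eq_zero_iff
    ((h.meas_weight.enorm.pow_const 2).mul (hm.comp h.meas_map))).1 h1
  filter_upwards [h2] with x hx
  by_cases hxN : R x ∈ N
  · have : w x = 0 := by simpa [hxN] using hx
    simp [this]
  · have : f (R x) = g (R x) := by
      by_contra hne
      exact hxN (subset_toMeasurable _ _ hne)
    rw [this]

theorem IsWeightedComp.eLpNorm_le (h : IsWeightedComp μ ν w R c) {f : β → V}
    (hf : StronglyMeasurable f) :
    eLpNorm (fun x => w x • f (R x)) 2 μ ≤ ENNReal.ofReal (√c) * eLpNorm f 2 ν := by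
  rw [← ENNReal.pow_le_pow_left_iff two_ne_zero, mul_pow, eLpNorm_two_sq, eLpNorm_two_sq,
    ← ENNReal.ofReal_pow (Real.sqrt_nonneg _), Real.sq_sqrt (NNReal.coe_nonneg c), ENNReal.ofReal_coe_nnreal]
  refine le_trans (le_of_eq (lintegral_congr fun x => ?_))
    (h.bound (fun y => ‖f y‖ₑ ^ 2) (hf.enorm.pow_const 2))
  rw [enorm_smul, mul_pow]

theorem IsWeightedComp.memLp (h : IsWeightedComp μ ν w R c) (f : Lp V 2 ν) :
    MemLp (fun x => w x • f (R x)) 2 μ :=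
  ⟨(h.meas_weight.stronglyMeasurable.smul
      ((Lp.stronglyMeasurable f).comp_measurable h.meas_map)).aestronglyMeasurable,
    (h.eLpNorm_le (Lp.stronglyMeasurable f)).trans_lt
      (ENNReal.mul_lt_top ENNReal.ofReal_lt_top (Lp.memLp f).2)⟩

/-- The weighted composition operator `f ↦ w • f ∘ R`. -/
def wcomp (V : Type*) [NormedAddCommGroup V] [NormedSpace ℝ V] (h : IsWeightedComp μ ν w R c) :
    Lp V 2 ν →L[ℝ] Lp V 2 μ :=
  LinearMap.mkContinuous
    { toFun := fun f => (h.memLp f).toLp _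
      map_add' := fun f g => by
        refine Lp.ext ((h.memLp _).coeFn_toLp.trans ?_)
        filter_upwards [h.congr_ae (Lp.coeFn_add f g), (h.memLp f).coeFn_toLp,
          (h.memLp g).coeFn_toLp, Lp.coeFn_add ((h.memLp f).toLp _) ((h.memLp g).toLp _)]
          with x h1 h2 h3 h4
        rw [h1, h4, Pi.add_apply, Pi.add_apply, h2, h3, smul_add]
      map_smul' := fun a f => by
        refine Lp.ext ((h.memLp _).coeFn_toLp.trans ?_)
        filter_upwards [h.congr_ae (Lp.coeFn_smul a f), (h.memLp f).coeFn_toLp,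
          Lp.coeFn_smul a ((h.memLp f).toLp _)] with x h1 h2 h4
        rw [h1, RingHom.id_apply, h4, Pi.smul_apply, Pi.smul_apply, h2, smul_comm] }
    (√c) fun f => by
      change ‖(h.memLp f).toLp _‖ ≤ _
      rw [Lp.norm_toLp, Lp.norm_def, ← ENNReal.toReal_ofReal (Real.sqrt_nonneg c),
        ← ENNReal.toReal_mul]
      exact ENNReal.toReal_mono (ENNReal.mul_ne_top ENNReal.ofReal_ne_top (Lp.eLpNorm_ne_top f))
        (h.eLpNorm_le (Lp.stronglyMeasurable f))

theorem coeFn_wcomp (h : IsWeightedComp μ ν w R c) (f : Lp V 2 ν) :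
    wcomp V h f =ᵐ[μ] fun x => w x • f (R x) :=
  (h.memLp f).coeFn_toLp

theorem coeFn_wcomp_of_ae (h : IsWeightedComp μ ν w R c) {f : Lp V 2 ν} {F : β → V}
    (hf : f =ᵐ[ν] F) : wcomp V h f =ᵐ[μ] fun x => w x • F (R x) :=
  (coeFn_wcomp h f).trans (h.congr_ae hf)

theorem IsWeightedComp.of_le {w' : α → ℝ} (h : IsWeightedComp μ ν w R c) (hw' : Measurable w')
    (C : ℝ≥0) (hC : ∀ x, |w' x| ≤ C * |w x|) : IsWeightedComp μ ν w' R (C ^ 2 * c) := by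
  refine ⟨hw', h.meas_map, fun g hg => ?_⟩
  have hle : ∀ x, ‖w' x‖ₑ ≤ C * ‖w x‖ₑ := fun x => by
    rw [← ofReal_norm, ← ofReal_norm, ← ENNReal.ofReal_coe_nnreal,
      ← ENNReal.ofReal_mul (NNReal.coe_nonneg C)]
    exact ENNReal.ofReal_le_ofReal (hC x)
  calc ∫⁻ x, ‖w' x‖ₑ ^ 2 * g (R x) ∂μ ≤ ∫⁻ x, (C : ℝ≥0∞) ^ 2 * (‖w x‖ₑ ^ 2 * g (R x)) ∂μ := by
        refine lintegral_mono fun x => ?_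
        rw [← mul_assoc, ← mul_pow]
        gcongr
        exact hle x
    _ = (C : ℝ≥0∞) ^ 2 * ∫⁻ x, ‖w x‖ₑ ^ 2 * g (R x) ∂μ :=
        lintegral_const_mul' _ _ (by simp)
    _ ≤ _ := by
        push_cast
        rw [mul_assoc]
        gcongr
        exact h.bound g hg

/-- Extension by zero. -/
theorem isWeightedComp_indicator (μ : Measure α) {S : Set α} (hS : MeasurableSet S) :
    IsWeightedComp μ (μ.restrict S) (S.indicator 1) id 1 := by
  refine ⟨measurable_one.indicator hS, measurable_id, fun g hg => ?_⟩
  rw [← lintegral_indicator hS, ENNReal.coe_one, one_mul]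
  refine lintegral_mono fun x => ?_
  by_cases hx : x ∈ S <;> simp [hx]

end WeightedComposition

/-! ### The Gaussian weight that makes the reflection bounded -/

section GaussWeight

theorem lintegral_comp_affine {c : ℝ} (hc : c ≠ 0) (a : ℝ) {F : ℝ → ℝ≥0∞} (hF : Measurable F) :
    ∫⁻ t, F (a + c * t) = ENNReal.ofReal |c⁻¹| * ∫⁻ t, F t := by
  have h1 : ∫⁻ t, F (a + c * t) = ∫⁻ s, F (a + s) ∂(Measure.map (c * ·) volume) := by
    exact (lintegral_map (hF.comp (measurable_const_add a)) (measurable_const_mul c)).symm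
  rw [h1, Real.map_volume_mul_left hc, lintegral_smul_measure, smul_eq_mul]
  congr 1
  exact lintegral_add_left_eq_self F a

/-- The weight `exp (-a τ² / 2)`. -/
def gw (a τ : ℝ) : ℝ := Real.exp (-(a * τ ^ 2) / 2)

/-- The derivative of `gw`. -/
def gwd (a τ : ℝ) : ℝ := -(a * τ) * gw a τ

/-- The second derivative of `gw`. -/
def gwdd (a τ : ℝ) : ℝ := (a ^ 2 * τ ^ 2 - a) * gw a τ

theorem hasDerivAt_gw (a τ : ℝ) : HasDerivAt (gw a) (gwd a τ) τ := by
  have h : HasDerivAt (fun τ : ℝ => -(a * τ ^ 2) / 2) (-(a * τ)) τ := by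
    refine ((((hasDerivAt_pow 2 τ).const_mul a).fun_neg).div_const 2).congr_deriv ?_
    simp
    ring
  have := h.exp
  rw [mul_comm] at this
  exact this

theorem hasDerivAt_gwd (a τ : ℝ) : HasDerivAt (gwd a) (gwdd a τ) τ := by
  have h : HasDerivAt (fun τ : ℝ => -(a * τ)) (-a) τ := by
    simpa using ((hasDerivAt_id τ).const_mul a).fun_neg
  refine (h.mul (hasDerivAt_gw a τ)).congr_deriv ?_
  rw [gwdd, gwd]
  ring

theorem contDiff_gw (a : ℝ) : ContDiff ℝ ∞ (gw a) := by
  unfold gw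
  fun_prop

theorem continuous_gw (a : ℝ) : Continuous (gw a) := (contDiff_gw a).continuous

theorem gw_pos (a τ : ℝ) : 0 < gw a τ := Real.exp_pos _

/-- From `1 + τ² ≤ exp(τ²)`: raising the rate by 2 pays for the polynomial factors, of degree at
most two, in the first two derivatives of the weight. -/
theorem gw_mul_le (β τ : ℝ) : (τ ^ 2 + 1) * gw (β + 2) τ ≤ gw β τ := by
  have h1 : gw β τ = Real.exp (τ ^ 2) * gw (β + 2) τ := by
    rw [gw, gw, ← Real.exp_add]
    congr 1
    ring
  rw [h1]
  exact mul_le_mul_of_nonneg_right (Real.add_one_le_exp _) (gw_pos _ _).le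

theorem abs_gw_le {β : ℝ} (hβ : 0 ≤ β) (τ : ℝ) : |gw (β + 2) τ| ≤ (β + 3) ^ 2 * gw β τ := by
  have h := gw_mul_le β τ
  have hp := gw_pos (β + 2) τ
  have hq := gw_pos β τ
  rw [abs_of_pos hp]
  nlinarith [mul_nonneg (sq_nonneg τ) hp.le, mul_nonneg hβ hq.le, mul_nonneg (sq_nonneg β) hq.le]

theorem abs_gwd_le {β : ℝ} (hβ : 0 ≤ β) (τ : ℝ) : |gwd (β + 2) τ| ≤ (β + 3) ^ 2 * gw β τ := by
  have h := gw_mul_le β τ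
  have hp := gw_pos (β + 2) τ
  have hq := gw_pos β τ
  rw [gwd, abs_mul, abs_neg, abs_mul, abs_of_pos hp, abs_of_nonneg (by linarith : 0 ≤ β + 2)]
  have h1 : |τ| ≤ τ ^ 2 + 1 := by
    rw [← sq_abs]
    nlinarith [sq_nonneg (|τ| - 1), abs_nonneg τ]
  calc (β + 2) * |τ| * gw (β + 2) τ ≤ (β + 2) * ((τ ^ 2 + 1) * gw (β + 2) τ) := by
        rw [mul_assoc]
        gcongr
    _ ≤ (β + 2) * gw β τ := by gcongr
    _ ≤ (β + 3) ^ 2 * gw β τ := by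
        gcongr
        nlinarith

theorem abs_gwdd_le {β : ℝ} (hβ : 0 ≤ β) (τ : ℝ) : |gwdd (β + 2) τ| ≤ (β + 3) ^ 2 * gw β τ := by
  have h := gw_mul_le β τ
  have hp := gw_pos (β + 2) τ
  have hq := gw_pos β τ
  rw [gwdd, abs_mul, abs_of_pos hp]
  have h1 : |(β + 2) ^ 2 * τ ^ 2 - (β + 2)| ≤ (β + 3) ^ 2 * (τ ^ 2 + 1) := by
    rw [abs_le]
    constructor <;> nlinarith [sq_nonneg τ, mul_nonneg hβ (sq_nonneg τ)]
  calc |(β + 2) ^ 2 * τ ^ 2 - (β + 2)| * gw (β + 2) τ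
      ≤ (β + 3) ^ 2 * (τ ^ 2 + 1) * gw (β + 2) τ := by gcongr
    _ = (β + 3) ^ 2 * ((τ ^ 2 + 1) * gw (β + 2) τ) := by ring
    _ ≤ (β + 3) ^ 2 * gw β τ := by gcongr

variable {X : Type*} [NormedAddCommGroup X] [NormedSpace ℝ X] [MeasurableSpace X] [BorelSpace X]
  [CompleteSpace X] [SecondCountableTopology X] {μ : Measure X} [IsGaussian μ]
  {xs : StrongDual ℝ X}

/-- The rate of the Gaussian weight that dominates the reflection with slope `k - 1`. -/
def reflRate (μ : Measure X) [IsGaussian μ] (xs : StrongDual ℝ X) (k : ℝ) : ℝ :=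
  (k - 1) * k / ‖repL μ xs‖ ^ 2

/-- The two exponents differ by the square `(r + k τ)² / (2 |h|²)`. The rate `k(k-1)/|h|²` and the
constant `exp(r²/(2|h|²))` are what completes this square. -/
theorem normalDens_refl_le (h0 : repL μ xs ≠ 0) (k r τ : ℝ) :
    gw (reflRate μ xs k) τ ^ 2 * normalDens μ xs (r + τ)
      ≤ Real.exp (r ^ 2 / (2 * ‖repL μ xs‖ ^ 2)) * normalDens μ xs (r - (k - 1) * τ) := by
  have hσ : 0 < ‖repL μ xs‖ ^ 2 := by positivity
  rw [normalDens, normalDens, mul_left_comm, mul_left_comm (Real.exp (r ^ 2 / _)), gw,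
    ← Real.exp_nat_mul, ← Real.exp_add, ← Real.exp_add]
  refine mul_le_mul_of_nonneg_left (Real.exp_le_exp.2 ?_) (by positivity)
  rw [reflRate, div_mul_eq_mul_div, ← sub_nonneg]
  have : r ^ 2 / (2 * ‖repL μ xs‖ ^ 2) + -(r - (k - 1) * τ) ^ 2 / (2 * ‖repL μ xs‖ ^ 2) -
      ((2 : ℕ) * (-((k - 1) * k * τ ^ 2 / ‖repL μ xs‖ ^ 2) / 2)
        + -(r + τ) ^ 2 / (2 * ‖repL μ xs‖ ^ 2)) = (r + k * τ) ^ 2 / (2 * ‖repL μ xs‖ ^ 2) := by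
    push_cast
    field_simp
    ring
  rw [this]
  positivity

theorem aff_fib (h0 : repL μ xs ≠ 0) (k r : ℝ) (x : X) (t : ℝ) :
    aff xs (normalDir μ xs) k r (fib μ xs x t) = fib μ xs x (r - (k - 1) * (t - r)) := by
  rw [aff, xs_fib h0, fib_eq, fib_eq]
  module

theorem continuous_aff (xs : StrongDual ℝ X) (v : X) (k c : ℝ) : Continuous (aff xs v k c) := by
  unfold aff
  fun_prop

/-- On each fiber the reflection is the affine map `t ↦ r - (k-1)(t - r)`, with constant Jacobian;
`normalDens_refl_le` compares the densities before and after the change of variables. -/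
theorem isWeightedComp_refl (hcent : ∀ L : StrongDual ℝ X, μ[L] = 0) (h0 : repL μ xs ≠ 0)
    {k : ℝ} (hk : 1 < k) (r : ℝ) : ∃ c : ℝ≥0, IsWeightedComp μ (μ.restrict (halfSpace xs r))
      ((halfSpace xs r)ᶜ.indicator fun x => gw (reflRate μ xs k) (xs x - r))
      (aff xs (normalDir μ xs) k r) c := by
  set C := Real.exp (r ^ 2 / (2 * ‖repL μ xs‖ ^ 2)) with hC
  have hC0 : 0 ≤ C := (Real.exp_pos _).le
  have hk' : -(k - 1) ≠ 0 := by linarith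
  refine ⟨Real.toNNReal C * Real.toNNReal |(-(k - 1))⁻¹|, ?_, (continuous_aff _ _ _ _).measurable,
    fun g hg => ?_⟩
  · refine Measurable.indicator ?_ measurableSet_halfSpace.compl
    exact ((continuous_gw _).comp (xs.continuous.sub continuous_const)).measurable
  have hm : Measurable fun x => ‖((halfSpace xs r)ᶜ.indicator
      (fun x => gw (reflRate μ xs k) (xs x - r)) x)‖ₑ ^ 2 * g (aff xs (normalDir μ xs) k r x) := by
    refine Measurable.mul (Measurable.pow_const (Measurable.enorm ?_) 2)
      (hg.comp (continuous_aff _ _ _ _).measurable)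
    refine Measurable.indicator ?_ measurableSet_halfSpace.compl
    exact ((continuous_gw _).comp (xs.continuous.sub continuous_const)).measurable
  rw [lintegral_fib hcent h0 hm, ← lintegral_indicator measurableSet_halfSpace,
    lintegral_fib hcent h0 (hg.indicator measurableSet_halfSpace)]
  rw [← lintegral_const_mul' _ _ ENNReal.coe_ne_top]
  refine lintegral_mono fun x => ?_
  have hfx : Measurable (fun t => fib μ xs x t) := (continuous_fib_right x).measurable
  have hl := lintegral_normalLaw h0 (hm.comp hfx)
  have hr := lintegral_normalLaw h0 ((hg.indicator (measurableSet_halfSpace (xs := xs) (r := r))).comp hfx)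
  simp only [Function.comp_apply] at hl hr
  rw [hl, hr]
  have hF : Measurable fun s => ENNReal.ofReal (normalDens μ xs s) *
      (halfSpace xs r).indicator g (fib μ xs x s) :=
    (continuous_normalDens.measurable.ennreal_ofReal).mul
      ((hg.indicator measurableSet_halfSpace).comp hfx)
  have key := lintegral_comp_affine hk' (r + (k - 1) * r) hF
  push_cast
  rw [mul_assoc]
  change _ ≤ ENNReal.ofReal C * (ENNReal.ofReal |(-(k - 1))⁻¹| * _)
  rw [← key, ← lintegral_const_mul' _ _ ENNReal.ofReal_ne_top]
  refine lintegral_mono fun t => ?_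
  change ENNReal.ofReal (normalDens μ xs t) * (‖((halfSpace xs r)ᶜ.indicator
      (fun x => gw (reflRate μ xs k) (xs x - r)) (fib μ xs x t))‖ₑ ^ 2
      * g (aff xs (normalDir μ xs) k r (fib μ xs x t))) ≤ _
  by_cases ht : t ≤ r
  · have : fib μ xs x t ∉ (halfSpace xs r)ᶜ := by simpa [halfSpace, xs_fib h0] using ht
    simp [this]
  · have h1 : fib μ xs x t ∈ (halfSpace xs r)ᶜ := by simpa [halfSpace, xs_fib h0] using ht
    have h2 : fib μ xs x (r + (k - 1) * r + -(k - 1) * t) ∈ halfSpace xs r := by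
      simp only [halfSpace, mem_ofPred_eq, xs_fib h0]
      nlinarith
    have h3 : r - (k - 1) * (t - r) = r + (k - 1) * r + -(k - 1) * t := by ring
    rw [indicator_of_mem h1, indicator_of_mem h2, aff_fib h0, xs_fib h0, h3, ← mul_assoc,
      ← mul_assoc]
    refine mul_le_mul_left ?_ _
    have h4 := normalDens_refl_le h0 k r (t - r)
    rw [h3] at h4
    rw [Real.enorm_eq_ofReal (gw_pos _ _).le, ← ENNReal.ofReal_pow (gw_pos _ _).le,
      ← ENNReal.ofReal_mul (normalDens_pos h0 t).le, ← ENNReal.ofReal_mul hC0, mul_comm]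
    refine ENNReal.ofReal_le_ofReal (le_trans (le_of_eq ?_) h4)
    rw [add_sub_cancel]

end GaussWeight

/-! ### Derivatives of a weight times a composition with an affine map -/

section ChainRule

variable {X : Type*} [NormedAddCommGroup X] [NormedSpace ℝ X] (xs : StrongDual ℝ X) (v : X)
  (k c : ℝ)

/-- The linear part of `aff`. -/
def affLin : X →L[ℝ] X := ContinuousLinearMap.id ℝ X - k • xs.smulRight v

theorem affLin_apply (x : X) : affLin xs v k x = x - (k * xs x) • v := by
  simp [affLin, smul_smul]

theorem hasFDerivAt_aff (x : X) : HasFDerivAt (aff xs v k c) (affLin xs v k) x := by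
  have e : aff xs v k c = fun x => affLin xs v k x + (k * c) • v := by
    funext y
    rw [affLin_apply, aff]
    module
  rw [e]
  exact (affLin xs v k).hasFDerivAt.add_const _

/-- The composition with the linear part of `aff`. -/
def affPull : StrongDual ℝ X →L[ℝ] StrongDual ℝ X :=
  (ContinuousLinearMap.compL ℝ X X ℝ).flip (affLin xs v k)

theorem affPull_apply (L : StrongDual ℝ X) : affPull xs v k L = L.comp (affLin xs v k) := rfl

variable {xs v k c} {g : X → ℝ} {θ θ₁ θ₂ : ℝ → ℝ}

theorem hasFDerivAt_comp_aff (hg : C2b g) (x : X) :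
    HasFDerivAt (fun x => g (aff xs v k c x))
      (affPull xs v k (fderiv ℝ g (aff xs v k c x))) x :=
  ((hg.differentiable _).hasFDerivAt).comp x (hasFDerivAt_aff xs v k c x)

theorem hasFDerivAt_mul_comp_aff (hg : C2b g) (hθ : ∀ t, HasDerivAt θ (θ₁ t) t) (x : X) :
    HasFDerivAt (fun x => θ (xs x) * g (aff xs v k c x))
      (θ (xs x) • affPull xs v k (fderiv ℝ g (aff xs v k c x))
        + (θ₁ (xs x) * g (aff xs v k c x)) • xs) x := by
  have h1 : HasFDerivAt (fun x => θ (xs x)) (θ₁ (xs x) • xs) x :=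
    (hθ (xs x)).comp_hasFDerivAt x xs.hasFDerivAt
  refine (h1.mul (hasFDerivAt_comp_aff hg x)).congr_fderiv ?_
  rw [smul_smul, mul_comm (g _)]

theorem fderiv_mul_comp_aff (hg : C2b g) (hθ : ∀ t, HasDerivAt θ (θ₁ t) t) :
    fderiv ℝ (fun x => θ (xs x) * g (aff xs v k c x))
      = fun x => θ (xs x) • affPull xs v k (fderiv ℝ g (aff xs v k c x))
        + (θ₁ (xs x) * g (aff xs v k c x)) • xs :=
  funext fun x => (hasFDerivAt_mul_comp_aff hg hθ x).fderiv

theorem fderiv_fderiv_mul_comp_aff (hg : C2b g) (hθ : ∀ t, HasDerivAt θ (θ₁ t) t)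
    (hθ₁ : ∀ t, HasDerivAt θ₁ (θ₂ t) t) (x : X) :
    fderiv ℝ (fderiv ℝ (fun x => θ (xs x) * g (aff xs v k c x))) x
      = (θ (xs x) • (affPull xs v k).comp
            ((fderiv ℝ (fderiv ℝ g) (aff xs v k c x)).comp (affLin xs v k))
          + (θ₁ (xs x) • xs).smulRight (affPull xs v k (fderiv ℝ g (aff xs v k c x))))
        + (θ₁ (xs x) • affPull xs v k (fderiv ℝ g (aff xs v k c x))
            + (θ₂ (xs x) * g (aff xs v k c x)) • xs).smulRight xs := by
  rw [fderiv_mul_comp_aff hg hθ]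
  have h1 : HasFDerivAt (fun x => θ (xs x)) (θ₁ (xs x) • xs) x :=
    (hθ (xs x)).comp_hasFDerivAt x xs.hasFDerivAt
  have h2 : HasFDerivAt (fun x => affPull xs v k (fderiv ℝ g (aff xs v k c x)))
      ((affPull xs v k).comp
        ((fderiv ℝ (fderiv ℝ g) (aff xs v k c x)).comp (affLin xs v k))) x :=
    (affPull xs v k).hasFDerivAt.comp x
      (((hg.differentiable_fderiv _).hasFDerivAt).comp x (hasFDerivAt_aff xs v k c x))
  exact ((h1.smul h2).add
    ((hasFDerivAt_mul_comp_aff (xs := xs) hg hθ₁ x).smul_const xs)).fderiv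

end ChainRule

/-! ### The chain rule on gradients and Hilbert–Schmidt operators -/

section JetFormula

variable {X : Type*} [NormedAddCommGroup X] [NormedSpace ℝ X] [MeasurableSpace X] [BorelSpace X]
  [CompleteSpace X] [SecondCountableTopology X] {μ : Measure X} [IsGaussian μ]
  {xs : StrongDual ℝ X} {ι : Type*} (b : HilbertBasis ι ℝ (CM μ)) {k c : ℝ}

/-- The action of `affPull` on the Cameron–Martin space. -/
def gradMap (μ : Measure X) [IsGaussian μ] (xs : StrongDual ℝ X) (k : ℝ) : CM μ →L[ℝ] CM μ :=
  ContinuousLinearMap.id ℝ (CM μ)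
    - (k * (‖repL μ xs‖ ^ 2)⁻¹) • (innerSL ℝ (repL μ xs)).smulRight (repL μ xs)

theorem gradMap_apply (h : CM μ) : gradMap μ xs k h
    = h - (k * (‖repL μ xs‖ ^ 2)⁻¹ * ⟪repL μ xs, h⟫_ℝ) • repL μ xs := by
  simp [gradMap, smul_smul]

theorem repL_affPull (L : StrongDual ℝ X) :
    repL μ (affPull xs (normalDir μ xs) k L) = gradMap μ xs k (repL μ L) := by
  have e : affPull xs (normalDir μ xs) k L = L - (k * L (normalDir μ xs)) • xs := by
    ext x
    simp only [affPull_apply, ContinuousLinearMap.comp_apply, affLin_apply, map_sub, map_smul,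
      sub_apply, smul_apply, smul_eq_mul]
    ring
  rw [e, gradMap_apply, map_sub, map_smul, dual_normalDir, real_inner_comm, mul_assoc]

/-- The action of `aff` on second derivatives. -/
def hessMap (xs : StrongDual ℝ X) (k : ℝ) : HS μ ι →L[ℝ] HS μ ι :=
  -- With `P = gradMap μ xs k` this is `Q ↦ P Q P`, expanded so that only rank-one compositions and
  -- the evaluation at `repL μ xs` occur.
  ContinuousLinearMap.id ℝ (HS μ ι)
    - (k * (‖repL μ xs‖ ^ 2)⁻¹) • (projHS ι (repL μ xs)
      + (tenR b (repL μ xs)).comp ((gradMap μ xs k).comp (evHS b (repL μ xs))))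

theorem hessMap_apply (Q : HS μ ι) (i : ι) : hessMap b xs k Q i
    = Q i - (k * (‖repL μ xs‖ ^ 2)⁻¹) • (⟪repL μ xs, Q i⟫_ℝ • repL μ xs
      + ⟪repL μ xs, b i⟫_ℝ • gradMap μ xs k (evHS b (repL μ xs) Q)) := rfl

theorem hsL_affPull (B : X →L[ℝ] StrongDual ℝ X) :
    hsL b ((affPull xs (normalDir μ xs) k).comp (B.comp (affLin xs (normalDir μ xs) k)))
      = hessMap b xs k (hsL b B) := by
  ext i : 2
  rw [hessMap_apply, evHS_hsL, hsL_apply, hsL_apply]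
  simp only [ContinuousLinearMap.comp_apply]
  rw [repL_affPull, affLin_apply, normalDir, dual_embL, map_sub, map_smul, map_smul, map_sub,
    map_smul, map_smul, map_sub, map_smul, map_smul, gradMap_apply (repL μ (B (embL μ (b i))))]
  module

/-- The symmetrized tensor product with `e`. -/
def symTen (e : CM μ) : CM μ →L[ℝ] HS μ ι := tenR b e + tenL b e

variable {g : X → ℝ} {θ θ₁ θ₂ : ℝ → ℝ}

/-- Only `g` and its gradient at the reflected point appear, through bounded linear maps and scalar
weights. The formula therefore makes sense for arbitrary `L²` data, and `reflGrad` is built from it;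
the next lemma plays the same role for `reflHess`. -/
theorem repL_fderiv_mul_comp_aff (hg : C2b g) (hθ : ∀ t, HasDerivAt θ (θ₁ t) t) (x : X) :
    repL μ (fderiv ℝ (fun x => θ (xs x) * g (aff xs (normalDir μ xs) k c x)) x)
      = θ (xs x) • gradMap μ xs k (repL μ (fderiv ℝ g (aff xs (normalDir μ xs) k c x)))
        + (θ₁ (xs x) * g (aff xs (normalDir μ xs) k c x)) • repL μ xs := by
  rw [fderiv_mul_comp_aff hg hθ, map_add, map_smul, map_smul, repL_affPull]

theorem hsL_fderiv_mul_comp_aff (hg : C2b g) (hθ : ∀ t, HasDerivAt θ (θ₁ t) t)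
    (hθ₁ : ∀ t, HasDerivAt θ₁ (θ₂ t) t) (x : X) :
    hsL b (fderiv ℝ (fderiv ℝ (fun x => θ (xs x) * g (aff xs (normalDir μ xs) k c x))) x)
      = θ (xs x) • hessMap b xs k
          (hsL b (fderiv ℝ (fderiv ℝ g) (aff xs (normalDir μ xs) k c x)))
        + θ₁ (xs x) • symTen b (repL μ xs)
          (gradMap μ xs k (repL μ (fderiv ℝ g (aff xs (normalDir μ xs) k c x))))
        + (θ₂ (xs x) * g (aff xs (normalDir μ xs) k c x)) •
          tenR b (repL μ xs) (repL μ xs) := by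
  rw [fderiv_fderiv_mul_comp_aff hg hθ hθ₁, map_add, map_add, map_smul, hsL_affPull,
    hsL_smulRight, ← tenL_eq_hsL, map_smul, map_add, map_add, map_smul, map_smul, map_smul,
    map_smul, repL_affPull, symTen, tenL_eq_hsL b xs xs, hsL_smulRight]
  have : tenR b (θ₁ (xs x) • repL μ xs) (gradMap μ xs k (repL μ (fderiv ℝ g
      (aff xs (normalDir μ xs) k c x)))) = θ₁ (xs x) • tenR b (repL μ xs)
        (gradMap μ xs k (repL μ (fderiv ℝ g (aff xs (normalDir μ xs) k c x)))) := by
    ext i : 2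
    simp only [tenR_apply, lp.coeFn_smul, Pi.smul_apply, real_inner_smul_left, smul_smul]
  rw [this, add_apply]
  module

end JetFormula

/-! ### The reflection operator on triples -/

section Reflection

variable {X : Type*} [NormedAddCommGroup X] [NormedSpace ℝ X] [MeasurableSpace X] [BorelSpace X]
  [CompleteSpace X] [SecondCountableTopology X] {μ : Measure X} [IsGaussian μ]
  {xs : StrongDual ℝ X} {ι : Type*} (b : HilbertBasis ι ℝ (CM μ)) {k r a : ℝ} {c : ℝ≥0}

/-- The weights of the reflection operator are admissible. -/
structure IsReflWeight (μ : Measure X) [IsGaussian μ] (xs : StrongDual ℝ X) (k r a : ℝ) (c : ℝ≥0) :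
    Prop where
  zero : IsWeightedComp μ (μ.restrict (halfSpace xs r))
    ((halfSpace xs r)ᶜ.indicator fun x => gw a (xs x - r)) (aff xs (normalDir μ xs) k r) c
  one : IsWeightedComp μ (μ.restrict (halfSpace xs r))
    ((halfSpace xs r)ᶜ.indicator fun x => gwd a (xs x - r)) (aff xs (normalDir μ xs) k r) c
  two : IsWeightedComp μ (μ.restrict (halfSpace xs r))
    ((halfSpace xs r)ᶜ.indicator fun x => gwdd a (xs x - r)) (aff xs (normalDir μ xs) k r) c

theorem exists_isReflWeight (hcent : ∀ L : StrongDual ℝ X, μ[L] = 0) (h0 : repL μ xs ≠ 0)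
    {k : ℝ} (hk : 1 < k) (r : ℝ) : ∃ c : ℝ≥0, IsReflWeight μ xs k r (reflRate μ xs k + 2) c := by
  obtain ⟨c, hc⟩ := isWeightedComp_refl hcent h0 hk r
  have hβ : 0 ≤ reflRate μ xs k := by
    have : 0 < k - 1 := by linarith
    unfold reflRate
    positivity
  set C : ℝ≥0 := ⟨(reflRate μ xs k + 3) ^ 2, by positivity⟩ with hC
  have key : ∀ W : ℝ → ℝ, Continuous W →
      (∀ τ, |W τ| ≤ (reflRate μ xs k + 3) ^ 2 * gw (reflRate μ xs k) τ) →
      IsWeightedComp μ (μ.restrict (halfSpace xs r))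
        ((halfSpace xs r)ᶜ.indicator fun x => W (xs x - r)) (aff xs (normalDir μ xs) k r)
        (C ^ 2 * c) := fun W hWc hW => by
    refine hc.of_le (Measurable.indicator ?_ measurableSet_halfSpace.compl) C fun x => ?_
    · exact (hWc.comp (xs.continuous.sub continuous_const)).measurable
    · by_cases hx : x ∈ (halfSpace xs r)ᶜ
      · rw [indicator_of_mem hx, indicator_of_mem hx, abs_of_pos (gw_pos _ _)]
        exact hW _
      · simp [indicator_of_notMem hx]
  refine ⟨C ^ 2 * c, key _ (continuous_gw _) (abs_gw_le hβ), key _ ?_ (abs_gwd_le hβ),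
    key _ ?_ (abs_gwdd_le hβ)⟩
  · unfold gwd
    exact (continuous_const.mul continuous_id).neg.mul (continuous_gw _)
  · unfold gwdd
    exact ((continuous_const.mul (continuous_id.pow 2)).sub continuous_const).mul (continuous_gw _)

/-- The first component of the reflection operator. -/
def reflFn (h : IsReflWeight μ xs k r a c) :
    Lp ℝ 2 (μ.restrict (halfSpace xs r)) →L[ℝ] Lp ℝ 2 μ :=
  wcomp ℝ (isWeightedComp_indicator μ measurableSet_halfSpace) + wcomp ℝ h.zero

/-- The second component of the reflection operator. -/
def reflGrad (h : IsReflWeight μ xs k r a c) (u : Lp ℝ 2 (μ.restrict (halfSpace xs r)) ×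
    Lp (CM μ) 2 (μ.restrict (halfSpace xs r)) × Lp (HS μ ι) 2 (μ.restrict (halfSpace xs r))) :
    Lp (CM μ) 2 μ :=
  wcomp (CM μ) (isWeightedComp_indicator μ measurableSet_halfSpace) u.2.1
    + wcomp (CM μ) h.zero ((gradMap μ xs k).compLpL 2 (μ.restrict (halfSpace xs r)) u.2.1)
    + wcomp (CM μ) h.one ((ContinuousLinearMap.toSpanSingleton ℝ (repL μ xs)).compLpL 2
        (μ.restrict (halfSpace xs r)) u.1)

/-- The third component of the reflection operator. -/
def reflHess (h : IsReflWeight μ xs k r a c) (u : Lp ℝ 2 (μ.restrict (halfSpace xs r)) ×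
    Lp (CM μ) 2 (μ.restrict (halfSpace xs r)) × Lp (HS μ ι) 2 (μ.restrict (halfSpace xs r))) :
    Lp (HS μ ι) 2 μ :=
  wcomp (HS μ ι) (isWeightedComp_indicator μ measurableSet_halfSpace) u.2.2
    + wcomp (HS μ ι) h.zero ((hessMap b xs k).compLpL 2 (μ.restrict (halfSpace xs r)) u.2.2)
    + wcomp (HS μ ι) h.one (((symTen b (repL μ xs)).comp (gradMap μ xs k)).compLpL 2
        (μ.restrict (halfSpace xs r)) u.2.1)
    + wcomp (HS μ ι) h.two ((ContinuousLinearMap.toSpanSingleton ℝ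
        (tenR b (repL μ xs) (repL μ xs))).compLpL 2 (μ.restrict (halfSpace xs r)) u.1)

/-- The reflection operator on triples. -/
def reflOp (h : IsReflWeight μ xs k r a c) :
    (Lp ℝ 2 (μ.restrict (halfSpace xs r)) × Lp (CM μ) 2 (μ.restrict (halfSpace xs r)) ×
      Lp (HS μ ι) 2 (μ.restrict (halfSpace xs r))) →L[ℝ]
    (Lp ℝ 2 μ × Lp (CM μ) 2 μ × Lp (HS μ ι) 2 μ) where
  toFun u := (reflFn h u.1, reflGrad h u, reflHess b h u)
  map_add' u v := by
    simp only [reflGrad, reflHess, Prod.fst_add, Prod.snd_add, map_add, Prod.mk_add_mk]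
    refine Prod.ext rfl (Prod.ext ?_ ?_)
    · dsimp only
      abel
    · dsimp only
      abel
  map_smul' t u := by
    simp only [reflGrad, reflHess, Prod.smul_fst, Prod.smul_snd, map_smul, Prod.smul_mk,
      smul_add, RingHom.id_apply]
  cont := by
    unfold reflGrad reflHess
    fun_prop

theorem reflFn_coe (h : IsReflWeight μ xs k r a c)
    (u : Lp ℝ 2 (μ.restrict (halfSpace xs r))) :
    ∀ᵐ x ∂μ, (x ∈ halfSpace xs r → reflFn h u x = u x) ∧ (x ∉ halfSpace xs r →
      reflFn h u x = gw a (xs x - r) * u (aff xs (normalDir μ xs) k r x)) := by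
  filter_upwards [Lp.coeFn_add (wcomp ℝ (isWeightedComp_indicator μ measurableSet_halfSpace) u)
    (wcomp ℝ h.zero u), coeFn_wcomp h.zero u,
    coeFn_wcomp (isWeightedComp_indicator μ (measurableSet_halfSpace (xs := xs) (r := r))) u]
    with x h1 h2 h3
  rw [reflFn, add_apply, h1, Pi.add_apply, h2, h3]
  constructor <;> intro hx <;> simp [hx]

variable {g : X → ℝ}

theorem coeFn_compLpL_of_ae {α V W : Type*} [MeasurableSpace α] {ν : Measure α}
    [NormedAddCommGroup V] [NormedSpace ℝ V] [NormedAddCommGroup W] [NormedSpace ℝ W]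
    (A : V →L[ℝ] W) {u : Lp V 2 ν} {F : α → V} (h : u =ᵐ[ν] F) :
    A.compLpL 2 ν u =ᵐ[ν] fun x => A (F x) := by
  filter_upwards [ContinuousLinearMap.coeFn_compLpL (p := 2) A u, h] with x h1 h2
  rw [h1, h2]

/-- The reflection of a smooth function above the hyperplane. -/
def reflUp (μ : Measure X) [IsGaussian μ] (xs : StrongDual ℝ X) (k r a : ℝ) (g : X → ℝ) (x : X) :
    ℝ :=
  gw a (xs x - r) * g (aff xs (normalDir μ xs) k r x)

/-- `reflOp` acts formally on unrelated components. On jets it returns genuine derivatives on each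
side separately; that the two sides fit together in the Sobolev sense is a different matter, settled
in `reflOp_jet_mem`. -/
theorem reflOp_jet (h : IsReflWeight μ xs k r a c) (hg : C2b g) :
    ∀ᵐ x ∂μ,
      (x ∈ halfSpace xs r →
        (reflOp b h (jet b (μ.restrict (halfSpace xs r)) hg)).1 x = g x ∧
        (reflOp b h (jet b (μ.restrict (halfSpace xs r)) hg)).2.1 x = repL μ (fderiv ℝ g x) ∧
        (reflOp b h (jet b (μ.restrict (halfSpace xs r)) hg)).2.2 x
          = hsL b (fderiv ℝ (fderiv ℝ g) x)) ∧
      (x ∉ halfSpace xs r →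
        (reflOp b h (jet b (μ.restrict (halfSpace xs r)) hg)).1 x = reflUp μ xs k r a g x ∧
        (reflOp b h (jet b (μ.restrict (halfSpace xs r)) hg)).2.1 x
          = repL μ (fderiv ℝ (reflUp μ xs k r a g) x) ∧
        (reflOp b h (jet b (μ.restrict (halfSpace xs r)) hg)).2.2 x
          = hsL b (fderiv ℝ (fderiv ℝ (reflUp μ xs k r a g)) x)) := by
  have hS := isWeightedComp_indicator μ (measurableSet_halfSpace (xs := xs) (r := r))
  have hθ : ∀ t, HasDerivAt (fun t => gw a (t - r)) (gwd a (t - r)) t := fun t =>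
    (hasDerivAt_gw a (t - r)).comp_sub_const t r
  have hθ₁ : ∀ t, HasDerivAt (fun t => gwd a (t - r)) (gwdd a (t - r)) t := fun t =>
    (hasDerivAt_gwd a (t - r)).comp_sub_const t r
  set ν := μ.restrict (halfSpace xs r) with hν
  set u := jet b ν hg with hu
  have j1 : u.1 =ᵐ[ν] g := jet_fst b hg
  have j2 : u.2.1 =ᵐ[ν] fun x => repL μ (fderiv ℝ g x) := jet_grad b hg
  have j3 : u.2.2 =ᵐ[ν] fun x => hsL b (fderiv ℝ (fderiv ℝ g) x) := jet_hess b hg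
  have e1 := (Lp.coeFn_add (wcomp ℝ hS u.1) (wcomp ℝ h.zero u.1)).trans
    ((coeFn_wcomp_of_ae hS j1).add (coeFn_wcomp_of_ae h.zero j1))
  have e2 := (Lp.coeFn_add _ _).trans (((Lp.coeFn_add _ _).trans ((coeFn_wcomp_of_ae hS j2).add
      (coeFn_wcomp_of_ae h.zero (coeFn_compLpL_of_ae (gradMap μ xs k) j2)))).add
    (coeFn_wcomp_of_ae h.one
      (coeFn_compLpL_of_ae (ContinuousLinearMap.toSpanSingleton ℝ (repL μ xs)) j1)))
  have e3 := (Lp.coeFn_add _ _).trans (((Lp.coeFn_add _ _).trans (((Lp.coeFn_add _ _).trans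
      ((coeFn_wcomp_of_ae hS j3).add
        (coeFn_wcomp_of_ae h.zero (coeFn_compLpL_of_ae (hessMap b xs k) j3)))).add
      (coeFn_wcomp_of_ae h.one (coeFn_compLpL_of_ae
        ((symTen b (repL μ xs)).comp (gradMap μ xs k)) j2)))).add
    (coeFn_wcomp_of_ae h.two (coeFn_compLpL_of_ae
      (ContinuousLinearMap.toSpanSingleton ℝ (tenR b (repL μ xs) (repL μ xs))) j1)))
  filter_upwards [e1, e2, e3] with x h1 h2 h3
  have k1 : (reflOp b h u).1 x = _ := h1
  have k2 : (reflOp b h u).2.1 x = _ := h2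
  have k3 : (reflOp b h u).2.2 x = _ := h3
  rw [k1, k2, k3]
  constructor
  · intro hx
    simp [hx]
  · intro hx
    have f1 := repL_fderiv_mul_comp_aff (μ := μ) (xs := xs) (k := k) (c := r) hg hθ x
    have f2 := hsL_fderiv_mul_comp_aff b (xs := xs) (k := k) (c := r) hg hθ hθ₁ x
    refine ⟨?_, ?_, ?_⟩
    · simp [hx, reflUp]
    · refine Eq.trans ?_ f1.symm
      simp [hx, smul_smul]
    · refine Eq.trans ?_ f2.symm
      simp [hx, smul_smul]

end Reflection

/-! ### Smooth cutoff profiles on the line -/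

section Profile

/-- A smooth function with its derivatives bounded by `C`, constant on each side of `[-1, 1]`. -/
structure IsProfile (φ : ℝ → ℝ) (C : ℝ) : Prop where
  contDiff : ContDiff ℝ ∞ φ
  bound : ∀ τ, |φ τ| ≤ C ∧ |deriv φ τ| ≤ C ∧ |deriv (deriv φ) τ| ≤ C
  flat : ∀ τ, 1 < |τ| → deriv φ τ = 0 ∧ deriv (deriv φ) τ = 0

variable {φ : ℝ → ℝ} {C : ℝ}

theorem exists_isProfile (hφ : ContDiff ℝ ∞ φ) (h1 : ∀ τ, |φ τ| ≤ 1)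
    (hflat : ∀ τ, 1 < |τ| → ∃ c, φ =ᶠ[𝓝 τ] fun _ => c) : ∃ C, IsProfile φ C := by
  have hφ' : ContDiff ℝ ∞ (deriv φ) := (contDiff_infty_iff_deriv.1 hφ).2
  have hφ'' : ContDiff ℝ ∞ (deriv (deriv φ)) := (contDiff_infty_iff_deriv.1 hφ').2
  have hz : ∀ τ, 1 < |τ| → deriv φ τ = 0 ∧ deriv (deriv φ) τ = 0 := fun τ hτ => by
    obtain ⟨c, hc⟩ := hflat τ hτ
    constructor
    · rw [hc.deriv_eq, deriv_const]
    · rw [hc.deriv.deriv_eq]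
      simp
  have hb : ∀ ψ : ℝ → ℝ, Continuous ψ → (∀ τ, 1 < |τ| → ψ τ = 0) → ∃ D, ∀ τ, |ψ τ| ≤ D := by
    intro ψ hψ h0
    obtain ⟨D, hD⟩ := (isCompact_Icc (a := (-1 : ℝ)) (b := 1)).exists_bound_of_continuousOn
      hψ.continuousOn
    refine ⟨max D 0, fun τ => ?_⟩
    by_cases hτ : 1 < |τ|
    · rw [h0 τ hτ, abs_zero]
      exact le_max_right _ _
    · exact (hD τ (abs_le.1 (not_lt.1 hτ))).trans (le_max_left _ _)
  obtain ⟨D, hD⟩ := hb _ hφ'.continuous fun τ hτ => (hz τ hτ).1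
  obtain ⟨D', hD'⟩ := hb _ hφ''.continuous fun τ hτ => (hz τ hτ).2
  exact ⟨max 1 (max D D'), hφ, fun τ => ⟨(h1 τ).trans (le_max_left _ _),
    (hD τ).trans ((le_max_left _ _).trans (le_max_right _ _)),
    (hD' τ).trans ((le_max_right _ _).trans (le_max_right _ _))⟩, hz⟩

theorem IsProfile.nonneg (h : IsProfile φ C) : 0 ≤ C := (abs_nonneg _).trans (h.bound 0).1

theorem exists_isProfile_smoothTransition : ∃ C, IsProfile Real.smoothTransition C := by
  refine exists_isProfile Real.smoothTransition.contDiff (fun τ => ?_) fun τ hτ => ?_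
  · rw [abs_of_nonneg (Real.smoothTransition.nonneg τ)]
    exact Real.smoothTransition.le_one τ
  · rcases lt_abs.1 hτ with h | h
    · refine ⟨1, ?_⟩
      filter_upwards [lt_mem_nhds h] with t ht
      exact Real.smoothTransition.one_of_one_le (le_of_lt ht)
    · refine ⟨0, ?_⟩
      filter_upwards [gt_mem_nhds (show τ < 0 by linarith)] with t ht
      exact Real.smoothTransition.zero_of_nonpos (le_of_lt ht)

/-- A smooth cutoff function on the line. -/
def cutoff : ContDiffBump (0 : ℝ) := ⟨1 / 2, 1, by norm_num, by norm_num⟩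

theorem cutoff_eq_one {τ : ℝ} (h : |τ| ≤ 1 / 2) : cutoff τ = 1 :=
  cutoff.one_of_mem_closedBall (by simpa [cutoff] using h)

theorem cutoff_eq_zero {τ : ℝ} (h : 1 ≤ |τ|) : cutoff τ = 0 :=
  cutoff.zero_of_le_dist (by simpa [cutoff] using h)

theorem contDiff_cutoff : ContDiff ℝ ∞ (cutoff : ℝ → ℝ) := cutoff.contDiff

theorem exists_isProfile_cutoff : ∃ C, IsProfile cutoff C := by
  refine exists_isProfile contDiff_cutoff (fun τ => ?_) fun τ hτ => ⟨0, ?_⟩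
  · rw [abs_of_nonneg cutoff.nonneg]
    exact cutoff.le_one
  · filter_upwards [(continuous_abs.tendsto τ).eventually (lt_mem_nhds hτ)] with t ht
    exact cutoff_eq_zero (le_of_lt ht)

theorem deriv_cutoff {τ : ℝ} (h : |τ| < 1 / 2) :
    deriv cutoff τ = 0 ∧ deriv (deriv cutoff) τ = 0 := by
  have : (cutoff : ℝ → ℝ) =ᶠ[𝓝 τ] fun _ => 1 := by
    filter_upwards [(continuous_abs.tendsto τ).eventually (gt_mem_nhds h)] with t ht
    exact cutoff_eq_one (le_of_lt ht)
  constructor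
  · rw [this.deriv_eq, deriv_const]
  · rw [this.deriv.deriv_eq]
    simp

theorem IsProfile.hasDerivAt (h : IsProfile φ C) (s r t : ℝ) :
    HasDerivAt (fun t => φ (s * (t - r))) (s * deriv φ (s * (t - r))) t := by
  have h1 : HasDerivAt (fun t => s * (t - r)) s t := by
    simpa using ((hasDerivAt_id t).sub_const r).const_mul s
  have h2 := ((h.contDiff.differentiable (by simp)) (s * (t - r))).hasDerivAt.comp t h1
  exact h2.congr_deriv (mul_comm _ _)

theorem IsProfile.hasDerivAt_deriv (h : IsProfile φ C) (s r t : ℝ) :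
    HasDerivAt (fun t => s * deriv φ (s * (t - r))) (s ^ 2 * deriv (deriv φ) (s * (t - r))) t := by
  have h1 : HasDerivAt (fun t => s * (t - r)) s t := by
    simpa using ((hasDerivAt_id t).sub_const r).const_mul s
  have hd : Differentiable ℝ (deriv φ) :=
    (contDiff_infty_iff_deriv.1 h.contDiff).2.differentiable (by simp)
  refine (((hd (s * (t - r))).hasDerivAt.comp t h1).const_mul s).congr_deriv ?_
  ring

end Profile

/-! ### Limits of uniformly bounded jets -/

section JetLimits

/-- Dominated convergence for sequences that are stationary at almost every point; the limit
inherits the bound `C` from any index at which it is attained. -/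
theorem tendsto_toLp_of_bound {α V : Type*} [MeasurableSpace α] {ν : Measure α}
    [IsFiniteMeasure ν] [NormedAddCommGroup V] {F : ℕ → α → V} (hF : ∀ n, MemLp (F n) 2 ν)
    {C : ℝ} (hC : ∀ n x, ‖F n x‖ ≤ C) {u : Lp V 2 ν}
    (hu : ∀ᵐ x ∂ν, ∀ᶠ n in atTop, F n x = u x) :
    Tendsto (fun n => (hF n).toLp (F n)) atTop (𝓝 u) := by
  have hsq : Tendsto (fun n => ∫⁻ x, ‖F n x - u x‖ₑ ^ 2 ∂ν) atTop (𝓝 (∫⁻ _, 0 ∂ν)) := by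
    refine tendsto_lintegral_of_dominated_convergence' (fun _ => ENNReal.ofReal (C + C) ^ 2)
      (fun n => (((hF n).1.sub (Lp.aestronglyMeasurable u)).enorm.pow_const 2))
      (fun n => ?_) ?_ ?_
    · filter_upwards [hu] with x hx
      obtain ⟨m, hm⟩ := hx.exists
      gcongr
      rw [← ofReal_norm, ← hm]
      exact ENNReal.ofReal_le_ofReal ((norm_sub_le _ _).trans (add_le_add (hC n x) (hC m x)))
    · rw [lintegral_const]
      exact ENNReal.mul_ne_top (ENNReal.pow_ne_top ENNReal.ofReal_ne_top) (measure_ne_top _ _)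
    · filter_upwards [hu] with x hx
      refine tendsto_const_nhds.congr' ?_
      filter_upwards [hx] with n hn
      simp [hn]
  rw [lintegral_zero] at hsq
  rw [Lp.tendsto_Lp_iff_tendsto_eLpNorm']
  have e : ∀ n, eLpNorm (⇑((hF n).toLp (F n)) - ⇑u) 2 ν = eLpNorm (fun x => F n x - u x) 2 ν :=
    fun n => eLpNorm_congr_ae ((hF n).coeFn_toLp.sub EventuallyEq.rfl)
  simp only [e]
  rw [ENNReal.tendsto_nhds_zero] at hsq ⊢
  intro ε hε
  filter_upwards [hsq (ε ^ 2) (pos_of_ne_zero (pow_ne_zero 2 hε.ne'))] with n hn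
  rw [← ENNReal.pow_le_pow_left_iff two_ne_zero, eLpNorm_two_sq]
  exact hn

variable {X : Type*} [NormedAddCommGroup X] [NormedSpace ℝ X] [MeasurableSpace X] [BorelSpace X]
  [CompleteSpace X] [SecondCountableTopology X] {μ : Measure X} [IsGaussian μ] {ι : Type*}
  (b : HilbertBasis ι ℝ (CM μ)) {ν : Measure X} [IsFiniteMeasure ν] {xs : StrongDual ℝ X}

theorem tendsto_jet_of_bound {f : ℕ → X → ℝ} (hf : ∀ n, C2b (f n)) {C : ℝ}
    (hC : ∀ n x, ‖f n x‖ ≤ C ∧ ‖repL μ (fderiv ℝ (f n) x)‖ ≤ C ∧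
      ‖hsL b (fderiv ℝ (fderiv ℝ (f n)) x)‖ ≤ C)
    {p : Lp ℝ 2 ν × Lp (CM μ) 2 ν × Lp (HS μ ι) 2 ν}
    (hp : ∀ᵐ x ∂ν, ∀ᶠ n in atTop, f n x = p.1 x ∧ repL μ (fderiv ℝ (f n) x) = p.2.1 x ∧
      hsL b (fderiv ℝ (fderiv ℝ (f n)) x) = p.2.2 x) :
    Tendsto (fun n => jet b ν (hf n)) atTop (𝓝 p) := by
  refine Prod.tendsto_iff _ _ |>.2 ⟨?_, Prod.tendsto_iff _ _ |>.2 ⟨?_, ?_⟩⟩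
  · exact tendsto_toLp_of_bound (fun n => (hf n).memLp 2) (fun n x => (hC n x).1)
      (hp.mono fun x hx => hx.mono fun n hn => hn.1)
  · exact tendsto_toLp_of_bound (fun n => (hf n).memLp_grad 2) (fun n x => (hC n x).2.1)
      (hp.mono fun x hx => hx.mono fun n hn => hn.2.1)
  · exact tendsto_toLp_of_bound (fun n => (hf n).memLp_hess b 2) (fun n x => (hC n x).2.2)
      (hp.mono fun x hx => hx.mono fun n hn => hn.2.2)

theorem aff_zero (v : X) (c : ℝ) (x : X) : aff xs v 0 c x = x := by
  simp [aff]

theorem gradMap_zero (h : CM μ) : gradMap μ xs 0 h = h := by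
  simp [gradMap_apply]

theorem hessMap_zero (Q : HS μ ι) : hessMap b xs 0 Q = Q := by
  simp [hessMap]

variable {g : X → ℝ} {θ θ₁ θ₂ : ℝ → ℝ}

/-- For `k = 0` the affine map is the identity, so the product rule is a case of the formulas for
the reflection. -/
theorem repL_fderiv_mul (hg : C2b g) (hθ : ∀ t, HasDerivAt θ (θ₁ t) t) (x : X) :
    repL μ (fderiv ℝ (fun x => θ (xs x) * g x) x)
      = θ (xs x) • repL μ (fderiv ℝ g x) + (θ₁ (xs x) * g x) • repL μ xs := by
  simpa only [aff_zero, gradMap_zero] using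
    repL_fderiv_mul_comp_aff (μ := μ) (xs := xs) (k := 0) (c := 0) hg hθ x

theorem hsL_fderiv_mul (hg : C2b g) (hθ : ∀ t, HasDerivAt θ (θ₁ t) t)
    (hθ₁ : ∀ t, HasDerivAt θ₁ (θ₂ t) t) (x : X) :
    hsL b (fderiv ℝ (fderiv ℝ (fun x => θ (xs x) * g x)) x)
      = θ (xs x) • hsL b (fderiv ℝ (fderiv ℝ g) x)
        + θ₁ (xs x) • symTen b (repL μ xs) (repL μ (fderiv ℝ g x))
        + (θ₂ (xs x) * g x) • tenR b (repL μ xs) (repL μ xs) := by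
  simpa only [aff_zero, gradMap_zero, hessMap_zero] using
    hsL_fderiv_mul_comp_aff b (xs := xs) (k := 0) (c := 0) hg hθ hθ₁ x

/-- Functions that vanish where `x*` is large. -/
def BddNormal (xs : StrongDual ℝ X) (f : X → ℝ) : Prop := ∃ M : ℝ, ∀ x, M < |xs x| → f x = 0

/-- No bound on `m` is needed: it may be multiplied by a bump of `x*` that equals 1 wherever `f`
does not vanish. Gaussian weights and transition functions of `x*` are handled this way. -/
theorem IsFCbInf.mul_of_bddNormal {f : X → ℝ} (hf : IsFCbInf f) (hM : BddNormal xs f) {m : ℝ → ℝ}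
    (hm : ContDiff ℝ ∞ m) : IsFCbInf (fun x => m (xs x) * f x) := by
  obtain ⟨M, hM⟩ := hM
  let κ : ContDiffBump (0 : ℝ) := ⟨max M 1, max M 1 + 1, by positivity, by linarith⟩
  have h := hf.mul_comp xs (hm.mul κ.contDiff) κ.hasCompactSupport.mul_left
  convert h using 2 with x
  by_cases hx : M < |xs x|
  · rw [hM x hx, mul_zero, mul_zero]
  · have : κ (xs x) = 1 := κ.one_of_mem_closedBall (by
      rw [mem_closedBall_zero_iff, Real.norm_eq_abs]
      exact (not_lt.1 hx).trans (le_max_left _ _))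
    simp [this]

end JetLimits

/-! ### Reflection of functions with vanishing normal derivative -/

section GoodFunctions

variable {X : Type*} [NormedAddCommGroup X] [NormedSpace ℝ X] [MeasurableSpace X] [BorelSpace X]
  [CompleteSpace X] [SecondCountableTopology X] {μ : Measure X} [IsGaussian μ] {ι : Type*}
  (b : HilbertBasis ι ℝ (CM μ)) {xs : StrongDual ℝ X} {k r a : ℝ} {c : ℝ≥0} {g q : X → ℝ}

/-- The mean value inequality between `π_r x` and `x`, at distance `|x* x - r| ‖v‖`, used twice:
first for the derivative, then for `q` on the slab `|x* - r| ≤ |x* x - r|`, where the first bound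
holds with the value at `x`. -/
theorem exists_bound_of_vanish (h0 : repL μ xs ≠ 0) (hq : C2b q) (hq0 : ∀ x, xs x = r → q x = 0)
    (hq1 : ∀ x, xs x = r → fderiv ℝ q x = 0) :
    ∃ M : ℝ, 0 ≤ M ∧ ∀ x, ‖fderiv ℝ q x‖ ≤ M * |xs x - r| ∧ |q x| ≤ M * |xs x - r| ^ 2 := by
  obtain ⟨C, hC⟩ := hq.2
  have hC0 : 0 ≤ C := (norm_nonneg _).trans (hC 0).1
  set n := ‖normalDir μ xs‖
  have hsub : ∀ x, x - fib μ xs x r = (xs x - r) • normalDir μ xs := fun x => by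
    rw [fib_eq]
    abel
  have h1 : ∀ x, ‖fderiv ℝ q x‖ ≤ C * n * |xs x - r| := fun x => by
    have h := Convex.norm_image_sub_le_of_norm_fderiv_le (𝕜 := ℝ) (f := fderiv ℝ q) (C := C)
      (s := univ) (fun y _ => hq.differentiable_fderiv y) (fun y _ => (hC y).2.2) convex_univ
      (mem_univ (fib μ xs x r)) (mem_univ x)
    rw [hq1 _ (xs_fib h0 x r), sub_zero, hsub, norm_smul, Real.norm_eq_abs] at h
    exact h.trans (le_of_eq (by ring))
  have h2 : ∀ x, |q x| ≤ C * n ^ 2 * |xs x - r| ^ 2 := fun x => by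
    have hconv : Convex ℝ (xs ⁻¹' Icc (r - |xs x - r|) (r + |xs x - r|)) :=
      (convex_Icc _ _).linear_preimage xs.toLinearMap
    have h := Convex.norm_image_sub_le_of_norm_fderiv_le (𝕜 := ℝ) (f := q)
      (C := C * n * |xs x - r|)
      (s := xs ⁻¹' Icc (r - |xs x - r|) (r + |xs x - r|)) (fun y _ => hq.differentiable y)
      (fun y hy => (h1 y).trans (mul_le_mul_of_nonneg_left
        (abs_sub_le_iff.2 ⟨by linarith [hy.2], by linarith [hy.1]⟩) (by positivity))) hconv
      (x := fib μ xs x r) (y := x)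
      ⟨by rw [xs_fib h0]; linarith [abs_nonneg (xs x - r)],
        by rw [xs_fib h0]; linarith [abs_nonneg (xs x - r)]⟩
      ⟨by linarith [neg_abs_le (xs x - r)], by linarith [le_abs_self (xs x - r)]⟩
    rw [hq0 _ (xs_fib h0 x r), sub_zero, hsub, norm_smul, Real.norm_eq_abs, Real.norm_eq_abs] at h
    exact h.trans (le_of_eq (by ring))
  refine ⟨C * n + C * n ^ 2, by positivity, fun x => ⟨(h1 x).trans ?_, (h2 x).trans ?_⟩⟩
  · gcongr
    exact le_add_of_nonneg_right (by positivity)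
  · gcongr
    exact le_add_of_nonneg_left (by positivity)

theorem xs_aff (h0 : repL μ xs ≠ 0) (x : X) :
    xs (aff xs (normalDir μ xs) k r x) = r - (k - 1) * (xs x - r) := by
  rw [aff, map_sub, map_smul, xs_normalDir h0, smul_eq_mul]
  ring

/-- Since `x* - r` is multiplied by `-(k - 1) ≠ 0` under the reflection, vanishing for large `x*`
survives the composition, and the unbounded weight argument can be truncated. -/
theorem isFCbInf_reflUp (h0 : repL μ xs ≠ 0) (hk : 1 < k) (hg : IsFCbInf g)
    (hM : BddNormal xs g) :
    IsFCbInf (reflUp μ xs k r a g) ∧ BddNormal xs (reflUp μ xs k r a g) := by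
  have h1 : BddNormal xs fun x => g (aff xs (normalDir μ xs) k r x) := by
    obtain ⟨M, hM⟩ := hM
    have hk' : 0 < k - 1 := by linarith
    refine ⟨|r| + (|M| + |r|) / (k - 1), fun x hx => hM _ ?_⟩
    rw [xs_aff h0]
    have h2 : (|M| + |r|) / (k - 1) < |xs x - r| := by
      have := abs_sub_abs_le_abs_sub (xs x) r
      linarith
    rw [div_lt_iff₀ hk'] at h2
    have h3 := abs_sub_abs_le_abs_sub ((k - 1) * (xs x - r)) r
    rw [abs_mul, abs_of_pos hk', abs_sub_comm ((k - 1) * (xs x - r))] at h3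
    have := le_abs_self M
    linarith
  constructor
  · exact (hg.comp_aff xs (normalDir μ xs) k r).mul_of_bddNormal h1
      ((contDiff_gw a).comp (contDiff_id.sub contDiff_const))
  · obtain ⟨M, hM⟩ := h1
    exact ⟨M, fun x hx => mul_eq_zero_of_right _ (hM x hx)⟩

/-- The reflection fixes `x`, the weight has value 1 and slope 0 there, and the linear part of the
reflection changes the derivative by a multiple of its value at `v`, which is 0. The Neumann
condition thus spares any linear system for the coefficients: they only have to sum to 1. -/
theorem fderiv_reflUp_of_eq (hg : C2b g) {x : X} (hx : xs x = r)
    (hgx : fderiv ℝ g x (normalDir μ xs) = 0) :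
    reflUp μ xs k r a g x = g x ∧ fderiv ℝ (reflUp μ xs k r a g) x = fderiv ℝ g x := by
  have hR : aff xs (normalDir μ xs) k r x = x := by simp [aff, hx]
  have hθ : ∀ t, HasDerivAt (fun t => gw a (t - r)) (gwd a (t - r)) t := fun t =>
    (hasDerivAt_gw a (t - r)).comp_sub_const t r
  have h1 : gw a 0 = 1 := by simp [gw]
  constructor
  · rw [reflUp, hR, hx, sub_self, h1, one_mul]
  · have h := congrFun (fderiv_mul_comp_aff (xs := xs) (v := normalDir μ xs) (k := k) (c := r)
      hg hθ) x
    refine Eq.trans h ?_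
    rw [hR, hx, sub_self, h1, one_smul]
    ext y
    simp [affPull_apply, affLin_apply, gwd, hgx]

/-- The reflection of a smooth cylindrical function with vanishing normal derivative on the
hyperplane belongs to `W^{2,2}(X, μ)`. -/
theorem reflOp_jet_mem (hcent : ∀ L : StrongDual ℝ X, μ[L] = 0) (h0 : repL μ xs ≠ 0) (hk : 1 < k)
    (h : IsReflWeight μ xs k r a c) (hg : IsFCbInf g) (hM : BddNormal xs g)
    (hN : ∀ x, xs x = r → fderiv ℝ g x (normalDir μ xs) = 0) :
    reflOp b h (jet b (μ.restrict (halfSpace xs r)) hg.c2b) ∈ W22 μ μ b := by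
  obtain ⟨hu, huM⟩ := isFCbInf_reflUp (r := r) (a := a) h0 hk hg hM
  set U := reflUp μ xs k r a g with hU
  have hq : IsFCbInf fun x => U x - g x := hu.sub hg
  set q : X → ℝ := fun x => U x - g x with hqdef
  have hqM : BddNormal xs q := by
    obtain ⟨M, hM⟩ := hM
    obtain ⟨M', hM'⟩ := huM
    refine ⟨max M M', fun x hx => ?_⟩
    rw [hqdef]
    dsimp only
    rw [hM x ((le_max_left _ _).trans_lt hx), hM' x ((le_max_right _ _).trans_lt hx), sub_zero]
  have hq' : fderiv ℝ q = fun x => fderiv ℝ U x - fderiv ℝ g x := funext fun x =>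
    fderiv_fun_sub (hu.c2b.differentiable x) (hg.c2b.differentiable x)
  have hq'' : ∀ x, fderiv ℝ (fderiv ℝ q) x
      = fderiv ℝ (fderiv ℝ U) x - fderiv ℝ (fderiv ℝ g) x := fun x => by
    rw [hq']
    exact fderiv_fun_sub (hu.c2b.differentiable_fderiv x) (hg.c2b.differentiable_fderiv x)
  obtain ⟨M, hM0, hMq⟩ := exists_bound_of_vanish (μ := μ) (r := r) h0 hq.c2b
    (fun x hx => by
      rw [hqdef]
      exact sub_eq_zero.2 (fderiv_reflUp_of_eq hg.c2b hx (hN x hx)).1)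
    (fun x hx => by
      rw [hq']
      exact sub_eq_zero.2 (fderiv_reflUp_of_eq hg.c2b hx (hN x hx)).2)
  obtain ⟨C, hφ⟩ := exists_isProfile_smoothTransition
  set φ := Real.smoothTransition with hφdef
  have hC0 := hφ.nonneg
  -- The approximants `g + φ(s_n G) q` equal `g` where `G ≤ 0` and `U` where `G ≥ 1/s_n`. The jump
  -- of the second derivative is smeared over the layer between.
  let s : ℕ → ℝ := fun n => n + 1
  have hs1 : ∀ n, 1 ≤ s n := fun n => by simp [s]
  have hφq : ∀ n, IsFCbInf fun x => φ (s n * (xs x - r)) * q x := fun n =>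
    hq.mul_of_bddNormal hqM
      (hφ.contDiff.comp (contDiff_const.mul (contDiff_id.sub contDiff_const)))
  have hE : ∀ n, IsFCbInf fun x => g x + φ (s n * (xs x - r)) * q x := fun n => hg.add (hφq n)
  have d1 : ∀ n x, repL μ (fderiv ℝ (fun x => g x + φ (s n * (xs x - r)) * q x) x)
      = repL μ (fderiv ℝ g x) + (φ (s n * (xs x - r)) • repL μ (fderiv ℝ q x)
        + (s n * deriv φ (s n * (xs x - r)) * q x) • repL μ xs) := fun n x => by
    rw [fderiv_add_fun hg.c2b (hφq n).c2b, map_add]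
    congr 1
    exact repL_fderiv_mul hq.c2b (hφ.hasDerivAt (s n) r) x
  have d2 : ∀ n x, hsL b (fderiv ℝ (fderiv ℝ (fun x => g x + φ (s n * (xs x - r)) * q x)) x)
      = hsL b (fderiv ℝ (fderiv ℝ g) x)
        + (φ (s n * (xs x - r)) • hsL b (fderiv ℝ (fderiv ℝ q) x)
        + (s n * deriv φ (s n * (xs x - r))) • symTen b (repL μ xs) (repL μ (fderiv ℝ q x))
        + (s n ^ 2 * deriv (deriv φ) (s n * (xs x - r)) * q x) •
          tenR b (repL μ xs) (repL μ xs)) := fun n x => by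
    rw [fderiv_add_fun hg.c2b (hφq n).c2b, fderiv_fun_add (hg.c2b.differentiable_fderiv x)
      ((hφq n).c2b.differentiable_fderiv x), map_add]
    congr 1
    exact hsL_fderiv_mul b hq.c2b (hφ.hasDerivAt (s n) r) (hφ.hasDerivAt_deriv (s n) r) x
  obtain ⟨Cg, hCg⟩ := hg.c2b.2
  obtain ⟨Cq, hCq⟩ := hq.c2b.2
  have hCq0 : 0 ≤ Cq := (norm_nonneg _).trans (hCq 0).1
  have hCg0 : 0 ≤ Cg := (norm_nonneg _).trans (hCg 0).1
  -- The derivatives of `φ(s_n G)` vanish where `|G| > 1/s_n`. In the layer the factors `s_n` and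
  -- `s_n²` are compensated by `|Dq| ≤ M |G|` and `|q| ≤ M G²`, so the jets stay bounded uniformly
  -- in `n`.
  have w1 : ∀ n x, |s n * deriv φ (s n * (xs x - r)) * q x| ≤ C * M := fun n x => by
    by_cases hτ : 1 < |s n * (xs x - r)|
    · rw [(hφ.flat _ hτ).1]
      simpa using mul_nonneg hC0 hM0
    · rw [not_lt, abs_mul, abs_of_nonneg (by linarith [hs1 n])] at hτ
      have h1 : |xs x - r| ≤ 1 := by nlinarith [hs1 n, abs_nonneg (xs x - r)]
      rw [abs_mul, abs_mul, abs_of_nonneg (by linarith [hs1 n] : 0 ≤ s n)]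
      calc s n * |deriv φ (s n * (xs x - r))| * |q x|
          ≤ s n * C * (M * |xs x - r| ^ 2) := by
            have := hs1 n
            gcongr
            · exact (hφ.bound _).2.1
            · exact (hMq x).2
        _ = C * M * ((s n * |xs x - r|) * |xs x - r|) := by ring
        _ ≤ C * M * (1 * 1) := by gcongr
        _ = C * M := by ring
  have w2 : ∀ n x, |s n ^ 2 * deriv (deriv φ) (s n * (xs x - r)) * q x| ≤ C * M := fun n x => by
    by_cases hτ : 1 < |s n * (xs x - r)|
    · rw [(hφ.flat _ hτ).2]
      simpa using mul_nonneg hC0 hM0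
    · rw [not_lt, abs_mul, abs_of_nonneg (by linarith [hs1 n])] at hτ
      rw [abs_mul, abs_mul, abs_of_nonneg (sq_nonneg (s n))]
      calc s n ^ 2 * |deriv (deriv φ) (s n * (xs x - r))| * |q x|
          ≤ s n ^ 2 * C * (M * |xs x - r| ^ 2) := by
            gcongr
            · exact (hφ.bound _).2.2
            · exact (hMq x).2
        _ = C * M * (s n * |xs x - r|) ^ 2 := by ring
        _ ≤ C * M * 1 ^ 2 := by
            have := hs1 n
            gcongr
        _ = C * M := by ring
  have w3 : ∀ n x, |s n * deriv φ (s n * (xs x - r))| * ‖fderiv ℝ q x‖ ≤ C * M := fun n x => by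
    by_cases hτ : 1 < |s n * (xs x - r)|
    · rw [(hφ.flat _ hτ).1]
      simpa using mul_nonneg hC0 hM0
    · rw [not_lt, abs_mul, abs_of_nonneg (by linarith [hs1 n])] at hτ
      rw [abs_mul, abs_of_nonneg (by linarith [hs1 n] : 0 ≤ s n)]
      calc s n * |deriv φ (s n * (xs x - r))| * ‖fderiv ℝ q x‖
          ≤ s n * C * (M * |xs x - r|) := by
            have := hs1 n
            gcongr
            · exact (hφ.bound _).2.1
            · exact (hMq x).1
        _ = C * M * (s n * |xs x - r|) := by ring
        _ ≤ C * M * 1 := by gcongr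
        _ = C * M := by ring
  set B0 := Cg + C * Cq
  set B1 := ‖repL μ‖ * Cg + (C * (‖repL μ‖ * Cq) + C * M * ‖repL μ xs‖)
  set B2 := ‖hsL b‖ * Cg + (C * (‖hsL b‖ * Cq) + ‖symTen b (repL μ xs)‖ * (‖repL μ‖ * (C * M))
    + C * M * ‖tenR b (repL μ xs) (repL μ xs)‖)
  have hB0 : 0 ≤ B0 := by positivity
  have hB1 : 0 ≤ B1 := by positivity
  have hB2 : 0 ≤ B2 := by positivity
  refine (Submodule.isClosed_topologicalClosure _).mem_of_tendsto
    (tendsto_jet_of_bound b (fun n => (hE n).c2b) (C := B0 + B1 + B2) (fun n x => ⟨?_, ?_, ?_⟩) ?_)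
    (Eventually.of_forall fun n => jet_mem b (hE n))
  · have : ‖g x + φ (s n * (xs x - r)) * q x‖ ≤ B0 := by
      refine (norm_add_le _ _).trans (add_le_add (hCg x).1 ?_)
      rw [norm_mul]
      gcongr
      · exact (hφ.bound _).1
      · exact (hCq x).1
    linarith
  · have : ‖repL μ (fderiv ℝ (fun x => g x + φ (s n * (xs x - r)) * q x) x)‖ ≤ B1 := by
      rw [d1]
      refine (norm_add_le _ _).trans (add_le_add ((repL μ).le_opNorm_of_le (hCg x).2.1)
        ((norm_add_le _ _).trans (add_le_add ?_ ?_)))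
      · rw [norm_smul]
        gcongr
        · exact (hφ.bound _).1
        · exact (repL μ).le_opNorm_of_le (hCq x).2.1
      · rw [norm_smul]
        gcongr
        exact w1 n x
    linarith
  · have : ‖hsL b (fderiv ℝ (fderiv ℝ (fun x => g x + φ (s n * (xs x - r)) * q x)) x)‖ ≤ B2 := by
      rw [d2]
      refine (norm_add_le _ _).trans (add_le_add ((hsL b).le_opNorm_of_le (hCg x).2.2)
        ((norm_add_le _ _).trans (add_le_add ((norm_add_le _ _).trans (add_le_add ?_ ?_)) ?_)))
      · rw [norm_smul]
        gcongr
        · exact (hφ.bound _).1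
        · exact (hsL b).le_opNorm_of_le (hCq x).2.2
      · rw [← map_smul, ← map_smul]
        refine (symTen b (repL μ xs)).le_opNorm_of_le ((repL μ).le_opNorm_of_le ?_)
        rw [norm_smul]
        exact w3 n x
      · rw [norm_smul]
        gcongr
        exact w2 n x
    linarith
  -- Off the null hyperplane, every point leaves the layer `|G| ≤ 1/s_n` eventually, and from then
  -- on the approximant has the jet given by `reflOp_jet`.
  · have hlev : ∀ᵐ x ∂μ, xs x ≠ r := by
      rw [ae_iff]
      simpa using measure_level hcent h0 r
    have hslim : Tendsto s atTop atTop :=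
      tendsto_atTop_add_const_right _ _ tendsto_natCast_atTop_atTop
    filter_upwards [reflOp_jet b h hg.c2b, hlev] with x hx hxr
    rcases lt_or_gt_of_ne hxr with hlt | hgt
    · obtain ⟨l1, l2, l3⟩ := hx.1 (show xs x ≤ r from hlt.le)
      filter_upwards [hslim.eventually_gt_atTop (1 / (r - xs x))] with n hn
      have hpos : 0 < r - xs x := by linarith
      rw [div_lt_iff₀ hpos] at hn
      have hτ : 1 < |s n * (xs x - r)| := by
        rw [lt_abs]
        right
        linarith
      have hz : φ (s n * (xs x - r)) = 0 :=
        Real.smoothTransition.zero_of_nonpos (by linarith)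
      rw [d1, d2, l1, l2, l3, (hφ.flat _ hτ).1, (hφ.flat _ hτ).2, hz]
      simp
    · obtain ⟨l1, l2, l3⟩ := hx.2 (show ¬ xs x ≤ r from not_le.2 hgt)
      filter_upwards [hslim.eventually_gt_atTop (1 / (xs x - r))] with n hn
      have hpos : 0 < xs x - r := by linarith
      rw [div_lt_iff₀ hpos] at hn
      have hτ : 1 < |s n * (xs x - r)| := by
        rw [lt_abs]
        left
        linarith
      have hz : φ (s n * (xs x - r)) = 1 :=
        Real.smoothTransition.one_of_one_le (by linarith)
      rw [d1, d2, l1, l2, l3, (hφ.flat _ hτ).1, (hφ.flat _ hτ).2, hz, hq'', hq', ← hU]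
      refine ⟨?_, ?_, ?_⟩
      · simp [hqdef]
      · simp
      · simp

end GoodFunctions

/-! ### Bookkeeping of `L²` bounds -/

section Helpers

variable {α V W : Type*} [MeasurableSpace α] {ν : Measure α} [NormedAddCommGroup V]
  [NormedAddCommGroup W] {δ : ℝ≥0∞} {k k' m : ℝ}

theorem eLpNorm_add_le_ofReal_mul {F G : α → V} (hk : 0 ≤ k) (hk' : 0 ≤ k')
    (hF : AEStronglyMeasurable F ν) (hG : AEStronglyMeasurable G ν)
    (h : eLpNorm F 2 ν ≤ ENNReal.ofReal k * δ) (h' : eLpNorm G 2 ν ≤ ENNReal.ofReal k' * δ) :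
    eLpNorm (fun x => F x + G x) 2 ν ≤ ENNReal.ofReal (k + k') * δ := by
  rw [ENNReal.ofReal_add hk hk', add_mul]
  exact (eLpNorm_add_le hF hG (by norm_num)).trans (add_le_add h h')

theorem eLpNorm_le_ofReal_mul {F : α → V} {G : α → W} (hm : 0 ≤ m)
    (hle : ∀ x, ‖G x‖ ≤ m * ‖F x‖) (h : eLpNorm F 2 ν ≤ ENNReal.ofReal k * δ) :
    eLpNorm G 2 ν ≤ ENNReal.ofReal (m * k) * δ := by
  rw [ENNReal.ofReal_mul hm, mul_assoc]
  exact (eLpNorm_le_mul_eLpNorm_of_ae_le_mul (ae_of_all _ hle) 2).trans (by gcongr)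

theorem eLpNorm_ofReal_mono {F : α → V} (hkm : k ≤ m)
    (h : eLpNorm F 2 ν ≤ ENNReal.ofReal k * δ) : eLpNorm F 2 ν ≤ ENNReal.ofReal m * δ :=
  h.trans (by gcongr)

theorem enorm_prod_le {p : V × W} {B : ℝ≥0∞} (h1 : ‖p.1‖ₑ ≤ B) (h2 : ‖p.2‖ₑ ≤ B) :
    ‖p‖ₑ ≤ B := by
  rw [← ofReal_norm, Prod.norm_def]
  rcases max_cases ‖p.1‖ ‖p.2‖ with h | h
  · rw [h.1, ofReal_norm]
    exact h1
  · rw [h.1, ofReal_norm]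
    exact h2

end Helpers

/-! ### Approximation by functions with vanishing normal derivative -/

section Density

variable {X : Type*} [NormedAddCommGroup X] [NormedSpace ℝ X] [MeasurableSpace X] [BorelSpace X]
  [CompleteSpace X] [SecondCountableTopology X] {μ : Measure X} [IsGaussian μ] {ι : Type*}
  (b : HilbertBasis ι ℝ (CM μ)) {xs : StrongDual ℝ X} {r ε : ℝ}

/-- Multiplication by the cutoff of `x* / (n + 1)`: its derivatives are bounded uniformly in `n`,
and near any given point it is eventually constant 1. -/
theorem jet_mem_closure_bddNormal {ν : Measure X} [IsFiniteMeasure ν] (xs : StrongDual ℝ X)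
    {f : X → ℝ} (hf : IsFCbInf f) :
    jet b ν hf.c2b ∈ closure {p : Lp ℝ 2 ν × Lp (CM μ) 2 ν × Lp (HS μ ι) 2 ν |
      ∃ (g : X → ℝ) (hg : IsFCbInf g), BddNormal xs g ∧ p = jet b ν hg.c2b} := by
  obtain ⟨C, hφ⟩ := exists_isProfile_cutoff
  have hC0 := hφ.nonneg
  let s : ℕ → ℝ := fun n => 1 / ((n : ℝ) + 1)
  have hs0 : ∀ n, 0 < s n := fun n => by positivity
  have hs1 : ∀ n, s n ≤ 1 := fun n => by
    rw [div_le_one (by positivity)]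
    linarith [(Nat.cast_nonneg n : (0 : ℝ) ≤ n)]
  have hz : ∀ n t, 1 / s n < |t| → cutoff (s n * (t - 0)) = 0 := fun n t ht => by
    refine cutoff_eq_zero ?_
    rw [div_lt_iff₀ (hs0 n), mul_comm] at ht
    rw [sub_zero, abs_mul, abs_of_pos (hs0 n)]
    exact ht.le
  have hE : ∀ n, IsFCbInf fun x => cutoff (s n * (xs x - 0)) * f x := fun n => by
    -- The idle shift by 0 keeps the argument in the form required by `IsProfile.hasDerivAt`.
    refine hf.mul_comp xs (m := fun t => cutoff (s n * (t - 0)))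
      (contDiff_cutoff.comp (contDiff_const.mul (contDiff_id.sub contDiff_const)))
      (HasCompactSupport.intro (isCompact_closedBall 0 (1 / s n)) fun t ht => hz n t ?_)
    simpa using ht
  have d1 := fun n x => repL_fderiv_mul (μ := μ) (xs := xs) hf.c2b (hφ.hasDerivAt (s n) 0) x
  have d2 := fun n x => hsL_fderiv_mul b (xs := xs) hf.c2b (hφ.hasDerivAt (s n) 0)
    (hφ.hasDerivAt_deriv (s n) 0) x
  obtain ⟨D, hD⟩ := hf.c2b.2
  have hD0 : 0 ≤ D := (norm_nonneg _).trans (hD 0).1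
  have w1 : ∀ n τ, |s n * deriv cutoff τ| ≤ C := fun n τ => by
    rw [abs_mul, abs_of_pos (hs0 n), ← one_mul C]
    exact mul_le_mul (hs1 n) (hφ.bound _).2.1 (abs_nonneg _) zero_le_one
  have w2 : ∀ n τ, |s n ^ 2 * deriv (deriv cutoff) τ| ≤ C := fun n τ => by
    rw [abs_mul, abs_of_pos (pow_pos (hs0 n) 2), ← one_mul C]
    exact mul_le_mul (pow_le_one₀ (hs0 n).le (hs1 n)) (hφ.bound _).2.2 (abs_nonneg _) zero_le_one
  set B0 := C * D
  set B1 := C * (‖repL μ‖ * D) + C * D * ‖repL μ xs‖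
  set B2 := C * (‖hsL b‖ * D) + C * (‖symTen b (repL μ xs)‖ * (‖repL μ‖ * D))
    + C * D * ‖tenR b (repL μ xs) (repL μ xs)‖
  have hB0 : 0 ≤ B0 := by positivity
  have hB1 : 0 ≤ B1 := by positivity
  have hB2 : 0 ≤ B2 := by positivity
  refine mem_closure_of_tendsto (tendsto_jet_of_bound b (fun n => (hE n).c2b)
    (C := B0 + B1 + B2) (fun n x => ⟨?_, ?_, ?_⟩) ?_)
    (Eventually.of_forall fun n => ⟨_, hE n, ⟨1 / s n, fun x hx =>
      mul_eq_zero_of_left (hz n _ hx) _⟩,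
      rfl⟩)
  · have : ‖cutoff (s n * (xs x - 0)) * f x‖ ≤ B0 := by
      rw [norm_mul]
      exact mul_le_mul (hφ.bound _).1 (hD x).1 (norm_nonneg _) hC0
    linarith
  · have : ‖repL μ (fderiv ℝ (fun x => cutoff (s n * (xs x - 0)) * f x) x)‖ ≤ B1 := by
      rw [d1]
      refine (norm_add_le _ _).trans (add_le_add ?_ ?_)
      · rw [norm_smul]
        gcongr
        · exact (hφ.bound _).1
        · exact (repL μ).le_opNorm_of_le (hD x).2.1
      · rw [norm_smul, norm_mul]
        gcongr
        · exact w1 n _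
        · exact (hD x).1
    linarith
  · have : ‖hsL b (fderiv ℝ (fderiv ℝ fun x => cutoff (s n * (xs x - 0)) * f x) x)‖ ≤ B2 := by
      rw [d2]
      refine (norm_add_le _ _).trans (add_le_add ((norm_add_le _ _).trans (add_le_add ?_ ?_)) ?_)
      · rw [norm_smul]
        gcongr
        · exact (hφ.bound _).1
        · exact (hsL b).le_opNorm_of_le (hD x).2.2
      · rw [norm_smul]
        gcongr
        · exact w1 n _
        · exact (symTen b (repL μ xs)).le_opNorm_of_le ((repL μ).le_opNorm_of_le (hD x).2.1)
      · rw [norm_smul, norm_mul]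
        gcongr
        · exact w2 n _
        · exact (hD x).1
    linarith
  · have hslim : Tendsto s atTop (𝓝 0) := tendsto_one_div_add_atTop_nhds_zero_nat
    filter_upwards [jet_fst b hf.c2b (ν := ν), jet_grad b hf.c2b (ν := ν),
      jet_hess b hf.c2b (ν := ν)] with x l1 l2 l3
    have hlim : Tendsto (fun n => |s n * (xs x - 0)|) atTop (𝓝 0) := by
      simpa using (hslim.mul_const (xs x - 0)).abs
    filter_upwards [hlim.eventually (gt_mem_nhds (by norm_num : (0 : ℝ) < 1 / 2))] with n hn
    rw [d1, d2, l1, l2, l3, (deriv_cutoff hn).1, (deriv_cutoff hn).2, cutoff_eq_one hn.le]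
    simp

theorem exists_bddNormal_jet_tendsto {ν : Measure X} [IsFiniteMeasure ν] (xs : StrongDual ℝ X)
    {u : Lp ℝ 2 ν × Lp (CM μ) 2 ν × Lp (HS μ ι) 2 ν} (hu : u ∈ W22 μ ν b) :
    ∃ (f : ℕ → X → ℝ) (hf : ∀ n, IsFCbInf (f n)), (∀ n, BddNormal xs (f n)) ∧
      Tendsto (fun n => jet b ν (hf n).c2b) atTop (𝓝 u) := by
  obtain ⟨f, hf, hlim⟩ := exists_jet_tendsto b hu
  have h := isClosed_closure.mem_of_tendsto hlim
    (Eventually.of_forall fun n => jet_mem_closure_bddNormal b xs (hf n))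
  obtain ⟨p, hp, hplim⟩ := mem_closure_iff_seq_limit.1 h
  choose g hg hgM hgp using hp
  exact ⟨g, hg, hgM, by simpa only [← hgp] using hplim⟩

/-- The functional that gives the normal derivative from the gradient. -/
def normalFun (μ : Measure X) [IsGaussian μ] (xs : StrongDual ℝ X) : CM μ →L[ℝ] ℝ :=
  (‖repL μ xs‖ ^ 2)⁻¹ • innerSL ℝ (repL μ xs)

/-- The map that gives the normal derivative of the gradient from the second derivative. -/
def normalEv (xs : StrongDual ℝ X) : HS μ ι →L[ℝ] CM μ :=
  (‖repL μ xs‖ ^ 2)⁻¹ • evHS b (repL μ xs)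

theorem gradMap_one (h : CM μ) :
    gradMap μ xs 1 h = h - normalFun μ xs h • repL μ xs := by
  rw [gradMap_apply, one_mul]
  rfl

theorem eLpNorm_restrict_halfSpace_eq {V : Type*} [NormedAddCommGroup V] {F : X → V}
    (hF : ∀ x, xs x < r - ε → F x = 0) :
    eLpNorm F 2 (μ.restrict (halfSpace xs r)) = eLpNorm F 2 (μ.restrict (strip xs r ε)) := by
  have h1 : F =ᵐ[μ.restrict (halfSpace xs r)] (strip xs r ε).indicator F := by
    filter_upwards [ae_restrict_mem measurableSet_halfSpace] with x hx
    by_cases hxS : x ∈ strip xs r ε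
    · rw [indicator_of_mem hxS]
    · rw [indicator_of_notMem hxS]
      refine hF x (not_le.1 fun hle => hxS ⟨hle, hx⟩)
  rw [eLpNorm_congr_ae h1, eLpNorm_indicator_eq_eLpNorm_restrict measurableSet_strip,
    Measure.restrict_restrict measurableSet_strip,
    inter_eq_self_of_subset_left strip_subset_halfSpace]

theorem poincare_strip_ofReal {V : Type*} [NormedAddCommGroup V] [NormedSpace ℝ V]
    [CompleteSpace V] (hcent : ∀ L : StrongDual ℝ X, μ[L] = 0) (h0 : repL μ xs ≠ 0)
    {c C : ℝ} (hc : 0 < c) (hC : 0 < C)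
    (hcC : ∀ t ∈ Icc (r - 1) r, c ≤ normalDens μ xs t ∧ normalDens μ xs t ≤ C)
    {F F' : X → V} (hF : HasNormalDeriv μ xs F F') (hε : ε ∈ Ioc (0 : ℝ) 1) {s : ℝ}
    (hs : s ∈ Icc (r - ε) r) {κ : ℝ} {δ : ℝ≥0∞}
    (hle : eLpNorm F' 2 (μ.restrict (strip xs r ε)) ≤ ENNReal.ofReal κ * δ) :
    eLpNorm (fun x => F x - F (fib μ xs x s)) 2 (μ.restrict (strip xs r ε))
      ≤ ENNReal.ofReal (√(C / c) * ε * κ) * δ := by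
  have hε0 := hε.1.le
  refine (poincare_strip hcent h0 hc hC hcC hF hε hs).trans ?_
  rw [ENNReal.ofReal_mul (by positivity : 0 ≤ √(C / c) * ε), mul_assoc]
  gcongr

theorem fderiv_normalDir_eq (f : X → ℝ) (x : X) :
    fderiv ℝ f x (normalDir μ xs) = normalFun μ xs (repL μ (fderiv ℝ f x)) :=
  fderiv_normalDir f x

/-- Projecting onto a slice removes the normal component of the gradient. What is left over is an
oscillation along the fiber, suited to the Poincaré inequality, and the normal derivative on the
slice, which has to be shown small separately. -/
theorem repL_fderiv_sub_fib {f : X → ℝ} (hf : IsFCbInf f) (t : ℝ) (x : X) :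
    repL μ (fderiv ℝ (fun x => f x - f (fib μ xs x t)) x) = (repL μ (fderiv ℝ f x)
      - repL μ (fderiv ℝ f (fib μ xs x t)))
      + fderiv ℝ f (fib μ xs x t) (normalDir μ xs) • repL μ xs := by
  have hfib : IsFCbInf fun x => f (fib μ xs x t) := hf.comp_aff xs (normalDir μ xs) 1 t
  have h1 := repL_fderiv_mul_comp_aff (μ := μ) (xs := xs) (k := 1) (c := t) hf.c2b
    (fun s => hasDerivAt_const s (1 : ℝ)) x
  simp only [one_mul, one_smul, zero_mul, zero_smul, add_zero] at h1
  have h2 : repL μ (fderiv ℝ (fun x => f (fib μ xs x t)) x)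
      = gradMap μ xs 1 (repL μ (fderiv ℝ f (fib μ xs x t))) := h1
  rw [fderiv_fun_sub (hf.c2b.differentiable x) (hfib.c2b.differentiable x), map_sub, h2,
    gradMap_one, fderiv_normalDir_eq]
  abel

theorem hsL_fderiv_sub_fib {f : X → ℝ} (hf : IsFCbInf f) (t : ℝ) (x : X) :
    hsL b (fderiv ℝ (fderiv ℝ (fun x => f x - f (fib μ xs x t))) x)
      = hsL b (fderiv ℝ (fderiv ℝ f) x)
        + -hessMap b xs 1 (hsL b (fderiv ℝ (fderiv ℝ f) (fib μ xs x t))) := by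
  have hfib : IsFCbInf fun x => f (fib μ xs x t) := hf.comp_aff xs (normalDir μ xs) 1 t
  have h1 := hsL_fderiv_mul_comp_aff b (xs := xs) (k := 1) (c := t) hf.c2b
    (fun s => hasDerivAt_const s (1 : ℝ)) (fun s => hasDerivAt_const s (0 : ℝ)) x
  simp only [one_mul, one_smul, zero_mul, zero_smul, add_zero] at h1
  have h2 : hsL b (fderiv ℝ (fderiv ℝ fun x => f (fib μ xs x t)) x)
      = hessMap b xs 1 (hsL b (fderiv ℝ (fderiv ℝ f) (fib μ xs x t))) := h1
  have h3 : fderiv ℝ (fun x => f x - f (fib μ xs x t))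
      = fun x => fderiv ℝ f x - fderiv ℝ (fun x => f (fib μ xs x t)) x :=
    funext fun x => fderiv_fun_sub (hf.c2b.differentiable x) (hfib.c2b.differentiable x)
  rw [h3, fderiv_fun_sub (hf.c2b.differentiable_fderiv x) (hfib.c2b.differentiable_fderiv x),
    map_sub, h2, sub_eq_add_neg]

/-- The size of the second derivative near the hyperplane and of the normal derivative on it. -/
def bdrySize (xs : StrongDual ℝ X) (r ε : ℝ) (f : X → ℝ) : ℝ≥0∞ :=
  eLpNorm (fun x => hsL b (fderiv ℝ (fderiv ℝ f) x)) 2 (μ.restrict (strip xs r ε))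
    + ENNReal.ofReal (√ε)⁻¹ * eLpNorm (fun x => fderiv ℝ f (fib μ xs x r) (normalDir μ xs)) 2 μ

theorem eLpNorm_hess_le_bdrySize (f : X → ℝ) :
    eLpNorm (fun x => hsL b (fderiv ℝ (fderiv ℝ f) x)) 2 (μ.restrict (strip xs r ε))
      ≤ ENNReal.ofReal 1 * bdrySize b xs r ε f := by
  rw [ENNReal.ofReal_one, one_mul]
  exact le_self_add

/-- The function is constant along the fibers and the strip has mass at most `C ε`, which gains `√(C
ε)`. The weight `ε^{-1/2}` in `bdrySize` is chosen so that the result is of order `ε`, as in a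
Poincaré estimate. -/
theorem eLpNorm_normal_le_bdrySize (hcent : ∀ L : StrongDual ℝ X, μ[L] = 0) (h0 : repL μ xs ≠ 0)
    {c C : ℝ} (hC : 0 < C)
    (hcC : ∀ t ∈ Icc (r - 1) r, c ≤ normalDens μ xs t ∧ normalDens μ xs t ≤ C)
    (hε : ε ∈ Ioc (0 : ℝ) 1) {f : X → ℝ} (hf : C2b f) :
    eLpNorm (fun x => fderiv ℝ f (fib μ xs x r) (normalDir μ xs)) 2 (μ.restrict (strip xs r ε))
      ≤ ENNReal.ofReal (√C * ε) * bdrySize b xs r ε f := by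
  have hε0 : 0 < ε := hε.1
  have cft : Continuous fun x => fderiv ℝ f x (normalDir μ xs) :=
    hf.continuous_fderiv.clm_apply continuous_const
  have h1 : eLpNorm (fun x => fderiv ℝ f (fib μ xs x r) (normalDir μ xs)) 2
      (μ.restrict (strip xs r ε)) ≤ ENNReal.ofReal (√(C * ε)) *
        eLpNorm (fun x => fderiv ℝ f (fib μ xs x r) (normalDir μ xs)) 2 μ := by
    rw [← ENNReal.pow_le_pow_left_iff two_ne_zero, mul_pow,
      eLpNorm_strip_comp_fib_sq hcent h0 (F := fun x => fderiv ℝ f x (normalDir μ xs))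
        (cft.comp (continuous_fib_const r)), ← ENNReal.ofReal_pow (Real.sqrt_nonneg _),
      Real.sq_sqrt (by positivity), ENNReal.ofReal_mul hC.le]
    gcongr
    exact (normalLaw_Icc_le h0 hcC hε).2
  have h2 : √(C * ε) = √C * ε * (√ε)⁻¹ := by
    have hs : √ε ≠ 0 := (Real.sqrt_pos.2 hε0).ne'
    rw [Real.sqrt_mul hC.le]
    field_simp
    exact (Real.sq_sqrt hε0.le)
  refine h1.trans ?_
  rw [h2, ENNReal.ofReal_mul (by positivity : 0 ≤ √C * ε), mul_assoc, bdrySize]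
  gcongr
  exact le_add_self

/-- Estimates of `f - f ∘ π` on thin strips, where `π` is the projection on a suitable slice. -/
theorem exists_slice_estimates (hcent : ∀ L : StrongDual ℝ X, μ[L] = 0) (h0 : repL μ xs ≠ 0)
    (r : ℝ) : ∃ k₅ k₇ k₈ : ℝ, 0 ≤ k₅ ∧ 0 ≤ k₇ ∧ 0 ≤ k₈ ∧ ∀ ε ∈ Ioc (0 : ℝ) 1,
      ∀ f : X → ℝ, IsFCbInf f → ∃ t : ℝ,
        eLpNorm (fun x => f x - f (fib μ xs x t)) 2 (μ.restrict (strip xs r ε))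
          ≤ ENNReal.ofReal (k₅ * ε ^ 2) * bdrySize b xs r ε f ∧
        eLpNorm (fun x => repL μ (fderiv ℝ (fun x => f x - f (fib μ xs x t)) x)) 2
          (μ.restrict (strip xs r ε)) ≤ ENNReal.ofReal (k₇ * ε) * bdrySize b xs r ε f ∧
        eLpNorm (fun x => hsL b (fderiv ℝ (fderiv ℝ (fun x => f x - f (fib μ xs x t))) x)) 2
          (μ.restrict (strip xs r ε)) ≤ ENNReal.ofReal k₈ * bdrySize b xs r ε f := by
  obtain ⟨c, C, hc, hC, hcC⟩ := exists_dens_bounds μ xs h0 r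
  set A := ‖normalFun μ xs‖ with hA
  set N := ‖normalEv b xs‖ with hN
  set P := √(C / c) with hP
  have hP0 : 0 ≤ P := Real.sqrt_nonneg _
  have hA0 : 0 ≤ A := norm_nonneg _
  have hN0 : 0 ≤ N := norm_nonneg _
  set k₁ := P * (A * N) with hk₁
  have hk₁0 : 0 ≤ k₁ := by positivity
  set k₃ := √C + k₁ with hk₃
  have hk₃0 : 0 ≤ k₃ := by positivity
  refine ⟨P * k₃, P * N + ‖repL μ xs‖ * (k₃ + k₁), 1 + ‖hessMap b xs 1‖, by positivity,
    by positivity, by positivity, fun ε hε f hf => ?_⟩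
  have hε0 : 0 ≤ ε := hε.1.le
  have cH : Continuous fun x => hsL b (fderiv ℝ (fderiv ℝ f) x) :=
    (hsL b).continuous.comp hf.c2b.continuous_hess
  have cgrad : Continuous fun x => repL μ (fderiv ℝ f x) :=
    (repL μ).continuous.comp hf.c2b.continuous_fderiv
  have cft : Continuous fun x => fderiv ℝ f x (normalDir μ xs) :=
    hf.c2b.continuous_fderiv.clm_apply continuous_const
  -- Second derivatives in `L²` have no trace, so the slice `{x* = r}` itself cannot be used; `t` is
  -- a height where the second derivative is no larger than on average.
  obtain ⟨t, ht, hslice⟩ := exists_slice hcent h0 hε (r := r) cH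
  have cfib : Continuous fun x => fib μ xs x t := continuous_fib_const t
  have cfibr : Continuous fun x => fib μ xs x r := continuous_fib_const r
  have cgradt : Continuous fun x => repL μ (fderiv ℝ f (fib μ xs x t)) := cgrad.comp cfib
  have cftt : Continuous fun x => fderiv ℝ f (fib μ xs x t) (normalDir μ xs) := cft.comp cfib
  have cftr : Continuous fun x => fderiv ℝ f (fib μ xs x r) (normalDir μ xs) := cft.comp cfibr
  have bH := eLpNorm_hess_le_bdrySize (r := r) (ε := ε) (xs := xs) b f
  set δ := bdrySize b xs r ε f with hδ
  set S := strip xs r ε with hS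
  have hr : r ∈ Icc (r - ε) r := ⟨by linarith [hε.1], le_rfl⟩
  have ndg : HasNormalDeriv μ xs (fun x => repL μ (fderiv ℝ f x))
      (fun x => normalEv b xs (hsL b (fderiv ℝ (fderiv ℝ f) x))) :=
    hf.c2b.hasNormalDeriv_grad b
  have ndt : HasNormalDeriv μ xs (fun x => fderiv ℝ f x (normalDir μ xs))
      (fun x => normalFun μ xs (normalEv b xs (hsL b (fderiv ℝ (fderiv ℝ f) x)))) := by
    simpa only [fderiv_normalDir_eq] using ndg.clm (normalFun μ xs)
  have bEv : eLpNorm (fun x => normalEv b xs (hsL b (fderiv ℝ (fderiv ℝ f) x))) 2 (μ.restrict S)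
      ≤ ENNReal.ofReal (N * 1) * δ :=
    eLpNorm_le_ofReal_mul hN0 (fun x => (normalEv b xs).le_opNorm _) bH
  have bEv' : eLpNorm (fun x => normalFun μ xs (normalEv b xs
      (hsL b (fderiv ℝ (fderiv ℝ f) x)))) 2 (μ.restrict S) ≤ ENNReal.ofReal (A * (N * 1)) * δ :=
    eLpNorm_le_ofReal_mul hA0 (fun x => (normalFun μ xs).le_opNorm _) bEv
  have bt : ∀ s ∈ Icc (r - ε) r, eLpNorm (fun x => fderiv ℝ f x (normalDir μ xs)
      - fderiv ℝ f (fib μ xs x s) (normalDir μ xs)) 2 (μ.restrict S)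
      ≤ ENNReal.ofReal (k₁ * ε) * δ := fun s hs =>
    (poincare_strip_ofReal hcent h0 hc hC hcC ndt hε hs bEv').trans
      (le_of_eq (by rw [hk₁]; congr 2; ring))
  -- The slice `r` enters here only through first derivatives: the normal derivative on the strip is
  -- its value on the hyperplane plus an oscillation.
  have bft : eLpNorm (fun x => fderiv ℝ f x (normalDir μ xs)) 2 (μ.restrict S)
      ≤ ENNReal.ofReal (k₃ * ε) * δ := by
    have h1 := eLpNorm_add_le_ofReal_mul (k := k₁ * ε) (k' := √C * ε)
      (F := fun x => fderiv ℝ f x (normalDir μ xs) - fderiv ℝ f (fib μ xs x r) (normalDir μ xs))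
      (G := fun x => fderiv ℝ f (fib μ xs x r) (normalDir μ xs)) (by positivity) (by positivity)
      (cft.sub cftr).aestronglyMeasurable cftr.aestronglyMeasurable (bt r hr)
      (eLpNorm_normal_le_bdrySize b hcent h0 hC hcC hε hf.c2b)
    simp only [sub_add_cancel] at h1
    exact h1.trans (le_of_eq (by rw [hk₃]; congr 2; ring))
  -- The bound on the strip is carried back to the slice `t` by one more oscillation.
  have bfts : eLpNorm (fun x => fderiv ℝ f (fib μ xs x t) (normalDir μ xs)) 2 (μ.restrict S)
      ≤ ENNReal.ofReal ((k₃ + k₁) * ε) * δ := by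
    have h2 : eLpNorm (fun x => fderiv ℝ f (fib μ xs x t) (normalDir μ xs)
        - fderiv ℝ f x (normalDir μ xs)) 2 (μ.restrict S) ≤ ENNReal.ofReal (k₁ * ε) * δ :=
      (eLpNorm_sub_comm _ _ _ _).le.trans (bt t ht)
    have h1 := eLpNorm_add_le_ofReal_mul (k := k₃ * ε) (k' := k₁ * ε)
      (F := fun x => fderiv ℝ f x (normalDir μ xs))
      (G := fun x => fderiv ℝ f (fib μ xs x t) (normalDir μ xs) - fderiv ℝ f x (normalDir μ xs))
      (by positivity) (by positivity) cft.aestronglyMeasurable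
      (cftt.sub cft).aestronglyMeasurable bft h2
    simp only [add_sub_cancel] at h1
    exact h1.trans (le_of_eq (by congr 2; ring))
  refine ⟨t, ?_, ?_, ?_⟩
  · exact (poincare_strip_ofReal hcent h0 hc hC hcC hf.c2b.hasNormalDeriv hε ht bft).trans
      (le_of_eq (by congr 2; ring))
  · simp only [repL_fderiv_sub_fib hf]
    have h1 := poincare_strip_ofReal hcent h0 hc hC hcC ndg hε ht bEv
    have h2 : eLpNorm (fun x => fderiv ℝ f (fib μ xs x t) (normalDir μ xs) • repL μ xs) 2
        (μ.restrict S) ≤ ENNReal.ofReal (‖repL μ xs‖ * ((k₃ + k₁) * ε)) * δ :=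
      eLpNorm_le_ofReal_mul (norm_nonneg (repL μ xs))
        (fun x => by rw [norm_smul, mul_comm]) bfts
    refine (eLpNorm_add_le_ofReal_mul
      (F := fun x => repL μ (fderiv ℝ f x) - repL μ (fderiv ℝ f (fib μ xs x t)))
      (G := fun x => fderiv ℝ f (fib μ xs x t) (normalDir μ xs) • repL μ xs)
      (by positivity) (by positivity) (cgrad.sub cgradt).aestronglyMeasurable
      (cftt.smul continuous_const).aestronglyMeasurable h1 h2).trans (le_of_eq ?_)
    congr 2
    ring
  · simp only [hsL_fderiv_sub_fib b hf]
    have h2 : eLpNorm (fun x => -hessMap b xs 1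
        (hsL b (fderiv ℝ (fderiv ℝ f) (fib μ xs x t)))) 2 (μ.restrict S)
        ≤ ENNReal.ofReal (‖hessMap b xs 1‖ * 1) * δ :=
      eLpNorm_le_ofReal_mul (norm_nonneg (hessMap b xs 1))
        (fun x => by rw [norm_neg]; exact (hessMap b xs 1).le_opNorm _) (hslice.trans bH)
    rw [mul_one] at h2
    exact eLpNorm_add_le_ofReal_mul (F := fun x => hsL b (fderiv ℝ (fderiv ℝ f) x))
      (G := fun x => -hessMap b xs 1 (hsL b (fderiv ℝ (fderiv ℝ f) (fib μ xs x t))))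
      zero_le_one (norm_nonneg _) cH.aestronglyMeasurable
      (((hessMap b xs 1).continuous.comp (cH.comp cfib)).neg).aestronglyMeasurable bH h2

/-- Estimates of a function localized near the hyperplane. -/
theorem exists_localization_bound (xs : StrongDual ℝ X) (r : ℝ) {k₅ k₇ k₈ : ℝ} (hk₅0 : 0 ≤ k₅)
    (hk₇0 : 0 ≤ k₇) (hk₈0 : 0 ≤ k₈) : ∃ K : ℝ, 0 ≤ K ∧ ∀ ε ∈ Ioc (0 : ℝ) 1,
      ∀ (ψ : X → ℝ) (δ : ℝ≥0∞), C2b ψ →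
        eLpNorm ψ 2 (μ.restrict (strip xs r ε)) ≤ ENNReal.ofReal (k₅ * ε ^ 2) * δ →
        eLpNorm (fun x => repL μ (fderiv ℝ ψ x)) 2 (μ.restrict (strip xs r ε))
          ≤ ENNReal.ofReal (k₇ * ε) * δ →
        eLpNorm (fun x => hsL b (fderiv ℝ (fderiv ℝ ψ) x)) 2 (μ.restrict (strip xs r ε))
          ≤ ENNReal.ofReal k₈ * δ →
        ∀ hχ : C2b (fun x => cutoff (ε⁻¹ * (xs x - r)) * ψ x),
          ‖jet b (μ.restrict (halfSpace xs r)) hχ‖ₑ ≤ ENNReal.ofReal K * δ := by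
  obtain ⟨D, hφ⟩ := exists_isProfile_cutoff
  have hD0 := hφ.nonneg
  -- Each derivative falling on the cutoff costs `ε⁻¹`, which is matched by the orders `ε²`, `ε` and
  -- `1` of the estimates of `ψ` and its derivatives. The constants are therefore independent of
  -- `ε`.
  set K₀ := D * k₅
  set K₁ := D * k₇ + D * ‖repL μ xs‖ * k₅
  set K₂ := D * k₈ + D * ‖symTen b (repL μ xs)‖ * k₇
    + D * ‖tenR b (repL μ xs) (repL μ xs)‖ * k₅
  have hK₀ : 0 ≤ K₀ := by positivity
  have hK₁ : 0 ≤ K₁ := by positivity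
  have hK₂ : 0 ≤ K₂ := by positivity
  refine ⟨K₀ + K₁ + K₂, by positivity, fun ε hε ψ δ hψ bψ bDψ bHψ hχ => ?_⟩
  have hε0 : 0 < ε := hε.1
  have cψ := hψ.1.continuous
  have cDψ : Continuous fun x => repL μ (fderiv ℝ ψ x) :=
    (repL μ).continuous.comp hψ.continuous_fderiv
  have cHψ : Continuous fun x => hsL b (fderiv ℝ (fderiv ℝ ψ) x) :=
    (hsL b).continuous.comp hψ.continuous_hess
  have cTψ : Continuous fun x => symTen b (repL μ xs) (repL μ (fderiv ℝ ψ x)) :=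
    (symTen b (repL μ xs)).continuous.comp cDψ
  have d1 := fun x => repL_fderiv_mul (μ := μ) (xs := xs) hψ (hφ.hasDerivAt ε⁻¹ r) x
  have d2 := fun x => hsL_fderiv_mul b (xs := xs) hψ (hφ.hasDerivAt ε⁻¹ r)
    (hφ.hasDerivAt_deriv ε⁻¹ r) x
  have hfar : ∀ x, xs x < r - ε → 1 < |ε⁻¹ * (xs x - r)| := fun x hx => by
    rw [abs_mul, abs_of_pos (inv_pos.2 hε0), ← div_eq_inv_mul, lt_div_iff₀ hε0, one_mul, lt_abs]
    right
    linarith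
  have hτc : Continuous fun x => ε⁻¹ * (xs x - r) :=
    continuous_const.mul (xs.continuous.sub continuous_const)
  have hc0 : Continuous fun x => cutoff (ε⁻¹ * (xs x - r)) := contDiff_cutoff.continuous.comp hτc
  have hc1 : Continuous fun x => ε⁻¹ * deriv cutoff (ε⁻¹ * (xs x - r)) :=
    continuous_const.mul ((contDiff_infty_iff_deriv.1 hφ.contDiff).2.continuous.comp hτc)
  have hc2 : Continuous fun x => ε⁻¹ ^ 2 * deriv (deriv cutoff) (ε⁻¹ * (xs x - r)) :=
    continuous_const.mul ((contDiff_infty_iff_deriv.1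
      (contDiff_infty_iff_deriv.1 hφ.contDiff).2).2.continuous.comp hτc)
  have v1 : ∀ x, |ε⁻¹ * deriv cutoff (ε⁻¹ * (xs x - r))| ≤ ε⁻¹ * D := fun x => by
    rw [abs_mul, abs_of_pos (inv_pos.2 hε0)]
    gcongr
    exact (hφ.bound _).2.1
  have v2 : ∀ x, |ε⁻¹ ^ 2 * deriv (deriv cutoff) (ε⁻¹ * (xs x - r))| ≤ ε⁻¹ ^ 2 * D := fun x => by
    rw [abs_mul, abs_of_pos (pow_pos (inv_pos.2 hε0) 2)]
    gcongr
    exact (hφ.bound _).2.2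
  have j0 : eLpNorm (fun x => cutoff (ε⁻¹ * (xs x - r)) * ψ x) 2 (μ.restrict (halfSpace xs r))
      ≤ ENNReal.ofReal K₀ * δ := by
    rw [eLpNorm_restrict_halfSpace_eq (ε := ε) fun x hx => by
      rw [cutoff_eq_zero (hfar x hx).le, zero_mul]]
    refine eLpNorm_ofReal_mono ?_ (eLpNorm_le_ofReal_mul hD0 (fun x => ?_) bψ)
    · exact mul_le_mul_of_nonneg_left (mul_le_of_le_one_right hk₅0
        (pow_le_one₀ hε0.le hε.2)) hD0
    · rw [norm_mul]
      gcongr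
      exact (hφ.bound _).1
  have j1 : eLpNorm (fun x => repL μ (fderiv ℝ (fun x => cutoff (ε⁻¹ * (xs x - r)) * ψ x) x)) 2
      (μ.restrict (halfSpace xs r)) ≤ ENNReal.ofReal K₁ * δ := by
    simp only [d1]
    rw [eLpNorm_restrict_halfSpace_eq (ε := ε) fun x hx => by
      rw [cutoff_eq_zero (hfar x hx).le, (hφ.flat _ (hfar x hx)).1]; simp]
    refine eLpNorm_ofReal_mono ?_ (eLpNorm_add_le_ofReal_mul
      (F := fun x => cutoff (ε⁻¹ * (xs x - r)) • repL μ (fderiv ℝ ψ x))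
      (G := fun x => (ε⁻¹ * deriv cutoff (ε⁻¹ * (xs x - r)) * ψ x) • repL μ xs)
      (k := D * (k₇ * ε)) (k' := (ε⁻¹ * D * ‖repL μ xs‖) * (k₅ * ε ^ 2)) (by positivity) (by positivity)
      (hc0.smul cDψ).aestronglyMeasurable
      ((hc1.mul cψ).smul continuous_const).aestronglyMeasurable
      (eLpNorm_le_ofReal_mul hD0 (fun x => ?_) bDψ)
      (eLpNorm_le_ofReal_mul (by positivity) (fun x => ?_) bψ))
    · have e : ε⁻¹ * D * ‖repL μ xs‖ * (k₅ * ε ^ 2) = D * ‖repL μ xs‖ * k₅ * ε := by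
        field_simp
      rw [e]
      refine add_le_add (mul_le_mul_of_nonneg_left (mul_le_of_le_one_right hk₇0 hε.2) hD0)
        (mul_le_of_le_one_right (by positivity) hε.2)
    · rw [norm_smul]
      gcongr
      exact (hφ.bound _).1
    · rw [norm_smul, norm_mul, mul_right_comm]
      gcongr
      exact v1 x
  have j2 : eLpNorm (fun x => hsL b
      (fderiv ℝ (fderiv ℝ (fun x => cutoff (ε⁻¹ * (xs x - r)) * ψ x)) x)) 2
      (μ.restrict (halfSpace xs r)) ≤ ENNReal.ofReal K₂ * δ := by
    simp only [d2]
    rw [eLpNorm_restrict_halfSpace_eq (ε := ε) fun x hx => by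
      rw [cutoff_eq_zero (hfar x hx).le, (hφ.flat _ (hfar x hx)).1,
        (hφ.flat _ (hfar x hx)).2]; simp]
    refine eLpNorm_ofReal_mono (le_of_eq ?_) (eLpNorm_add_le_ofReal_mul
      (F := fun x => cutoff (ε⁻¹ * (xs x - r)) • hsL b (fderiv ℝ (fderiv ℝ ψ) x)
        + (ε⁻¹ * deriv cutoff (ε⁻¹ * (xs x - r))) •
          symTen b (repL μ xs) (repL μ (fderiv ℝ ψ x)))
      (G := fun x => (ε⁻¹ ^ 2 * deriv (deriv cutoff) (ε⁻¹ * (xs x - r)) * ψ x) •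
        tenR b (repL μ xs) (repL μ xs))
      (k := D * k₈ + (ε⁻¹ * D * ‖symTen b (repL μ xs)‖) * (k₇ * ε))
      (k' := (ε⁻¹ ^ 2 * D * ‖tenR b (repL μ xs) (repL μ xs)‖) * (k₅ * ε ^ 2))
      (by positivity) (by positivity)
      ((hc0.smul cHψ).add
        (hc1.smul cTψ)).aestronglyMeasurable
      ((hc2.mul cψ).smul continuous_const).aestronglyMeasurable
      (eLpNorm_add_le_ofReal_mul
        (F := fun x => cutoff (ε⁻¹ * (xs x - r)) • hsL b (fderiv ℝ (fderiv ℝ ψ) x))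
        (G := fun x => (ε⁻¹ * deriv cutoff (ε⁻¹ * (xs x - r))) •
          symTen b (repL μ xs) (repL μ (fderiv ℝ ψ x))) (by positivity) (by positivity)
        (hc0.smul cHψ).aestronglyMeasurable
        (hc1.smul cTψ).aestronglyMeasurable
        (eLpNorm_le_ofReal_mul hD0 (fun x => ?_) bHψ)
        (eLpNorm_le_ofReal_mul (by positivity) (fun x => ?_) bDψ))
      (eLpNorm_le_ofReal_mul (by positivity) (fun x => ?_) bψ))
    · simp only [K₂]
      field_simp
    · rw [norm_smul]
      gcongr
      exact (hφ.bound _).1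
    · rw [norm_smul, mul_assoc]
      gcongr
      · exact v1 x
      · exact (symTen b (repL μ xs)).le_opNorm _
    · rw [norm_smul, norm_mul, mul_right_comm]
      gcongr
      exact v2 x
  have hm0 : K₀ ≤ K₀ + K₁ + K₂ := by linarith
  have hm1 : K₁ ≤ K₀ + K₁ + K₂ := by linarith
  have hm2 : K₂ ≤ K₀ + K₁ + K₂ := by linarith
  refine enorm_prod_le ?_ (enorm_prod_le ?_ ?_)
  · rw [Lp.enorm_def]
    exact (eLpNorm_congr_ae (jet_fst b hχ)).le.trans (eLpNorm_ofReal_mono hm0 j0)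
  · rw [Lp.enorm_def]
    exact (eLpNorm_congr_ae (jet_grad b hχ)).le.trans (eLpNorm_ofReal_mono hm1 j1)
  · rw [Lp.enorm_def]
    exact (eLpNorm_congr_ae (jet_hess b hχ)).le.trans (eLpNorm_ofReal_mono hm2 j2)

/-- Functions whose normal derivative is small on the hyperplane are close to functions whose
normal derivative vanishes there. -/
theorem exists_correction (hcent : ∀ L : StrongDual ℝ X, μ[L] = 0) (h0 : repL μ xs ≠ 0) (r : ℝ) :
    ∃ K : ℝ, 0 ≤ K ∧ ∀ ε ∈ Ioc (0 : ℝ) 1, ∀ (f : X → ℝ) (hf : IsFCbInf f), BddNormal xs f →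
      ∃ (g : X → ℝ) (hg : IsFCbInf g), BddNormal xs g ∧
        (∀ x, xs x = r → fderiv ℝ g x (normalDir μ xs) = 0) ∧
        ‖jet b (μ.restrict (halfSpace xs r)) hg.c2b - jet b (μ.restrict (halfSpace xs r)) hf.c2b‖ₑ
          ≤ ENNReal.ofReal K * bdrySize b xs r ε f := by
  obtain ⟨k₅, k₇, k₈, hk₅, hk₇, hk₈, hest⟩ := exists_slice_estimates b hcent h0 r
  obtain ⟨K, hK, hloc⟩ := exists_localization_bound b xs r hk₅ hk₇ hk₈
  refine ⟨K, hK, fun ε hε f hf hfM => ?_⟩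
  have hε0 : 0 < ε := hε.1
  obtain ⟨t, b0, b1, b2⟩ := hest ε hε f hf
  obtain ⟨D, hφ⟩ := exists_isProfile_cutoff
  have hψ : IsFCbInf fun x => f x - f (fib μ xs x t) :=
    hf.sub (hf.comp_aff xs (normalDir μ xs) 1 t)
  have hfar : ∀ s, ε < |s - r| → 1 ≤ |ε⁻¹ * (s - r)| := fun s hs => by
    rw [abs_mul, abs_of_pos (inv_pos.2 hε0), ← div_eq_inv_mul, le_div_iff₀ hε0, one_mul]
    exact hs.le
  have hχ : IsFCbInf fun x => cutoff (ε⁻¹ * (xs x - r)) * (f x - f (fib μ xs x t)) := by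
    refine hψ.mul_comp xs (m := fun t => cutoff (ε⁻¹ * (t - r)))
      (contDiff_cutoff.comp (contDiff_const.mul (contDiff_id.sub contDiff_const)))
      (HasCompactSupport.intro (isCompact_closedBall r ε) fun s hs =>
        cutoff_eq_zero (hfar s ?_))
    rwa [Metric.mem_closedBall, not_le, Real.dist_eq] at hs
  -- The corrected function is `f - χ(G/ε)(f - f ∘ π_t)`, which is `f ∘ π_t` near the hyperplane and
  -- hence constant along the fibers there.
  refine ⟨_, hf.add (hχ.const_mul (-1)), ?_, fun x hx => ?_, ?_⟩
  · obtain ⟨M, hM⟩ := hfM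
    refine ⟨max M (|r| + ε), fun x hx => ?_⟩
    have h1 : ε < |xs x - r| := by
      have := abs_sub_abs_le_abs_sub (xs x) r
      linarith [(le_max_right M (|r| + ε)).trans_lt hx]
    have h2 := hM x ((le_max_left _ _).trans_lt hx)
    have h3 := cutoff_eq_zero (hfar _ h1)
    simp only [h2, h3, zero_mul, mul_zero, add_zero]
  · have hw : |ε⁻¹ * (xs x - r)| < 1 / 2 := by simp [hx]
    have d1 := repL_fderiv_mul (μ := μ) (xs := xs) hψ.c2b (hφ.hasDerivAt ε⁻¹ r) x
    rw [(deriv_cutoff hw).1, cutoff_eq_one hw.le, repL_fderiv_sub_fib hf, fderiv_normalDir_eq] at d1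
    have hNe : normalFun μ xs (repL μ xs) = 1 := by
      rw [← xs_normalDir h0, dual_normalDir]
      rfl
    rw [fderiv_add_fun hf.c2b (hχ.const_mul (-1)).c2b, fderiv_const_mul_fun (-1) hχ.c2b,
      add_apply, smul_apply, fderiv_normalDir_eq, fderiv_normalDir_eq, d1]
    simp [hNe]
  · rw [jet_add b hf.c2b (hχ.const_mul (-1)).c2b, jet_const_mul b (-1) hχ.c2b, add_sub_cancel_left,
      neg_one_smul, enorm_neg]
    exact hloc ε hε _ _ hψ.c2b b0 b1 b2 hχ.c2b

end Density

/-! ### Density in the Neumann space and the averaged reflection -/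

section Extension

variable {X : Type*} [NormedAddCommGroup X] [NormedSpace ℝ X] [MeasurableSpace X] [BorelSpace X]
  [CompleteSpace X] [SecondCountableTopology X] {μ : Measure X} [IsGaussian μ] {ι : Type*}
  (b : HilbertBasis ι ℝ (CM μ)) {xs : StrongDual ℝ X} {r : ℝ}

/-- Absolute continuity of the integral, since the mass of the strips is at most a multiple of their
width. -/
theorem tendsto_eLpNorm_strip {V : Type*} [NormedAddCommGroup V]
    (hcent : ∀ L : StrongDual ℝ X, μ[L] = 0) (h0 : repL μ xs ≠ 0)
    (u : Lp V 2 (μ.restrict (halfSpace xs r))) :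
    Tendsto (fun n : ℕ => eLpNorm u 2 (μ.restrict (strip xs r (1 / ((n : ℝ) + 1))))) atTop
      (𝓝 0) := by
  obtain ⟨c, C, hc, hC, hcC⟩ := exists_dens_bounds μ xs h0 r
  have hε : ∀ n : ℕ, 1 / ((n : ℝ) + 1) ∈ Ioc (0 : ℝ) 1 := fun n =>
    ⟨by positivity, by
      rw [div_le_one (by positivity)]
      linarith [(Nat.cast_nonneg n : (0 : ℝ) ≤ n)]⟩
  have hres : ∀ ε : ℝ, μ.restrict (strip xs r ε)
      = (μ.restrict (halfSpace xs r)).restrict (strip xs r ε) := fun ε => by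
    rw [Measure.restrict_restrict measurableSet_strip,
      inter_eq_self_of_subset_left strip_subset_halfSpace]
  have hmeas : Tendsto (fun n : ℕ => (μ.restrict (halfSpace xs r))
      (strip xs r (1 / ((n : ℝ) + 1)))) atTop (𝓝 0) := by
    have hlim : Tendsto (fun n : ℕ => ENNReal.ofReal C * ENNReal.ofReal (1 / ((n : ℝ) + 1)))
        atTop (𝓝 0) := by
      have h1 := ENNReal.tendsto_ofReal (tendsto_one_div_add_atTop_nhds_zero_nat (𝕜 := ℝ))
      have h2 := ENNReal.Tendsto.const_mul (a := ENNReal.ofReal C) h1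
        (Or.inr ENNReal.ofReal_ne_top)
      simpa using h2
    refine tendsto_zero_of_le hlim fun n => ?_
    refine (Measure.restrict_apply_le _ _).trans ?_
    have h1 := setLIntegral_strip_of_const (r := r) (ε := 1 / ((n : ℝ) + 1)) hcent h0
      (g := fun _ => 1) measurable_const (fun _ _ => rfl)
    simp only [lintegral_const, one_mul, Measure.restrict_apply MeasurableSet.univ, univ_inter,
      measure_univ, mul_one] at h1
    rw [h1]
    exact (normalLaw_Icc_le h0 hcC (hε n)).2
  have hfin : ∫⁻ x, ‖u x‖ₑ ^ 2 ∂(μ.restrict (halfSpace xs r)) ≠ ⊤ := by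
    rw [← eLpNorm_two_sq]
    exact ENNReal.pow_ne_top (Lp.eLpNorm_ne_top u)
  have hsq := tendsto_setLIntegral_zero hfin hmeas
  rw [ENNReal.tendsto_nhds_zero] at hsq ⊢
  intro η hη
  filter_upwards [hsq (η ^ 2) (pos_of_ne_zero (pow_ne_zero 2 hη.ne'))] with n hn
  rw [← ENNReal.pow_le_pow_left_iff two_ne_zero, eLpNorm_two_sq, hres]
  exact hn

/-- The triples of smooth cylindrical functions that vanish for large `x*` and whose normal
derivative vanishes on the hyperplane are dense in `W^{2,2}_{0,N}`. -/
theorem mem_closure_neumann (hcent : ∀ L : StrongDual ℝ X, μ[L] = 0) (h0 : repL μ xs ≠ 0)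
    {u : W22 μ (μ.restrict (halfSpace xs r)) b} (hu : u ∈ W22N μ b xs r) :
    u.1 ∈ closure {p | ∃ (g : X → ℝ) (hg : IsFCbInf g), BddNormal xs g ∧
      (∀ x, xs x = r → fderiv ℝ g x (normalDir μ xs) = 0) ∧
      p = jet b (μ.restrict (halfSpace xs r)) hg.c2b} := by
  obtain ⟨f, hf, hfM, hlim⟩ := exists_bddNormal_jet_tendsto b xs u.2
  have htr := tendsto_normal_trace b hcent h0 hu (fun n => (hf n).c2b) hlim
  obtain ⟨K, hK, hcorr⟩ := exists_correction b hcent h0 r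
  have hess := tendsto_eLpNorm_sub_of_toLp
    (fun n => (hf n).c2b.memLp_hess b (ν := μ.restrict (halfSpace xs r)) 2)
    ((continuous_snd.tendsto _).comp ((continuous_snd.tendsto _).comp hlim))
  rw [EMetric.mem_closure_iff]
  intro η hη
  have hstrip := ENNReal.Tendsto.const_mul (a := ENNReal.ofReal K)
    (tendsto_eLpNorm_strip hcent h0 u.1.2.2) (Or.inr ENNReal.ofReal_ne_top)
  rw [mul_zero] at hstrip
  -- The width is fixed by the second derivative of the limit `u` alone. Only then does `n` grow, so
  -- that the boundary term with the large factor `ε^{-1/2}` still tends to 0.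
  obtain ⟨m, hm⟩ := (hstrip.eventually (gt_mem_nhds hη)).exists
  set ε : ℝ := 1 / ((m : ℝ) + 1) with hεdef
  have hε : ε ∈ Ioc (0 : ℝ) 1 := ⟨by positivity, by
    rw [hεdef, div_le_one (by positivity)]
    linarith [(Nat.cast_nonneg m : (0 : ℝ) ≤ m)]⟩
  set U := eLpNorm u.1.2.2 2 (μ.restrict (strip xs r ε)) with hU
  have hrest : μ.restrict (strip xs r ε) ≤ μ.restrict (halfSpace xs r) :=
    Measure.restrict_mono strip_subset_halfSpace le_rfl
  have hd : Tendsto (fun n => edist (jet b (μ.restrict (halfSpace xs r)) (hf n).c2b) u.1) atTop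
      (𝓝 0) := tendsto_iff_edist_tendsto_0.1 hlim
  have htot := (ENNReal.Tendsto.const_mul (a := ENNReal.ofReal K)
    ((hess.add_const U).add (ENNReal.Tendsto.const_mul (a := ENNReal.ofReal (√ε)⁻¹) htr
      (Or.inr ENNReal.ofReal_ne_top))) (Or.inr ENNReal.ofReal_ne_top)).add hd
  rw [mul_zero, add_zero, add_zero, zero_add] at htot
  obtain ⟨n, hn⟩ := (htot.eventually (gt_mem_nhds hm)).exists
  obtain ⟨g, hg, hgM, hgN, hgf⟩ := hcorr ε hε (f n) (hf n) (hfM n)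
  refine ⟨_, ⟨g, hg, hgM, hgN, rfl⟩, ?_⟩
  rw [edist_comm]
  refine lt_of_le_of_lt ((edist_triangle _ (jet b (μ.restrict (halfSpace xs r)) (hf n).c2b) _).trans
    (add_le_add ?_ le_rfl)) hn
  rw [edist_eq_enorm_sub]
  refine hgf.trans ?_
  rw [bdrySize]
  gcongr
  have e : (fun x => hsL b (fderiv ℝ (fderiv ℝ (f n)) x))
      = (fun x => hsL b (fderiv ℝ (fderiv ℝ (f n)) x) - u.1.2.2 x) + u.1.2.2 := by
    funext x
    simp
  have hum : AEStronglyMeasurable u.1.2.2 (μ.restrict (halfSpace xs r)) :=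
    Lp.aestronglyMeasurable _
  have hfm : AEStronglyMeasurable (fun x => hsL b (fderiv ℝ (fderiv ℝ (f n)) x))
      (μ.restrict (halfSpace xs r)) :=
    ((hsL b).continuous.comp (hf n).c2b.continuous_hess).aestronglyMeasurable
  rw [e]
  refine (eLpNorm_add_le ((hfm.sub hum).mono_measure hrest) (hum.mono_measure hrest)
    (by norm_num)).trans (add_le_add ?_ le_rfl)
  exact eLpNorm_mono_measure _ hrest

theorem reflOp_mem (hcent : ∀ L : StrongDual ℝ X, μ[L] = 0) (h0 : repL μ xs ≠ 0) {k a : ℝ}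
    {c : ℝ≥0} (hk : 1 < k) (h : IsReflWeight μ xs k r a c)
    {u : W22 μ (μ.restrict (halfSpace xs r)) b} (hu : u ∈ W22N μ b xs r) :
    reflOp b h u.1 ∈ W22 μ μ b := by
  have hcl : IsClosed (reflOp b h ⁻¹' (W22 μ μ b : Set _)) :=
    (Submodule.isClosed_topologicalClosure _).preimage (reflOp b h).continuous
  refine hcl.closure_subset_iff.2 ?_ (mem_closure_neumann b hcent h0 hu)
  rintro p ⟨g, hg, hgM, hgN, rfl⟩
  exact reflOp_jet_mem b hcent h0 hk h hg hgM hgN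

/-- The average of the seven reflections, on triples. -/
def extOp {a : Fin 7 → ℝ} {c : Fin 7 → ℝ≥0}
    (h : ∀ j : Fin 7, IsReflWeight μ xs (((j : ℕ) : ℝ) + 2) r (a j) (c j)) :
    (Lp ℝ 2 (μ.restrict (halfSpace xs r)) × Lp (CM μ) 2 (μ.restrict (halfSpace xs r)) ×
      Lp (HS μ ι) 2 (μ.restrict (halfSpace xs r))) →L[ℝ]
    (Lp ℝ 2 μ × Lp (CM μ) 2 μ × Lp (HS μ ι) 2 μ) :=
  -- Each summand is an extension by itself, so any coefficients with sum 1 would do. The slope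
  -- parameter is `j + 2` because the index `j` starts at 0.
  ∑ j : Fin 7, (1 / 7 : ℝ) • reflOp b (h j)

variable {a : Fin 7 → ℝ} {c : Fin 7 → ℝ≥0}

theorem extOp_apply (h : ∀ j : Fin 7, IsReflWeight μ xs (((j : ℕ) : ℝ) + 2) r (a j) (c j))
    (u : Lp ℝ 2 (μ.restrict (halfSpace xs r)) × Lp (CM μ) 2 (μ.restrict (halfSpace xs r)) ×
      Lp (HS μ ι) 2 (μ.restrict (halfSpace xs r))) :
    extOp b h u = ∑ j : Fin 7, (1 / 7 : ℝ) • reflOp b (h j) u := by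
  simp only [extOp, sum_apply, smul_apply]

theorem extOp_fst_coe (h : ∀ j : Fin 7, IsReflWeight μ xs (((j : ℕ) : ℝ) + 2) r (a j) (c j))
    (u : Lp ℝ 2 (μ.restrict (halfSpace xs r)) × Lp (CM μ) 2 (μ.restrict (halfSpace xs r)) ×
      Lp (HS μ ι) 2 (μ.restrict (halfSpace xs r))) :
    ∀ᵐ x ∂μ, (x ∈ halfSpace xs r → (extOp b h u).1 x = u.1 x) ∧ (x ∉ halfSpace xs r →
      (extOp b h u).1 x = ∑ j : Fin 7, (1 / 7 : ℝ) * (gw (a j) (xs x - r) *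
        u.1 (aff xs (normalDir μ xs) (((j : ℕ) : ℝ) + 2) r x))) := by
  have e : (extOp b h u).1 = ∑ j : Fin 7, (1 / 7 : ℝ) • reflFn (h j) u.1 := by
    rw [extOp_apply, Prod.fst_sum]
    rfl
  have h1 : ∀ᵐ x ∂μ, ∀ j : Fin 7, ((1 / 7 : ℝ) • reflFn (h j) u.1) x
      = (1 / 7 : ℝ) * reflFn (h j) u.1 x :=
    ae_all_iff.2 fun j => Lp.coeFn_smul (1 / 7 : ℝ) (reflFn (h j) u.1)
  filter_upwards [ae_all_iff.2 fun j => reflFn_coe (h j) u.1, h1,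
    Lp.coeFn_finsetSum Finset.univ fun j : Fin 7 => (1 / 7 : ℝ) • reflFn (h j) u.1]
    with x h2 h3 h4
  rw [e, h4]
  simp only [Finset.sum_apply, h3]
  constructor
  · intro hx
    simp only [(h2 _).1 hx]
    simp
  · intro hx
    simp only [(h2 _).2 hx]

theorem aff_normalDir (k : ℝ) (x : X) : aff xs (normalDir μ xs) k r x
    = x - (k * (xs x - r) / ‖rep μ xs‖ ^ 2) • emb μ (rep μ xs) := by
  rw [aff, normalDir, smul_smul, embL_apply, repL_apply, div_eq_mul_inv]

/-- The prescribed exponent is divided by `2 |h|`, so the rate `α` becomes the quadratic coefficient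
`α |h|`, and the linear coefficient is 0. -/
theorem gw_eq (h0 : repL μ xs ≠ 0) (α τ : ℝ) : gw α τ
    = Real.exp (-(0 * τ + (α * ‖rep μ xs‖) * τ ^ 2) / (2 * ‖rep μ xs‖)) := by
  have : ‖rep μ xs‖ ≠ 0 := norm_ne_zero_iff.2 h0
  rw [gw]
  congr 1
  field_simp
  ring

end Extension

end GaussSobolev

end

/-! ### The Neumann extension operator -/

theorem mainTheorem8 {X : Type*} [NormedAddCommGroup X] [NormedSpace ℝ X] [CompleteSpace X]
    [SecondCountableTopology X] [MeasurableSpace X] [BorelSpace X]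
    (μ : Measure X) [IsGaussian μ]
    (hcent : ∀ L : StrongDual ℝ X, μ[L] = 0)
    (hnd : ∀ L : StrongDual ℝ X, L ≠ 0 → 0 < Var[L; μ])
    {ι : Type*} (b : HilbertBasis ι ℝ (GaussSobolev.CM μ))
    (xs : StrongDual ℝ X) (hxs : xs ≠ 0) (r : ℝ) :
    ∃ E : GaussSobolev.W22N μ b xs r →ₗ[ℝ] GaussSobolev.W22 μ μ b,
      GaussSobolev.IsNeumannExtension E ∧
      ∃ a d c : Fin 7 → ℝ, ∀ u : GaussSobolev.W22N μ b xs r, ∀ᵐ x ∂μ, r < xs x →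
        GaussSobolev.W22.fn (E u) x =
          GaussSobolev.reflection μ xs r a d c (GaussSobolev.W22.fn u.1) x := by
  open GaussSobolev in
  have h0 : repL μ xs ≠ 0 := repL_ne_zero (hnd xs hxs) (hcent xs)
  have hk : ∀ j : Fin 7, (1 : ℝ) < ((j : ℕ) : ℝ) + 2 := fun j => by
    linarith [(Nat.cast_nonneg (j : ℕ) : (0 : ℝ) ≤ ((j : ℕ) : ℝ))]
  choose c hc using fun j : Fin 7 => exists_isReflWeight (μ := μ) (xs := xs) hcent h0 (hk j) r
  have hmem : ∀ u : W22N μ b xs r, extOp b hc u.1.1 ∈ W22 μ μ b := fun u => by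
    rw [extOp_apply]
    exact Submodule.sum_mem _ fun j _ => Submodule.smul_mem _ _
      (reflOp_mem b hcent h0 (hk j) (hc j) u.2)
  let E : W22N μ b xs r →ₗ[ℝ] W22 μ μ b :=
    LinearMap.codRestrict (W22 μ μ b) ((extOp b hc).toLinearMap ∘ₗ
      (W22 μ (μ.restrict (halfSpace xs r)) b).subtype ∘ₗ (W22N μ b xs r).subtype) hmem
  have hE : ∀ u, (E u).1 = extOp b hc u.1.1 := fun u => rfl
  -- The product space carries the maximum norm while `sobNorm` adds the three norms, whence the
  -- factor 3; the summand 1 only makes the constant positive.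
  refine ⟨E, ⟨fun u => ?_, 3 * ‖extOp b hc‖ + 1, by positivity, fun u => ?_⟩,
    fun _ => 1 / 7, fun j => (reflRate μ xs (((j : ℕ) : ℝ) + 2) + 2) * ‖rep μ xs‖, fun _ => 0,
    fun u => ?_⟩
  · have h1 := ae_restrict_of_ae (s := halfSpace xs r) (extOp_fst_coe b hc u.1.1)
    filter_upwards [h1, ae_restrict_mem measurableSet_halfSpace] with x hx hxS
    exact hx.1 hxS
  · have h1 : ‖(E u).1‖ ≤ ‖extOp b hc‖ * ‖u.1.1‖ := (extOp b hc).le_opNorm _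
    have h2 : ‖u.1.1‖ ≤ W22.sobNorm u.1 := by
      rw [Prod.norm_def, Prod.norm_def, W22.sobNorm]
      refine max_le ?_ (max_le ?_ ?_) <;>
      linarith [norm_nonneg u.1.1.1, norm_nonneg u.1.1.2.1, norm_nonneg u.1.1.2.2]
    have h3 : W22.sobNorm (E u) ≤ 3 * ‖(E u).1‖ := by
      have e1 := norm_fst_le (E u).1
      have e2 := (norm_fst_le (E u).1.2).trans (norm_snd_le (E u).1)
      have e3 := (norm_snd_le (E u).1.2).trans (norm_snd_le (E u).1)
      rw [W22.sobNorm]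
      linarith
    have h4 : ‖extOp b hc‖ * ‖u.1.1‖ ≤ ‖extOp b hc‖ * W22.sobNorm u.1 := by gcongr
    have h5 : 0 ≤ W22.sobNorm u.1 := (norm_nonneg _).trans h2
    linarith
  · filter_upwards [extOp_fst_coe b hc u.1.1] with x hx hxr
    refine (hx.2 (not_le.2 hxr)).trans (Finset.sum_congr rfl fun j _ => ?_)
    rw [aff_normalDir, gw_eq h0]
    simp only [W22.fn]
    ring
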